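/- Let $K$ be a field with $\operatorname{char} K\neq 2$ and let $Q=(Q_0,Q_1,\sigma,\tau)$ be a finite quiver with a degree $|a|\in\mathbb Z$ for each arrow; $\beta\alpha$ denotes the path $\alpha$ followed by $\beta$. Let $\Lambda=(KQ/\langle I\rangle,|\cdot|)$ be a graded pinched gentle algebra. That is, $Q_1=Q_1^g\sqcup Q_1^p$ and $I=I^g\sqcup I^p$, where: (i) $Q^g=(Q_0,Q_1^g)$ with $I^g$ is gentle: every vertex has at most two incoming and at most two outgoing arrows in $Q_1^g$; $I^g$ is a set of paths of length two; for each arrow $a\in Q_1^g$ there is at most one arrow $b\in Q_1^g$ such that $ab$ is a path in $I^g$, at most one such that $ab$ is a path not in $I^g$, at most one such that $ba$ is a path in $I^g$, and at most one such that $ba$ is a path not in $I^g$; (ii) $Q_1^p$ is a set of loops of degree $0$ based at pairwise different vertices; (iii) at each vertex $v$ that carries a loop $\gamma_v\in Q_1^p$, the arrows of $Q_1^g$ ending at $v$ can be named $\alpha_v^-,\beta_v^-$ and those starting at $v$ can be named $\alpha_v^+,\beta_v^+$ (any of them may be absent, and an arrow that is a loop has a name of each kind) such that $\beta_v^+\alpha_v^-,\alpha_v^+\beta_v^-\in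 I^g$ and $I^p$ consists of the relations $\beta_v^+(\gamma_v+e_v)$, $(\gamma_v+e_v)\beta_v^-$, $\alpha_v^+(\gamma_v-e_v)$, $(\gamma_v-e_v)\alpha_v^-$ at all these vertices (omitting those with an absent arrow). Let $(\alpha,\beta)$ be a graded Kronecker of $\Lambda$: two distinct arrows of $Q_1^g$ with the same source $1$, the same target $2\neq 1$ and the same degree, such that no loop of $Q_1^p$ is based at $1$ or $2$. Let $\mu\in K\setminus\{0\}$ and $\omega=\alpha+\mu\beta$. Let $\Lambda[\omega^{-1}]$ be the graded algebra obtained by adding to $Q$ an arrow $\delta\colon 2\to 1$ of degree $-|\alpha|$ and to $I$ the relations $\delta\omega-e_1$ and $\omega\delta-e_2$. Let $\alpha^+,\beta^+,\alpha^-,\beta^-$ be the arrows, if they exist, with $\alpha^+\beta,\ \beta^+\alpha,\ \beta\alpha^-,\ \alpha\beta^-\in I$. Let $\Lambda_{(\alpha,\beta)}$ be the graded algebra obtained from $\Lambda$ by removing $\alpha$ and $\beta$, merging $1$ and $2$ into one vertex $1$, adding a loop $\gamma$ of degree $0$ at $1$, replacing the degrees of $\alpha^+$ and $\beta^+$ by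 $|\alpha^+|+|\alpha|$ and $|\beta^+|+|\beta|$, keeping the relations that do not involve $\alpha$ and $\beta$, and adding the relations $$\alpha^+\beta^-,\quad \beta^+\alpha^-,\quad \beta^+(\gamma+e_1),\quad (\gamma+e_1)\beta^-,\quad \alpha^+(\gamma-e_1),\quad (\gamma-e_1)\alpha^-$$ (omitting those with an absent arrow). For a graded algebra $A$, regarded as a DG algebra with zero differential, let $\mathcal D(A)$ be the derived category of right DG $A$-modules, and let $per(A)$ be its smallest full triangulated subcategory that contains $A$ and is closed under isomorphisms and direct summands. Then there are $K$-linear triangulated equivalences $$\mathcal D(\Lambda[\omega^{-1}])\simeq\mathcal D(\Lambda_{(\alpha,\beta)})\qquad\text{and}\qquad per(\Lambda[\omega^{-1}])\simeq per(\Lambda_{(\alpha,\beta)}).$$ -/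

import Mathlib

open CategoryTheory MulOpposite

universe u

noncomputable section

/-! ## Right DG modules over a graded algebra -/

section DGModules

variable {K A : Type u} [Field K] [Ring A] [Algebra K A]

/-- A right DG module over the graded `K`-algebra `A = ⨁ n, 𝒜 n`, regarded as a DG algebra with
zero differential: a right `A`-module (that is, an `Aᵐᵒᵖ`-module) with a decomposition
`⨁ n, gr n` such that `gr n * 𝒜 i ⊆ gr (n + i)`, and a differential of degree `1`.
As the differential of `A` is zero, the Leibniz rule `d (m a) = d m a + (-1) ^ |m| m d a`
says that `d` is `A`-linear. -/
structure DGModule (𝒜 : ℤ → Submodule K A) where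
  carrier : Type u
  [addCommGroup : AddCommGroup carrier]
  [module : Module Aᵐᵒᵖ carrier]
  gr : ℤ → AddSubgroup carrier
  isInternal : DirectSum.IsInternal gr
  smul_mem : ∀ {n i : ℤ} {m : carrier} {a : A}, m ∈ gr n → a ∈ 𝒜 i → op a • m ∈ gr (n + i)
  d : carrier →ₗ[Aᵐᵒᵖ] carrier
  d_mem : ∀ {n : ℤ} {m : carrier}, m ∈ gr n → d m ∈ gr (n + 1)
  d_d : ∀ m : carrier, d (d m) = 0

attribute [instance] DGModule.addCommGroup DGModule.module

namespace DGModule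

variable {𝒜 : ℤ → Submodule K A}

/-- Morphisms of DG modules: `A`-linear maps of degree `0` that commute with the differentials. -/
@[ext]
structure Hom (X Y : DGModule 𝒜) where
  map : X.carrier →ₗ[Aᵐᵒᵖ] Y.carrier
  map_mem : ∀ {n : ℤ} {m : X.carrier}, m ∈ X.gr n → map m ∈ Y.gr n
  comm : ∀ m : X.carrier, map (X.d m) = Y.d (map m)

instance : Category (DGModule 𝒜) where
  Hom X Y := Hom X Y
  id X := ⟨LinearMap.id, fun h => h, fun _ => rfl⟩
  comp f g := ⟨g.map.comp f.map, fun h => g.map_mem (f.map_mem h), fun m => by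
    simp [f.comm, g.comm]⟩

@[ext]
lemma hom_ext {X Y : DGModule 𝒜} {f g : X ⟶ Y} (h : ∀ m, Hom.map f m = Hom.map g m) : f = g :=
  Hom.ext (LinearMap.ext h)

@[simp]
lemma id_map (X : DGModule 𝒜) (m : X.carrier) : Hom.map (𝟙 X) m = m := rfl

@[simp]
lemma comp_map {X Y Z : DGModule 𝒜} (f : X ⟶ Y) (g : Y ⟶ Z) (m : X.carrier) :
    Hom.map (f ≫ g) m = Hom.map g (Hom.map f m) := rfl

lemma isInternal_iff {M : Type u} [AddCommGroup M] (p : ℤ → AddSubgroup M) :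
    DirectSum.IsInternal p ↔ iSupIndep p ∧ ∀ m : M, m ∈ iSup p := by
  have key : (∀ m : M, m ∈ iSup p) ↔
      Function.Surjective (DirectSum.coeAddMonoidHom p) := by
    constructor
    · intro h m
      refine AddSubgroup.iSup_induction p (C := fun m => ∃ x, DirectSum.coeAddMonoidHom p x = m)
        (h m) ?_ ⟨0, by simp⟩ ?_
      · intro i x hx
        exact ⟨DirectSum.of (fun i => p i) i ⟨x, hx⟩, by simp⟩
      · rintro x y ⟨a, rfl⟩ ⟨b, rfl⟩
        exact ⟨a + b, by simp⟩
    · intro h m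
      obtain ⟨x, rfl⟩ := h m
      induction x using DirectSum.induction_on with
      | zero => simp
      | of i x => simpa using AddSubgroup.mem_iSup_of_mem i x.2
      | add x y hx hy => simpa using add_mem hx hy
  rw [key]
  constructor
  · intro h
    exact ⟨h.addSubgroup_iSupIndep, h.2⟩
  · rintro ⟨h1, h2⟩
    exact ⟨h1.dfinsuppSumAddHom_injective, h2⟩

lemma isInternal_shift {M : Type u} [AddCommGroup M] {p : ℤ → AddSubgroup M}
    (h : DirectSum.IsInternal p) (n : ℤ) : DirectSum.IsInternal (fun k => p (k + n)) := by
  rw [isInternal_iff] at h ⊢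
  refine ⟨h.1.comp (add_left_injective n), fun m => ?_⟩
  have := (Equiv.addRight n).iSup_comp (g := p)
  simp only [Equiv.coe_addRight] at this
  rw [this]
  exact h.2 m

lemma isInternal_prod {M N : Type u} [AddCommGroup M] [AddCommGroup N] {p : ℤ → AddSubgroup M}
    {q : ℤ → AddSubgroup N} (hp : DirectSum.IsInternal p) (hq : DirectSum.IsInternal q) :
    DirectSum.IsInternal (fun k => (p k).prod (q k)) := by
  constructor
  · let f : ∀ k, (p k).prod (q k) →+ p k := fun k =>
      ((AddMonoidHom.fst M N).comp ((p k).prod (q k)).subtype).codRestrict (p k) fun x => x.2.1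
    let g : ∀ k, (p k).prod (q k) →+ q k := fun k =>
      ((AddMonoidHom.snd M N).comp ((p k).prod (q k)).subtype).codRestrict (q k) fun x => x.2.2
    have hf : (DirectSum.coeAddMonoidHom p).comp (DirectSum.map f) =
        (AddMonoidHom.fst M N).comp (DirectSum.coeAddMonoidHom fun k => (p k).prod (q k)) := by
      ext k x
      simp only [AddMonoidHom.comp_apply, DirectSum.map_of, DirectSum.coeAddMonoidHom_of]
      rfl
    have hg : (DirectSum.coeAddMonoidHom q).comp (DirectSum.map g) =
        (AddMonoidHom.snd M N).comp (DirectSum.coeAddMonoidHom fun k => (p k).prod (q k)) := by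
      ext k x
      simp only [AddMonoidHom.comp_apply, DirectSum.map_of, DirectSum.coeAddMonoidHom_of]
      rfl
    rw [injective_iff_map_eq_zero]
    intro x hx
    have h1 : DirectSum.map f x = 0 := hp.1 (by
      have := DFunLike.congr_fun hf x
      simp only [AddMonoidHom.comp_apply, hx] at this
      simpa using this)
    have h2 : DirectSum.map g x = 0 := hq.1 (by
      have := DFunLike.congr_fun hg x
      simp only [AddMonoidHom.comp_apply, hx] at this
      simpa using this)
    refine DFinsupp.ext fun k => Subtype.ext (Prod.ext ?_ ?_)
    · have := congrArg Subtype.val (DFunLike.congr_fun h1 k)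
      exact this
    · have := congrArg Subtype.val (DFunLike.congr_fun h2 k)
      exact this
  · have h1 := ((isInternal_iff p).1 hp).2
    have h2 := ((isInternal_iff q).1 hq).2
    let r : ∀ k, p k →+ (p k).prod (q k) := fun k =>
      ((AddMonoidHom.inl M N).comp (p k).subtype).codRestrict ((p k).prod (q k))
        fun x => ⟨x.2, zero_mem _⟩
    let s : ∀ k, q k →+ (p k).prod (q k) := fun k =>
      ((AddMonoidHom.inr M N).comp (q k).subtype).codRestrict ((p k).prod (q k))
        fun x => ⟨zero_mem _, x.2⟩
    have hr : (DirectSum.coeAddMonoidHom fun k => (p k).prod (q k)).comp (DirectSum.map r) =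
        (AddMonoidHom.inl M N).comp (DirectSum.coeAddMonoidHom p) := by
      refine DirectSum.addHom_ext fun k x => ?_
      simp only [AddMonoidHom.comp_apply, DirectSum.map_of, DirectSum.coeAddMonoidHom_of]
      rfl
    have hs : (DirectSum.coeAddMonoidHom fun k => (p k).prod (q k)).comp (DirectSum.map s) =
        (AddMonoidHom.inr M N).comp (DirectSum.coeAddMonoidHom q) := by
      refine DirectSum.addHom_ext fun k x => ?_
      simp only [AddMonoidHom.comp_apply, DirectSum.map_of, DirectSum.coeAddMonoidHom_of]
      rfl
    rintro ⟨m, n⟩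
    obtain ⟨x, rfl⟩ := hp.2 m
    obtain ⟨y, rfl⟩ := hq.2 n
    refine ⟨DirectSum.map r x + DirectSum.map s y, ?_⟩
    have e1 := DFunLike.congr_fun hr x
    have e2 := DFunLike.congr_fun hs y
    simp only [AddMonoidHom.comp_apply] at e1 e2
    rw [map_add, e1, e2]
    simp

/-- The shift `X[n]`: `X[n]^k = X^{k+n}`, with differential `(-1)^n d`. -/
def shift (X : DGModule 𝒜) (n : ℤ) : DGModule 𝒜 where
  carrier := X.carrier
  gr k := X.gr (k + n)
  isInternal := isInternal_shift X.isInternal n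
  smul_mem {k i m a} hm ha := by
    have := X.smul_mem hm ha
    rwa [add_right_comm] at this
  d := (n.negOnePow : ℤ) • X.d
  d_mem {k m} hm := by
    have := X.d_mem hm
    rw [add_right_comm] at this
    exact zsmul_mem this _
  d_d m := by
    change (n.negOnePow : ℤ) • X.d ((n.negOnePow : ℤ) • X.d m) = 0
    rw [map_zsmul, X.d_d, smul_zero, smul_zero]

/-- A linear equivalence compatible with gradings and differentials is an isomorphism. -/
def isoOfEq {X Y : DGModule 𝒜} (e : X.carrier ≃ₗ[Aᵐᵒᵖ] Y.carrier)
    (h : ∀ n m, m ∈ X.gr n ↔ e m ∈ Y.gr n) (hd : ∀ m, e (X.d m) = Y.d (e m)) : X ≅ Y where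
  hom := ⟨e.toLinearMap, fun hm => (h _ _).1 hm, hd⟩
  inv := ⟨e.symm.toLinearMap, fun {n m} hm => (h _ _).2 (by simpa using hm), fun m => by
    apply e.injective
    simp [hd]⟩
  hom_inv_id := by ext m; exact e.symm_apply_apply m
  inv_hom_id := by ext m; exact e.apply_symm_apply m

/-- The shift functor `X ↦ X[n]`; it does not change the underlying linear maps. -/
def shiftFunctor (𝒜 : ℤ → Submodule K A) (n : ℤ) : DGModule 𝒜 ⥤ DGModule 𝒜 where
  obj X := X.shift n
  map {X Y} f :=
    { map := (Hom.map f : X.carrier →ₗ[Aᵐᵒᵖ] Y.carrier)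
      map_mem := fun hm => Hom.map_mem f hm
      comm := fun m => by
        change Hom.map f ((n.negOnePow : ℤ) • X.d m) = (n.negOnePow : ℤ) • Y.d (Hom.map f m)
        exact (map_zsmul (Hom.map f) _ _).trans (congrArg _ (Hom.comm f _)) }

lemma eqToHom_shift_map (X : DGModule 𝒜) {a b : ℤ} (h : a = b)
    (h' : (shiftFunctor 𝒜 a).obj X = (shiftFunctor 𝒜 b).obj X) (m : X.carrier) :
    Hom.map (X := X.shift a) (Y := X.shift b) (eqToHom h') m = m := by
  subst h
  rfl

/-- The shift functors satisfy `X[0] = X` and `X[n + m] = X[n][m]`, through identity maps. -/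
def shiftMkCore (𝒜 : ℤ → Submodule K A) : ShiftMkCore (DGModule 𝒜) ℤ where
  F := shiftFunctor 𝒜
  zero := NatIso.ofComponents (fun X => isoOfEq (X := X.shift 0) (Y := X)
    (LinearEquiv.refl Aᵐᵒᵖ X.carrier) (fun n m => by
      change m ∈ X.gr (n + 0) ↔ m ∈ X.gr n
      rw [add_zero])
    (fun m => by
      change ((0 : ℤ).negOnePow : ℤ) • X.d m = X.d m
      simp))
    (fun _ => rfl)
  add n k := NatIso.ofComponents (fun X => isoOfEq (X := X.shift (n + k)) (Y := (X.shift n).shift k)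
    (LinearEquiv.refl Aᵐᵒᵖ X.carrier)
    (fun i m => by
      change m ∈ X.gr (i + (n + k)) ↔ m ∈ X.gr (i + k + n)
      rw [add_assoc, add_comm k n])
    (fun m => by
      change ((n + k).negOnePow : ℤ) • X.d m = (k.negOnePow : ℤ) • (n.negOnePow : ℤ) • X.d m
      rw [Int.negOnePow_add, smul_smul, Units.val_mul, mul_comm])) (fun _ => rfl)
  assoc_hom_app m₁ m₂ m₃ X := by
    apply hom_ext
    intro m
    exact (eqToHom_shift_map X (add_assoc m₁ m₂ m₃) _ m).symm
  zero_add_hom_app n X := by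
    apply hom_ext
    intro m
    exact (eqToHom_shift_map X (zero_add n) _ m).symm
  add_zero_hom_app n X := by
    apply hom_ext
    intro m
    exact (eqToHom_shift_map X (add_zero n) _ m).symm

instance : HasShift (DGModule 𝒜) ℤ := hasShiftMk _ _ (shiftMkCore 𝒜)

/-- The cohomology `H(X) = ker d / im d`; it is the direct sum of the `H^n(X)`. -/
abbrev Cohomology (X : DGModule 𝒜) : Type u :=
  LinearMap.ker X.d ⧸ (LinearMap.range X.d).submoduleOf (LinearMap.ker X.d)

/-- The map `H(X) → H(Y)` induced by a morphism of DG modules. -/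
def cohomologyMap {X Y : DGModule 𝒜} (f : X ⟶ Y) : X.Cohomology →ₗ[Aᵐᵒᵖ] Y.Cohomology :=
  Submodule.mapQ _ _
    ((Hom.map f).restrict (p := LinearMap.ker X.d) (q := LinearMap.ker Y.d) (fun m hm => by
      rw [LinearMap.mem_ker] at hm ⊢
      rw [← Hom.comm f, hm, map_zero]))
    (by
      rintro ⟨_, _⟩ ⟨m, rfl⟩
      exact ⟨Hom.map f m, (Hom.comm f m).symm⟩)

/-- Quasi-isomorphisms: the morphisms that induce a bijection in cohomology. -/
def quasiIso (𝒜 : ℤ → Submodule K A) : MorphismProperty (DGModule 𝒜) :=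
  fun _ _ f => Function.Bijective (cohomologyMap f)

lemma quasiIso_iff {X Y : DGModule 𝒜} (f : X ⟶ Y) : quasiIso 𝒜 f ↔
    (∀ m, X.d m = 0 → (∃ y, Y.d y = Hom.map f m) → ∃ x, X.d x = m) ∧
    (∀ y, Y.d y = 0 → ∃ m, X.d m = 0 ∧ ∃ z, Y.d z = Hom.map f m - y) := by
  have mk_eq : ∀ (Z : DGModule 𝒜) (a b : LinearMap.ker Z.d),
      (Submodule.Quotient.mk a : Z.Cohomology) = Submodule.Quotient.mk b ↔
        ∃ z, Z.d z = a.1 - b.1 := fun Z a b => Submodule.Quotient.eq _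
  refine and_congr ⟨fun h m hm => ?_, fun h => ?_⟩ ⟨fun h y hy => ?_, fun h => ?_⟩
  · rintro ⟨y, hy⟩
    have := @h (Submodule.Quotient.mk ⟨m, hm⟩) (Submodule.Quotient.mk 0) (by
      refine (mk_eq Y _ _).2 ⟨y, ?_⟩
      simpa using hy)
    simpa using (mk_eq X _ _).1 this
  · intro a b hab
    obtain ⟨⟨a, ha⟩, rfl⟩ := Submodule.Quotient.mk_surjective _ a
    obtain ⟨⟨b, hb⟩, rfl⟩ := Submodule.Quotient.mk_surjective _ b
    obtain ⟨z, hz⟩ := (mk_eq Y _ _).1 hab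
    rw [LinearMap.mem_ker] at ha hb
    refine (mk_eq X _ _).2 (h (a - b) (by simp [ha, hb]) ⟨z, ?_⟩)
    rw [hz, map_sub]
    rfl
  · obtain ⟨x, hx⟩ := h (Submodule.Quotient.mk ⟨y, hy⟩)
    obtain ⟨⟨m, hm⟩, rfl⟩ := Submodule.Quotient.mk_surjective _ x
    exact ⟨m, hm, (mk_eq Y _ _).1 hx⟩
  · intro y
    obtain ⟨⟨y, hy⟩, rfl⟩ := Submodule.Quotient.mk_surjective _ y
    obtain ⟨m, hm, z, hz⟩ := h y hy
    exact ⟨Submodule.Quotient.mk ⟨m, hm⟩, (mk_eq Y _ _).2 ⟨z, hz⟩⟩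

lemma shift_d_eq (X : DGModule 𝒜) (n : ℤ) (x y : X.carrier) :
    (X.shift n).d x = y ↔ X.d ((n.negOnePow : ℤ) • x) = y := by
  change (n.negOnePow : ℤ) • X.d x = y ↔ _
  rw [map_zsmul]

instance (𝒜 : ℤ → Submodule K A) : (quasiIso 𝒜).IsCompatibleWithShift ℤ where
  condition n := by
    ext X Y f
    change quasiIso 𝒜 ((shiftFunctor 𝒜 n).map f) ↔ quasiIso 𝒜 f
    have hu : ∀ (Z : DGModule 𝒜) (x : Z.carrier),
        (n.negOnePow : ℤ) • (n.negOnePow : ℤ) • x = x := fun Z x => by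
      rw [smul_smul, ← Units.val_mul, Int.units_mul_self]
      simp
    have hex : ∀ (Z : DGModule 𝒜) (y : Z.carrier),
        (∃ x : Z.carrier, (Z.shift n).d x = y) ↔ ∃ x, Z.d x = y := fun Z y =>
      ⟨fun ⟨x, hx⟩ => ⟨_, (shift_d_eq Z n x y).1 hx⟩, fun ⟨x, hx⟩ =>
        ⟨(n.negOnePow : ℤ) • x, (shift_d_eq Z n _ y).2 (by rw [hu, hx])⟩⟩
    have hz : ∀ (Z : DGModule 𝒜) (x : Z.carrier), (Z.shift n).d x = 0 ↔ Z.d x = 0 := fun Z x => by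
      change (n.negOnePow : ℤ) • Z.d x = 0 ↔ _
      constructor
      · intro h
        rw [← hu Z (Z.d x), h, smul_zero]
      · intro h
        rw [h, smul_zero]
    rw [quasiIso_iff, quasiIso_iff]
    refine and_congr (forall_congr' fun m => imp_congr (hz X m) (imp_congr (hex Y _) (hex X m)))
      (forall_congr' fun y => imp_congr (hz Y y) (exists_congr fun m =>
        and_congr (hz X m) (hex Y _)))

/-- The mapping cone `Y ⊕ X[1]` of `f : X ⟶ Y`, with differential `(y, x) ↦ (d y + f x, -d x)`. -/
def cone {X Y : DGModule 𝒜} (f : X ⟶ Y) : DGModule 𝒜 where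
  carrier := Y.carrier × X.carrier
  gr k := (Y.gr k).prod (X.gr (k + 1))
  isInternal := isInternal_prod Y.isInternal (isInternal_shift X.isInternal 1)
  smul_mem {k i m a} hm ha := ⟨Y.smul_mem hm.1 ha, (X.shift 1).smul_mem hm.2 ha⟩
  d := (Y.d.coprod (Hom.map f)).prod (-(X.d.comp (LinearMap.snd _ _ _)))
  d_mem {k m} hm := ⟨add_mem (Y.d_mem hm.1) (Hom.map_mem f hm.2), (X.gr (k + 1 + 1)).neg_mem (X.d_mem hm.2)⟩
  d_d m := by
    refine Prod.ext ?_ ?_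
    · change Y.d (Y.d m.1 + Hom.map f m.2) + Hom.map f (-X.d m.2) = 0
      rw [map_add, Y.d_d, map_neg, Hom.comm f, zero_add, add_neg_cancel]
    · change -X.d (-X.d m.2) = 0
      rw [map_neg, X.d_d, neg_zero, neg_zero]

/-- The inclusion `Y ⟶ cone f`. -/
def coneInl {X Y : DGModule 𝒜} (f : X ⟶ Y) : Y ⟶ cone f where
  map := LinearMap.inl _ _ _
  map_mem hm := ⟨hm, zero_mem _⟩
  comm m := by
    refine Prod.ext ?_ ?_
    · change Y.d m = Y.d m + Hom.map f 0
      rw [map_zero, add_zero]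
    · change 0 = -X.d 0
      rw [map_zero, neg_zero]

/-- The projection `cone f ⟶ X[1]`. -/
def coneSnd {X Y : DGModule 𝒜} (f : X ⟶ Y) : cone f ⟶ (CategoryTheory.shiftFunctor (DGModule 𝒜) (1 : ℤ)).obj X :=
  show Hom (cone f) (X.shift 1) from
  { map := LinearMap.snd Aᵐᵒᵖ Y.carrier X.carrier
    map_mem := fun hm => hm.2
    comm := fun m => by
      change -X.d m.2 = ((1 : ℤ).negOnePow : ℤ) • X.d m.2
      simp }

/-- The triangle `X ⟶ Y ⟶ cone f ⟶ X[1]`. -/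
def coneTriangle {X Y : DGModule 𝒜} (f : X ⟶ Y) : Pretriangulated.Triangle (DGModule 𝒜) :=
  Pretriangulated.Triangle.mk f (coneInl f) (coneSnd f)

section

variable [GradedAlgebra 𝒜]

/-- Multiplication by the scalar `c : K`, as a natural endomorphism of the identity functor. -/
def scalar (𝒜 : ℤ → Submodule K A) [GradedAlgebra 𝒜] (c : K) :
    𝟭 (DGModule 𝒜) ⟶ 𝟭 (DGModule 𝒜) where
  app X := show Hom X X from
    { map :=
        { toFun := fun m => op (algebraMap K A c) • m
          map_add' := smul_add _
          map_smul' := fun a m => by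
            simp only [smul_smul, RingHom.id_apply]
            congr 1
            apply unop_injective
            simp [Algebra.commutes] }
      map_mem := fun {n m} hm => by
        have := X.smul_mem hm (SetLike.algebraMap_mem_graded 𝒜 c)
        rwa [add_zero] at this
      comm := fun m => ((X.d).map_smul _ m).symm }
  naturality X Y f := by
    ext m
    exact ((Hom.map f).map_smul (op (algebraMap K A c)) m).symm

/-- The algebra `A` as a right DG module over itself, with zero differential. -/
def regular (𝒜 : ℤ → Submodule K A) [GradedAlgebra 𝒜] : DGModule 𝒜 where
  carrier := A
  gr n := (𝒜 n).toAddSubgroup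
  isInternal := DirectSum.Decomposition.isInternal 𝒜
  smul_mem hm ha := SetLike.mul_mem_graded (A := 𝒜) hm ha
  d := 0
  d_mem _ := zero_mem _
  d_d _ := rfl

end

end DGModule

/-! ## Derived categories and perfect derived categories -/

/-- The derived category `D(A)`: the localization of the category of right DG modules at the
quasi-isomorphisms. It carries the shift induced by the shift of DG modules. -/
abbrev DerivedCat (𝒜 : ℤ → Submodule K A) := (DGModule.quasiIso 𝒜).Localization

namespace DerivedCat

open Pretriangulated

/-- The localization functor. -/
abbrev Q (𝒜 : ℤ → Submodule K A) : DGModule 𝒜 ⥤ DerivedCat 𝒜 := (DGModule.quasiIso 𝒜).Q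

/-- The distinguished triangles of `D(A)`: those isomorphic to the image of some
`X ⟶ Y ⟶ cone f ⟶ X[1]`. -/
def distinguished (𝒜 : ℤ → Submodule K A) : Set (Triangle (DerivedCat 𝒜)) :=
  {T | ∃ (X Y : DGModule 𝒜) (f : X ⟶ Y),
    Nonempty (T ≅ (Q 𝒜).mapTriangle.obj (DGModule.coneTriangle f))}

/-- Multiplication by `c : K` on the objects of `D(A)`. It determines the `K`-linear structure of
`D(A)`, as `c • f = f ≫ c • 𝟙`. -/
def scalar (𝒜 : ℤ → Submodule K A) [GradedAlgebra 𝒜] (c : K) :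
    𝟭 (DerivedCat 𝒜) ⟶ 𝟭 (DerivedCat 𝒜) :=
  Localization.liftNatTrans (Q 𝒜) (DGModule.quasiIso 𝒜) (Q 𝒜) (Q 𝒜) _ _
    (Functor.whiskerRight (DGModule.scalar 𝒜 c) (Q 𝒜))

/-- Perfect objects: the smallest class of objects of `D(A)` that contains `A` and is closed under
shifts, cones, direct summands (and isomorphisms, which are special retracts). -/
inductive IsPerfect (𝒜 : ℤ → Submodule K A) [GradedAlgebra 𝒜] : DerivedCat 𝒜 → Prop
  | regular : IsPerfect 𝒜 ((Q 𝒜).obj (DGModule.regular 𝒜))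
  | shift (X : DerivedCat 𝒜) (n : ℤ) :
      IsPerfect 𝒜 X → IsPerfect 𝒜 ((shiftFunctor (DerivedCat 𝒜) n).obj X)
  | cone (T : Triangle (DerivedCat 𝒜)) : T ∈ distinguished 𝒜 →
      IsPerfect 𝒜 T.obj₁ → IsPerfect 𝒜 T.obj₂ → IsPerfect 𝒜 T.obj₃
  | retract (X Y : DerivedCat 𝒜) : Retract X Y → IsPerfect 𝒜 Y → IsPerfect 𝒜 X

/-- The class of perfect objects. -/
def perfect (𝒜 : ℤ → Submodule K A) [GradedAlgebra 𝒜] : ObjectProperty (DerivedCat 𝒜) :=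
  IsPerfect 𝒜

instance (𝒜 : ℤ → Submodule K A) [GradedAlgebra 𝒜] : (perfect 𝒜).IsStableUnderShift ℤ where
  isStableUnderShiftBy n := ⟨fun X hX => IsPerfect.shift X n hX⟩

end DerivedCat

/-- The perfect derived category `per(A)`, the thick subcategory of `D(A)` generated by `A`. -/
abbrev PerfectCat (𝒜 : ℤ → Submodule K A) [GradedAlgebra 𝒜] :=
  (DerivedCat.perfect 𝒜).FullSubcategory

namespace PerfectCat

open Pretriangulated

/-- The distinguished triangles of `per(A)` are those of `D(A)` with perfect vertices. -/
def distinguished (𝒜 : ℤ → Submodule K A) [GradedAlgebra 𝒜] : Set (Triangle (PerfectCat 𝒜)) :=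
  {T | (DerivedCat.perfect 𝒜).ι.mapTriangle.obj T ∈ DerivedCat.distinguished 𝒜}

/-- Multiplication by `c : K` on the objects of `per(A)`. -/
def scalar (𝒜 : ℤ → Submodule K A) [GradedAlgebra 𝒜] (c : K) :
    𝟭 (PerfectCat 𝒜) ⟶ 𝟭 (PerfectCat 𝒜) where
  app X := ObjectProperty.homMk ((DerivedCat.scalar 𝒜 c).app X.obj)
  naturality X Y f := by
    ext
    exact (DerivedCat.scalar 𝒜 c).naturality f.hom

end PerfectCat

end DGModules

/-- Let `C` and `D` be `K`-linear triangulated categories, with the given distinguished triangles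
and the given scalar multiplications on objects. This says that there is a `K`-linear triangulated
equivalence `C ≌ D`: an equivalence that commutes with the shifts, identifies the distinguished
triangles, and is compatible with scalars (an equivalence of additive categories is additive). -/
def TriangleEquivalent {K C D : Type*} [Category* C] [Category* D] [HasShift C ℤ]
    [HasShift D ℤ] (distC : Set (Pretriangulated.Triangle C))
    (distD : Set (Pretriangulated.Triangle D))
    (scalarC : K → (𝟭 C ⟶ 𝟭 C)) (scalarD : K → (𝟭 D ⟶ 𝟭 D)) : Prop :=
  ∃ (F : C ≌ D) (_ : F.functor.CommShift ℤ),
    (∀ T, T ∈ distC ↔ F.functor.mapTriangle.obj T ∈ distD) ∧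
    ∀ (c : K) (X : C), F.functor.map ((scalarC c).app X) = (scalarD c).app (F.functor.obj X)

/-! ## Graded quivers with relations -/

/-- A finite quiver with a degree for each arrow. -/
structure GradedQuiver where
  V : Type u
  E : Type u
  [fintypeV : Fintype V]
  [fintypeE : Fintype E]
  src : E → V
  tgt : E → V
  deg : E → ℤ

attribute [instance] GradedQuiver.fintypeV GradedQuiver.fintypeE

namespace GradedQuiver

/-- The free algebra on the vertices and the arrows, of which the path algebra is a quotient. -/
abbrev Free (K : Type u) [Field K] (q : GradedQuiver.{u}) : Type u := FreeAlgebra K (q.V ⊕ q.E)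

variable {K : Type u} [Field K] (q : GradedQuiver.{u})

/-- The trivial path at a vertex. -/
def vertex (v : q.V) : q.Free K := FreeAlgebra.ι K (Sum.inl v)

/-- The path given by an arrow. -/
def arrow (a : q.E) : q.Free K := FreeAlgebra.ι K (Sum.inr a)

/-- Trivial paths have degree `0`. -/
def genDeg : q.V ⊕ q.E → ℤ := Sum.elim (fun _ => 0) q.deg

/-- The homogeneous elements of degree `n` of the free algebra. -/
def homog (K : Type u) [Field K] (q : GradedQuiver.{u}) (n : ℤ) : Submodule K (q.Free K) :=
  Submodule.span K {x | ∃ l : List (q.V ⊕ q.E),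
    (l.map q.genDeg).sum = n ∧ x = (l.map (FreeAlgebra.ι K)).prod}

/-- The relations that define the path algebra `KQ`. Paths are composed from right to left: `b * a`
is the path `a` followed by `b`, so that an arrow `a` is equal to `e_{t(a)} * a * e_{s(a)}`. -/
inductive PathRel : q.Free K → q.Free K → Prop
  | idem (v : q.V) : PathRel (q.vertex v * q.vertex v) (q.vertex v)
  | orth (v w : q.V) : v ≠ w → PathRel (q.vertex v * q.vertex w) 0
  | one : PathRel (∑ v, q.vertex v) 1
  | tgt (a : q.E) : PathRel (q.vertex (q.tgt a) * q.arrow a) (q.arrow a)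
  | src (a : q.E) : PathRel (q.arrow a * q.vertex (q.src a)) (q.arrow a)

variable {q}

lemma homog_gen (g : q.V ⊕ q.E) : FreeAlgebra.ι K g ∈ homog K q (q.genDeg g) :=
  Submodule.subset_span ⟨[g], by simp, by simp⟩

lemma homog_vertex (v : q.V) : (q.vertex v : q.Free K) ∈ homog K q 0 := homog_gen (Sum.inl v)

lemma homog_arrow (a : q.E) : (q.arrow a : q.Free K) ∈ homog K q (q.deg a) := homog_gen (Sum.inr a)

lemma homog_one : (1 : q.Free K) ∈ homog K q 0 := Submodule.subset_span ⟨[], by simp, by simp⟩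

lemma homog_mul {m n : ℤ} {x y : q.Free K} (hx : x ∈ homog K q m) (hy : y ∈ homog K q n) :
    x * y ∈ homog K q (m + n) := by
  have h := Submodule.mul_mem_mul hx hy
  rw [homog, homog, Submodule.span_mul_span] at h
  refine Submodule.span_mono ?_ h
  rintro _ ⟨_, ⟨l, rfl, rfl⟩, _, ⟨l', rfl, rfl⟩, rfl⟩
  exact ⟨l ++ l', by simp, by simp⟩

lemma PathRel.homog {x y : q.Free K} (h : PathRel q x y) :
    ∃ n, x ∈ homog K q n ∧ y ∈ homog K q n := by
  cases h with
  | idem v => exact ⟨0 + 0, homog_mul (homog_vertex v) (homog_vertex v), homog_vertex v⟩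
  | orth v w _ => exact ⟨0 + 0, homog_mul (homog_vertex v) (homog_vertex w), zero_mem _⟩
  | one => exact ⟨0, sum_mem fun v _ => homog_vertex v, homog_one⟩
  | tgt a =>
    refine ⟨0 + q.deg a, homog_mul (homog_vertex (q.tgt a)) (homog_arrow a), ?_⟩
    rw [zero_add]
    exact homog_arrow a
  | src a =>
    refine ⟨q.deg a + 0, homog_mul (homog_arrow a) (homog_vertex (q.src a)), ?_⟩
    rw [add_zero]
    exact homog_arrow a

end GradedQuiver

/-- A graded quiver with a set `I` of homogeneous relations, given by representatives of elements
of the path algebra. -/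
structure GradedBoundQuiver (K : Type u) [Field K] extends GradedQuiver.{u} where
  rel : Set (toGradedQuiver.Free K)
  rel_homog : ∀ x ∈ rel, ∃ n, x ∈ GradedQuiver.homog K toGradedQuiver n

namespace GradedBoundQuiver

variable {K : Type u} [Field K]

/-- The relations of `KQ / ⟨I⟩` as a quotient of the free algebra. -/
def Rel (B : GradedBoundQuiver K) (x y : B.Free K) : Prop := B.PathRel x y ∨ (x ∈ B.rel ∧ y = 0)

/-- The algebra `KQ / ⟨I⟩`. -/
abbrev Alg (B : GradedBoundQuiver K) : Type u := RingQuot B.Rel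

/-- The quotient map. -/
abbrev proj (B : GradedBoundQuiver K) : B.Free K →ₐ[K] B.Alg := RingQuot.mkAlgHom K B.Rel

/-- The grading of `KQ / ⟨I⟩` induced by the degrees of the arrows. -/
def grading (B : GradedBoundQuiver K) (n : ℤ) : Submodule K B.Alg :=
  (GradedQuiver.homog K B.toGradedQuiver n).map B.proj.toLinearMap

instance gradedMonoid (B : GradedBoundQuiver K) : SetLike.GradedMonoid B.grading where
  one_mem := Submodule.mem_map.2 ⟨1, GradedQuiver.homog_one, map_one B.proj⟩
  mul_mem := by
    intro m n _ _ hx hy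
    obtain ⟨x, hx', rfl⟩ := Submodule.mem_map.1 hx
    obtain ⟨y, hy', rfl⟩ := Submodule.mem_map.1 hy
    exact Submodule.mem_map.2 ⟨x * y, GradedQuiver.homog_mul hx' hy', map_mul B.proj x y⟩

/-- The decomposition of elements of the free algebra into homogeneous components. -/
def decomposeFree (B : GradedBoundQuiver K) :
    B.Free K →ₐ[K] DirectSum ℤ (fun n => B.grading n) :=
  FreeAlgebra.lift K fun g => DirectSum.of (fun n => B.grading n) (B.genDeg g)
    ⟨B.proj (FreeAlgebra.ι K g), ⟨_, GradedQuiver.homog_gen g, rfl⟩⟩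

lemma decomposeFree_apply (B : GradedBoundQuiver K) {n : ℤ} {x : B.Free K}
    (hx : x ∈ GradedQuiver.homog K B.toGradedQuiver n) :
    B.decomposeFree x = DirectSum.of (fun n => B.grading n) n ⟨B.proj x, ⟨x, hx, rfl⟩⟩ := by
  have key : ∀ l : List (B.V ⊕ B.E), ∀ h : B.proj (l.map (FreeAlgebra.ι K)).prod ∈
      B.grading (l.map B.genDeg).sum, B.decomposeFree (l.map (FreeAlgebra.ι K)).prod =
      DirectSum.of (fun n => B.grading n) (l.map B.genDeg).sum
        ⟨B.proj (l.map (FreeAlgebra.ι K)).prod, h⟩ := by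
    intro l
    induction l with
    | nil =>
      intro h
      simp only [List.map_nil, List.prod_nil, map_one]
      rfl
    | cons g l ih =>
      intro h
      simp only [List.map_cons, List.prod_cons, map_mul]
      rw [ih ⟨_, Submodule.subset_span ⟨l, rfl, rfl⟩, rfl⟩]
      rw [decomposeFree, FreeAlgebra.lift_ι_apply, DirectSum.of_mul_of]
      rfl
  induction hx using Submodule.span_induction with
  | mem x hx =>
    obtain ⟨l, rfl, rfl⟩ := hx
    exact key l _
  | zero =>
    rw [map_zero]
    refine (map_zero (DirectSum.of (fun n => B.grading n) n)).symm.trans ?_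
    congr 1
    exact Subtype.ext (map_zero B.proj).symm
  | add x y hx hy h1 h2 =>
    rw [map_add, h1, h2, ← map_add]
    congr 1
    exact Subtype.ext (map_add B.proj x y).symm
  | smul c x hx h =>
    rw [map_smul, h, ← DirectSum.lof_eq_of K, ← map_smul]
    refine congrArg (DirectSum.lof K ℤ (fun n => B.grading n) n) ?_
    exact Subtype.ext (map_smul B.proj c x).symm

/-- The decomposition of elements of `KQ / ⟨I⟩` into homogeneous components. -/
def decompose (B : GradedBoundQuiver K) : B.Alg →ₐ[K] DirectSum ℤ (fun n => B.grading n) :=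
  RingQuot.liftAlgHom K ⟨B.decomposeFree, fun x y h => by
    obtain ⟨n, hx, hy⟩ : ∃ n, x ∈ GradedQuiver.homog K B.toGradedQuiver n ∧
        y ∈ GradedQuiver.homog K B.toGradedQuiver n := by
      rcases h with h | ⟨h, rfl⟩
      · exact h.homog
      · obtain ⟨n, hn⟩ := B.rel_homog x h
        exact ⟨n, hn, zero_mem _⟩
    rw [decomposeFree_apply B hx, decomposeFree_apply B hy]
    congr 1
    exact Subtype.ext (RingQuot.mkAlgHom_rel K h)⟩

lemma decompose_proj (B : GradedBoundQuiver K) (x : B.Free K) :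
    B.decompose (B.proj x) = B.decomposeFree x :=
  RingQuot.liftAlgHom_mkAlgHom_apply K _ _ x

instance gradedAlgebra (B : GradedBoundQuiver K) : GradedAlgebra B.grading :=
  GradedAlgebra.ofAlgHom B.grading B.decompose
    (by
      apply RingQuot.ringQuot_ext'
      apply FreeAlgebra.hom_ext
      funext g
      simp only [Function.comp_apply, AlgHom.comp_apply]
      rw [decompose_proj, decomposeFree, FreeAlgebra.lift_ι_apply, DirectSum.coeAlgHom_of]
      rfl)
    (by
      rintro n ⟨y, hy⟩
      obtain ⟨x, hx, rfl⟩ := Submodule.mem_map.1 hy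
      exact (decompose_proj B x).trans (decomposeFree_apply B hx))

/-- The `K`-linear triangulated categories `D(B)` and `D(B')` are equivalent. -/
def DerivedEquivalent (B B' : GradedBoundQuiver K) : Prop :=
  TriangleEquivalent (DerivedCat.distinguished B.grading) (DerivedCat.distinguished B'.grading)
    (DerivedCat.scalar B.grading) (DerivedCat.scalar B'.grading)

/-- The `K`-linear triangulated categories `per(B)` and `per(B')` are equivalent. -/
def PerfectEquivalent (B B' : GradedBoundQuiver K) : Prop :=
  TriangleEquivalent (PerfectCat.distinguished B.grading) (PerfectCat.distinguished B'.grading)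
    (PerfectCat.scalar B.grading) (PerfectCat.scalar B'.grading)

/-- The quiver obtained by adding an arrow `δ` (`none`) of degree `-|α|` from the target to the
source of an arrow `α`. -/
def addInverse (B : GradedBoundQuiver K) (α : B.E) : GradedQuiver.{u} where
  V := B.V
  E := Option B.E
  src a := a.elim (B.tgt α) B.src
  tgt a := a.elim (B.src α) B.tgt
  deg a := a.elim (-B.deg α) B.deg

/-- The inclusion of the old quiver into the new one. -/
def incl (B : GradedBoundQuiver K) (α : B.E) : B.Free K →ₐ[K] (B.addInverse α).Free K :=
  FreeAlgebra.lift K fun g => FreeAlgebra.ι K (Sum.map id some g)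

lemma incl_homog (B : GradedBoundQuiver K) (α : B.E) {n : ℤ} {x : B.Free K}
    (hx : x ∈ GradedQuiver.homog K B.toGradedQuiver n) :
    B.incl α x ∈ GradedQuiver.homog K (B.addInverse α) n := by
  have : (GradedQuiver.homog K B.toGradedQuiver n).map (B.incl α).toLinearMap ≤
      GradedQuiver.homog K (B.addInverse α) n := by
    rw [GradedQuiver.homog, Submodule.map_span, Submodule.span_le]
    rintro _ ⟨_, ⟨l, rfl, rfl⟩, rfl⟩
    refine Submodule.subset_span ⟨l.map (Sum.map id some), ?_, ?_⟩
    · refine congrArg List.sum ((List.map_map ..).trans (List.map_congr_left fun g _ => ?_))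
      cases g <;> rfl
    · refine (map_list_prod (B.incl α) _).trans (congrArg List.prod ?_)
      rw [List.map_map]
      refine Eq.trans (List.map_congr_left fun g _ => ?_) (List.map_map ..).symm
      exact FreeAlgebra.lift_ι_apply _ _
  exact this ⟨x, hx, rfl⟩

/-- The localization at `ω = α + μ β`, where `α` and `β` are arrows of the same degree (and with the
same source and target): add an arrow `δ` from the target to the source, of degree `-|α|`, and the
relations `δ ω - e_{s(α)}` and `ω δ - e_{t(α)}`. -/
def localization (B : GradedBoundQuiver K) (α β : B.E) (h : B.deg β = B.deg α) (μ : K) :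
    GradedBoundQuiver K where
  toGradedQuiver := B.addInverse α
  rel :=
    let q := B.addInverse α
    let δ : q.Free K := q.arrow none
    let ω : q.Free K := q.arrow (some α) + μ • q.arrow (some β)
    B.incl α '' B.rel ∪ {δ * ω - q.vertex (B.src α), ω * δ - q.vertex (B.tgt α)}
  rel_homog := by
    have hω : (B.addInverse α).arrow (some α) + μ • (B.addInverse α).arrow (some β) ∈
        GradedQuiver.homog K (B.addInverse α) (B.deg α) := by
      refine add_mem (GradedQuiver.homog_arrow (q := B.addInverse α) (some α))
        (Submodule.smul_mem _ _ ?_)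
      rw [← h]
      exact GradedQuiver.homog_arrow (q := B.addInverse α) (some β)
    have hδ : (B.addInverse α).arrow none ∈
        GradedQuiver.homog K (B.addInverse α) (-B.deg α) :=
      GradedQuiver.homog_arrow (q := B.addInverse α) none
    rintro x (⟨y, hy, rfl⟩ | rfl | rfl)
    · obtain ⟨n, hn⟩ := B.rel_homog y hy
      exact ⟨n, B.incl_homog α hn⟩
    · exact ⟨0, sub_mem (by simpa using GradedQuiver.homog_mul hδ hω)
        (GradedQuiver.homog_vertex (q := B.addInverse α) _)⟩
    · exact ⟨0, sub_mem (by simpa using GradedQuiver.homog_mul hω hδ)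
        (GradedQuiver.homog_vertex (q := B.addInverse α) _)⟩

end GradedBoundQuiver

/-! ## Graded pinched gentle algebras -/

/-- The two types of arrows at a vertex with a pinched loop. -/
inductive Strand
  | alpha
  | beta

/-- `1` for `α` and `-1` for `β`. -/
def Strand.sign (K : Type u) [Field K] : Strand → K
  | alpha => 1
  | beta => -1

/-- The quiver, the degrees and the relations of a graded pinched gentle algebra. The arrows are
`G ⊔ P`, where `G = Q₁ᵍ` are the arrows of the gentle bound quiver `(Qᵍ, Iᵍ)`, and `P = Q₁ᵖ` are
loops of degree `0` based at different vertices. `rel b a` says that `b a` is a path in `Iᵍ`.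
An arrow `a` of `G` into a vertex `v = base p` is `α_v⁻` or `β_v⁻` according to `inStrand a`, and an
arrow `b` of `G` out of `v` is `α_v⁺` or `β_v⁺` according to `outStrand b`. -/
structure GradedPinchedGentle where
  V : Type u
  G : Type u
  P : Type u
  [fintypeV : Fintype V]
  [fintypeG : Fintype G]
  [fintypeP : Fintype P]
  src : G → V
  tgt : G → V
  deg : G → ℤ
  rel : G → G → Prop
  rel_path : ∀ b a, rel b a → src b = tgt a
  /-- At most two arrows of `G` end at each vertex, and at most two start there. -/
  in_le : ∀ v, {a | tgt a = v}.ncard ≤ 2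
  out_le : ∀ v, {a | src a = v}.ncard ≤ 2
  /-- For each `a` there is at most one `b` with `a b` a path in `Iᵍ`, and so on. -/
  rel_right_unique : ∀ a b b', rel a b → rel a b' → b = b'
  rel_left_unique : ∀ a c c', rel c a → rel c' a → c = c'
  path_right_unique : ∀ a b b', src a = tgt b → src a = tgt b' → ¬ rel a b → ¬ rel a b' → b = b'
  path_left_unique : ∀ a c c', src c = tgt a → src c' = tgt a → ¬ rel c a → ¬ rel c' a → c = c'
  base : P → V
  base_injective : Function.Injective base
  inStrand : G → Strand
  outStrand : G → Strand
  inStrand_unique : ∀ p a a', tgt a = base p → tgt a' = base p → inStrand a = inStrand a' → a = a'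
  outStrand_unique : ∀ p b b', src b = base p → src b' = base p → outStrand b = outStrand b' → b = b'
  /-- `β_v⁺ α_v⁻` and `α_v⁺ β_v⁻` belong to `Iᵍ`. -/
  strand_rel : ∀ p b a, src b = base p → tgt a = base p → outStrand b ≠ inStrand a → rel b a

attribute [instance] GradedPinchedGentle.fintypeV GradedPinchedGentle.fintypeG
  GradedPinchedGentle.fintypeP

namespace GradedPinchedGentle

open GradedQuiver

/-- The graded quiver `Q`. -/
def quiver (Λ : GradedPinchedGentle.{u}) : GradedQuiver.{u} where
  V := Λ.V
  E := Λ.G ⊕ Λ.P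
  src := Sum.elim Λ.src Λ.base
  tgt := Sum.elim Λ.tgt Λ.base
  deg := Sum.elim Λ.deg (fun _ => 0)

/-- The relations `I = Iᵍ ⊔ Iᵖ`. At a vertex `v` with a loop `γ` in `P`, the set `Iᵖ` consists of
`α_v⁺ (γ - e_v)`, `(γ - e_v) α_v⁻`, `β_v⁺ (γ + e_v)` and `(γ + e_v) β_v⁻`. -/
inductive IsRel (K : Type u) [Field K] (Λ : GradedPinchedGentle.{u}) : Λ.quiver.Free K → Prop
  | gentle (b a : Λ.G) : Λ.rel b a →
      IsRel K Λ (Λ.quiver.arrow (Sum.inl b) * Λ.quiver.arrow (Sum.inl a))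
  | loop_out (p : Λ.P) (b : Λ.G) : Λ.src b = Λ.base p →
      IsRel K Λ (Λ.quiver.arrow (Sum.inl b) * (Λ.quiver.arrow (Sum.inr p) -
        (Λ.outStrand b).sign K • Λ.quiver.vertex (Λ.base p)))
  | loop_in (p : Λ.P) (a : Λ.G) : Λ.tgt a = Λ.base p →
      IsRel K Λ ((Λ.quiver.arrow (Sum.inr p) -
        (Λ.inStrand a).sign K • Λ.quiver.vertex (Λ.base p)) * Λ.quiver.arrow (Sum.inl a))

/-- The graded bound quiver whose algebra is the graded pinched gentle algebra `Λ = KQ / ⟨I⟩`. -/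
def boundQuiver (K : Type u) [Field K] (Λ : GradedPinchedGentle.{u}) : GradedBoundQuiver K where
  toGradedQuiver := Λ.quiver
  rel := {x | Λ.IsRel K x}
  rel_homog := by
    have hl : ∀ (p : Λ.P) (c : K), (Λ.quiver.arrow (Sum.inr p) - c • Λ.quiver.vertex (Λ.base p) :
        Λ.quiver.Free K) ∈ homog K Λ.quiver 0 := fun p c =>
      sub_mem (homog_arrow (q := Λ.quiver) (Sum.inr p))
        (Submodule.smul_mem _ _ (homog_vertex (q := Λ.quiver) _))
    rintro x (⟨b, a, -⟩ | ⟨p, b, -⟩ | ⟨p, a, -⟩)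
    · exact ⟨_, homog_mul (homog_arrow _) (homog_arrow _)⟩
    · exact ⟨_, homog_mul (homog_arrow _) (hl _ _)⟩
    · exact ⟨_, homog_mul (hl _ _) (homog_arrow _)⟩

/-- A graded Kronecker: two distinct arrows of `Qᵍ` with the same source, target and degree, which
are not loops, and such that no loop of `P` is based at their source or target. -/
structure Kronecker (Λ : GradedPinchedGentle.{u}) where
  α : Λ.G
  β : Λ.G
  ne : α ≠ β
  src_eq : Λ.src β = Λ.src α
  tgt_eq : Λ.tgt β = Λ.tgt α
  deg_eq : Λ.deg β = Λ.deg α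
  not_loop : Λ.src α ≠ Λ.tgt α
  base_ne_src : ∀ p, Λ.base p ≠ Λ.src α
  base_ne_tgt : ∀ p, Λ.base p ≠ Λ.tgt α

variable {Λ : GradedPinchedGentle.{u}}

/-- The localization `Λ[ω⁻¹]` at `ω = α + μ β`. -/
def localization {K : Type u} [Field K] (κ : Λ.Kronecker) (μ : K) : GradedBoundQuiver K :=
  (Λ.boundQuiver K).localization (Sum.inl κ.α) (Sum.inl κ.β) κ.deg_eq μ

open Classical in
/-- The map that merges the target `2` of the Kronecker with its source `1`. -/
def merge (κ : Λ.Kronecker) (v : Λ.V) : {v : Λ.V // v ≠ Λ.tgt κ.α} :=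
  if h : v = Λ.tgt κ.α then ⟨Λ.src κ.α, κ.not_loop⟩ else ⟨v, h⟩

open Classical in
/-- The quiver of the pinching: remove `α` and `β`, merge their source `1` and their target `2`
into one vertex `1`, add a loop `γ` (the arrow `Sum.inr none`) of degree `0` at `1`, and add `|α|`
to the degree of `α⁺` and `|β|` to the degree of `β⁺`, where `α⁺ β` and `β⁺ α` are in `I`. -/
def pinchingQuiver (κ : Λ.Kronecker) : GradedQuiver.{u} where
  V := {v : Λ.V // v ≠ Λ.tgt κ.α}
  E := {a : Λ.G // a ≠ κ.α ∧ a ≠ κ.β} ⊕ Option Λ.P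
  src := Sum.elim (fun a => merge κ (Λ.src a.1))
    (fun p => p.elim (merge κ (Λ.src κ.α)) (fun p => merge κ (Λ.base p)))
  tgt := Sum.elim (fun a => merge κ (Λ.tgt a.1))
    (fun p => p.elim (merge κ (Λ.src κ.α)) (fun p => merge κ (Λ.base p)))
  deg := Sum.elim (fun a =>
      if Λ.rel a.1 κ.β then Λ.deg a.1 + Λ.deg κ.α
      else if Λ.rel a.1 κ.α then Λ.deg a.1 + Λ.deg κ.β
      else Λ.deg a.1)
    (fun _ => 0)

section

variable (K : Type u) [Field K] (κ : Λ.Kronecker)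

/-- An arrow of `Qᵍ` other than `α` and `β`, in the pinching. -/
abbrev pArrow (a : {a : Λ.G // a ≠ κ.α ∧ a ≠ κ.β}) : (pinchingQuiver κ).Free K :=
  (pinchingQuiver κ).arrow (Sum.inl a)

/-- A loop of `P`, in the pinching. -/
abbrev pLoop (p : Λ.P) : (pinchingQuiver κ).Free K := (pinchingQuiver κ).arrow (Sum.inr (some p))

/-- The new loop `γ`. -/
abbrev pGamma : (pinchingQuiver κ).Free K := (pinchingQuiver κ).arrow (Sum.inr none)

/-- The trivial path at the image of a vertex, in the pinching. -/
abbrev pVertex (v : Λ.V) : (pinchingQuiver κ).Free K := (pinchingQuiver κ).vertex (merge κ v)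

/-- The relations of the pinching: the relations of `Λ` that do not involve `α` and `β`, and
`α⁺ β⁻`, `β⁺ α⁻`, `β⁺ (γ + e₁)`, `(γ + e₁) β⁻`, `α⁺ (γ - e₁)`, `(γ - e₁) α⁻`, where `α⁺, β⁺, α⁻, β⁻`
are the arrows, if they exist, such that `α⁺ β`, `β⁺ α`, `β α⁻`, `α β⁻` are in `I`. -/
inductive IsPinchingRel : (pinchingQuiver κ).Free K → Prop
  | gentle (b a) : Λ.rel b.1 a.1 → IsPinchingRel (pArrow K κ b * pArrow K κ a)
  | loop_out (p : Λ.P) (b) : Λ.src b.1 = Λ.base p → IsPinchingRel (pArrow K κ b *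
      (pLoop K κ p - (Λ.outStrand b.1).sign K • pVertex K κ (Λ.base p)))
  | loop_in (p : Λ.P) (a) : Λ.tgt a.1 = Λ.base p → IsPinchingRel
      ((pLoop K κ p - (Λ.inStrand a.1).sign K • pVertex K κ (Λ.base p)) * pArrow K κ a)
  | alpha_beta (b a) : Λ.rel b.1 κ.β → Λ.rel κ.α a.1 → IsPinchingRel (pArrow K κ b * pArrow K κ a)
  | beta_alpha (b a) : Λ.rel b.1 κ.α → Λ.rel κ.β a.1 → IsPinchingRel (pArrow K κ b * pArrow K κ a)
  | beta_out (b) : Λ.rel b.1 κ.α →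
      IsPinchingRel (pArrow K κ b * (pGamma K κ + pVertex K κ (Λ.src κ.α)))
  | beta_in (a) : Λ.rel κ.α a.1 →
      IsPinchingRel ((pGamma K κ + pVertex K κ (Λ.src κ.α)) * pArrow K κ a)
  | alpha_out (b) : Λ.rel b.1 κ.β →
      IsPinchingRel (pArrow K κ b * (pGamma K κ - pVertex K κ (Λ.src κ.α)))
  | alpha_in (a) : Λ.rel κ.β a.1 →
      IsPinchingRel ((pGamma K κ - pVertex K κ (Λ.src κ.α)) * pArrow K κ a)

/-- The pinching `Λ_(α, β)`. -/
def pinching : GradedBoundQuiver K where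
  toGradedQuiver := pinchingQuiver κ
  rel := {x | IsPinchingRel K κ x}
  rel_homog := by
    have hv : ∀ v, (pVertex K κ v) ∈ homog K (pinchingQuiver κ) 0 := fun v =>
      homog_vertex (q := pinchingQuiver κ) _
    have hl : ∀ (p : Λ.P) (c : K), (pLoop K κ p - c • pVertex K κ (Λ.base p)) ∈
        homog K (pinchingQuiver κ) 0 := fun p c =>
      sub_mem (homog_arrow (q := pinchingQuiver κ) (Sum.inr (some p)))
        (Submodule.smul_mem _ _ (hv _))
    have hγ : pGamma K κ ∈ homog K (pinchingQuiver κ) 0 :=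
      homog_arrow (q := pinchingQuiver κ) (Sum.inr none)
    rintro x (⟨b, a, -⟩ | ⟨p, b, -⟩ | ⟨p, a, -⟩ | ⟨b, a, -, -⟩ | ⟨b, a, -, -⟩ | ⟨b, -⟩ | ⟨a, -⟩ |
      ⟨b, -⟩ | ⟨a, -⟩)
    · exact ⟨_, homog_mul (homog_arrow _) (homog_arrow _)⟩
    · exact ⟨_, homog_mul (homog_arrow _) (hl _ _)⟩
    · exact ⟨_, homog_mul (hl _ _) (homog_arrow _)⟩
    · exact ⟨_, homog_mul (homog_arrow _) (homog_arrow _)⟩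
    · exact ⟨_, homog_mul (homog_arrow _) (homog_arrow _)⟩
    · exact ⟨_, homog_mul (homog_arrow _) (add_mem hγ (hv _))⟩
    · exact ⟨_, homog_mul (add_mem hγ (hv _)) (homog_arrow _)⟩
    · exact ⟨_, homog_mul (homog_arrow _) (sub_mem hγ (hv _))⟩
    · exact ⟨_, homog_mul (sub_mem hγ (hv _)) (homog_arrow _)⟩

end

end GradedPinchedGentle

end

noncomputable section

section Transfer

open Pretriangulated

variable {K A B : Type u} [Field K] [Ring A] [Algebra K A] [Ring B] [Algebra K B]
  {𝒜 : ℤ → Submodule K A} {ℬ : ℤ → Submodule K B}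

namespace DGModule

lemma cohomologyMap_comp {X Y Z : DGModule 𝒜} (f : X ⟶ Y) (g : Y ⟶ Z) :
    ⇑(cohomologyMap (f ≫ g)) = cohomologyMap g ∘ cohomologyMap f := by
  ext m
  obtain ⟨m, rfl⟩ := Submodule.Quotient.mk_surjective _ m
  rfl

lemma cohomologyMap_id (X : DGModule 𝒜) : ⇑(cohomologyMap (𝟙 X)) = id := by
  ext m
  obtain ⟨m, rfl⟩ := Submodule.Quotient.mk_surjective _ m
  rfl

lemma quasiIso_of_iso {X Y : DGModule 𝒜} (e : X ≅ Y) : quasiIso 𝒜 e.hom :=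
  Function.bijective_iff_has_inverse.2 ⟨cohomologyMap e.inv,
    Function.leftInverse_iff_comp.2 (by rw [← cohomologyMap_comp, e.hom_inv_id, cohomologyMap_id]),
    Function.rightInverse_iff_comp.2 (by rw [← cohomologyMap_comp, e.inv_hom_id, cohomologyMap_id])⟩

lemma quasiIso_comp {X Y Z : DGModule 𝒜} {f : X ⟶ Y} {g : Y ⟶ Z} (hf : quasiIso 𝒜 f)
    (hg : quasiIso 𝒜 g) : quasiIso 𝒜 (f ≫ g) := by
  change Function.Bijective _
  rw [cohomologyMap_comp]
  exact Function.Bijective.comp hg hf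

/-- The morphism of cones induced by a commutative square. -/
def coneMap {X Y X' Y' : DGModule 𝒜} {f : X ⟶ Y} {f' : X' ⟶ Y'} (a : X ⟶ X') (b : Y ⟶ Y')
    (h : f ≫ b = a ≫ f') : cone f ⟶ cone f' :=
  show Hom (cone f) (cone f') from
  { map := (Hom.map b).prodMap (Hom.map a)
    map_mem := fun hm => ⟨Hom.map_mem b hm.1, Hom.map_mem a hm.2⟩
    comm := fun m => by
      refine Prod.ext ?_ ?_
      · change Hom.map b (Y.d m.1 + Hom.map f m.2) =
          Y'.d (Hom.map b m.1) + Hom.map f' (Hom.map a m.2)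
        rw [map_add, Hom.comm b, ← comp_map f b, h, comp_map]
      · change Hom.map a (-X.d m.2) = -X'.d (Hom.map a m.2)
        rw [map_neg, Hom.comm a] }

/-- Isomorphic morphisms have isomorphic cone triangles. -/
def coneTriangleIso {X Y X' Y' : DGModule 𝒜} {f : X ⟶ Y} {f' : X' ⟶ Y'} (a : X ≅ X') (b : Y ≅ Y')
    (h : f ≫ b.hom = a.hom ≫ f') : coneTriangle f ≅ coneTriangle f' :=
  Triangle.isoMk _ _ a b
    { hom := coneMap a.hom b.hom h
      inv := coneMap a.inv b.inv (by rw [Iso.comp_inv_eq, Category.assoc, h, a.inv_hom_id_assoc])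
      hom_inv_id := hom_ext fun m => Prod.ext
        (congrArg (fun g => Hom.map g m.1) b.hom_inv_id)
        (congrArg (fun g => Hom.map g m.2) a.hom_inv_id)
      inv_hom_id := hom_ext fun m => Prod.ext
        (congrArg (fun g => Hom.map g m.1) b.inv_hom_id)
        (congrArg (fun g => Hom.map g m.2) a.inv_hom_id) }
    h
    (hom_ext fun _ => Prod.ext rfl (map_zero (Hom.map a.hom)))
    (hom_ext fun _ => rfl)

end DGModule

namespace DerivedCat

lemma distinguished_of_iso {T T' : Triangle (DerivedCat 𝒜)} (e : T ≅ T')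
    (h : T' ∈ distinguished 𝒜) : T ∈ distinguished 𝒜 := by
  obtain ⟨X, Y, f, ⟨i⟩⟩ := h
  exact ⟨X, Y, f, ⟨e ≪≫ i⟩⟩

lemma Q_obj_surjective (X : DerivedCat 𝒜) : ∃ Y, (Q 𝒜).obj Y = X :=
  (Localization.Construction.objEquiv (DGModule.quasiIso 𝒜)).surjective X

section

variable [GradedAlgebra 𝒜] [GradedAlgebra ℬ]

lemma scalar_app_Q (c : K) (X : DGModule 𝒜) :
    (scalar 𝒜 c).app ((Q 𝒜).obj X) = (Q 𝒜).map ((DGModule.scalar 𝒜 c).app X) := by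
  rw [scalar]
  exact (Localization.liftNatTrans_app ..).trans (by simp)

instance : (perfect 𝒜).IsClosedUnderIsomorphisms where
  of_iso e h := IsPerfect.retract _ _ (Retract.ofIso e.symm) h

lemma IsPerfect.of_iso {X Y : DerivedCat 𝒜} (e : X ≅ Y) (h : IsPerfect 𝒜 X) : IsPerfect 𝒜 Y :=
  (perfect 𝒜).prop_of_iso e h

end

end DerivedCat

variable (F : DGModule 𝒜 ⥤ DGModule ℬ)
  (hW : DGModule.quasiIso 𝒜 = (DGModule.quasiIso ℬ).inverseImage F)

/-- A functor that reflects and preserves quasi-isomorphisms, as a morphism of localizers. -/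
abbrev quasiIsoLocalizer : LocalizerMorphism (DGModule.quasiIso 𝒜) (DGModule.quasiIso ℬ) :=
  LocalizerMorphism.ofEq (F := F) hW

/-- The functor induced between derived categories. -/
abbrev derivedFunctor : DerivedCat 𝒜 ⥤ DerivedCat ℬ :=
  (quasiIsoLocalizer F hW).localizedFunctor (DerivedCat.Q 𝒜) (DerivedCat.Q ℬ)

/-- The compatibility of the derived functor with the localization functors. -/
def derivedFunctorIso : F ⋙ DerivedCat.Q ℬ ≅ DerivedCat.Q 𝒜 ⋙ derivedFunctor F hW :=
  CatCommSq.iso (quasiIsoLocalizer F hW).functor (DerivedCat.Q 𝒜) (DerivedCat.Q ℬ) _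

lemma derivedFunctor_map_scalar [GradedAlgebra 𝒜] [GradedAlgebra ℬ]
    (hs : ∀ (c : K) (X : DGModule 𝒜),
      F.map ((DGModule.scalar 𝒜 c).app X) = (DGModule.scalar ℬ c).app (F.obj X)) (c : K) (X : DerivedCat 𝒜) :
    (derivedFunctor F hW).map ((DerivedCat.scalar 𝒜 c).app X) =
      (DerivedCat.scalar ℬ c).app ((derivedFunctor F hW).obj X) := by
  obtain ⟨X, rfl⟩ := DerivedCat.Q_obj_surjective X
  let e := derivedFunctorIso F hW
  have h1 := e.hom.naturality ((DGModule.scalar 𝒜 c).app X)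
  have h2 := (DerivedCat.scalar ℬ c).naturality (e.hom.app X)
  rw [DerivedCat.scalar_app_Q, ← cancel_epi (e.hom.app X)]
  refine h1.symm.trans (Eq.trans ?_ h2.symm)
  refine congrArg (· ≫ e.hom.app X) ?_
  change (DerivedCat.Q ℬ).map (F.map _) = _
  rw [hs]
  exact (DerivedCat.scalar_app_Q c _).symm

variable [F.IsEquivalence]

instance : (quasiIsoLocalizer F hW).functor.IsEquivalence := inferInstanceAs F.IsEquivalence

include hW in
lemma quasiIso_le_map : DGModule.quasiIso ℬ ≤ (DGModule.quasiIso 𝒜).map F := by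
  intro X Y f hf
  let e := F.objObjPreimageIso X
  let e' := F.objObjPreimageIso Y
  refine ⟨_, _, F.preimage (e.hom ≫ f ≫ e'.inv), ?_, ⟨Arrow.isoMk e e' ?_⟩⟩
  · rw [hW]
    change DGModule.quasiIso ℬ _
    rw [F.map_preimage]
    exact DGModule.quasiIso_comp (DGModule.quasiIso_of_iso e)
      (DGModule.quasiIso_comp hf (DGModule.quasiIso_of_iso e'.symm))
  · simp

instance : (quasiIsoLocalizer F hW).IsLocalizedEquivalence :=
  LocalizerMorphism.IsLocalizedEquivalence.of_equivalence _ (quasiIso_le_map F hW)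

variable [F.CommShift ℤ]
  (hcone : ∀ {X Y : DGModule 𝒜} (f : X ⟶ Y),
    Nonempty (F.mapTriangle.obj (DGModule.coneTriangle f) ≅ DGModule.coneTriangle (F.map f)))

instance : (quasiIsoLocalizer F hW).functor.CommShift ℤ := inferInstanceAs (F.CommShift ℤ)

instance : NatTrans.CommShift (derivedFunctorIso F hW).hom ℤ :=
  LocalizerMorphism.natTransCommShift_hom ..

include hcone in
lemma derivedFunctor_distinguished_iff (T : Triangle (DerivedCat 𝒜)) :
    T ∈ DerivedCat.distinguished 𝒜 ↔
      (derivedFunctor F hW).mapTriangle.obj T ∈ DerivedCat.distinguished ℬ := by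
  have key : ∀ {X Y : DGModule 𝒜} (f : X ⟶ Y), Nonempty ((derivedFunctor F hW).mapTriangle.obj
      ((DerivedCat.Q 𝒜).mapTriangle.obj (DGModule.coneTriangle f)) ≅
      (DerivedCat.Q ℬ).mapTriangle.obj (DGModule.coneTriangle (F.map f))) := fun f => by
    obtain ⟨i⟩ := hcone f
    exact ⟨((Functor.mapTriangleCompIso _ _).symm.app _) ≪≫
      ((Functor.mapTriangleIso (derivedFunctorIso F hW)).symm.app _) ≪≫
      ((Functor.mapTriangleCompIso _ _).app _) ≪≫ (DerivedCat.Q ℬ).mapTriangle.mapIso i⟩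
  constructor
  · rintro ⟨X, Y, f, ⟨i⟩⟩
    obtain ⟨j⟩ := key f
    exact ⟨_, _, F.map f, ⟨(derivedFunctor F hW).mapTriangle.mapIso i ≪≫ j⟩⟩
  · rintro ⟨X, Y, f, ⟨i⟩⟩
    let e := F.objObjPreimageIso X
    let e' := F.objObjPreimageIso Y
    let g := F.preimage (e.hom ≫ f ≫ e'.inv)
    obtain ⟨j⟩ := key g
    exact ⟨_, _, g, ⟨(derivedFunctor F hW).mapTriangle.preimageIso
      (i ≪≫ (DerivedCat.Q ℬ).mapTriangle.mapIso
        (DGModule.coneTriangleIso e e' (by simp [g])).symm ≪≫ j.symm)⟩⟩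

section Scalar

variable [GradedAlgebra 𝒜] [GradedAlgebra ℬ]
  (hs : ∀ (c : K) (X : DGModule 𝒜),
    F.map ((DGModule.scalar 𝒜 c).app X) = (DGModule.scalar ℬ c).app (F.obj X))

include hW hcone hs in
theorem derived_triangleEquivalent :
    TriangleEquivalent (DerivedCat.distinguished 𝒜) (DerivedCat.distinguished ℬ)
      (DerivedCat.scalar 𝒜) (DerivedCat.scalar ℬ) :=
  ⟨(derivedFunctor F hW).asEquivalence, (inferInstance : (derivedFunctor F hW).CommShift ℤ),
    derivedFunctor_distinguished_iff F hW hcone, derivedFunctor_map_scalar F hW hs⟩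

variable (hA : DerivedCat.IsPerfect ℬ ((DerivedCat.Q ℬ).obj (F.obj (DGModule.regular 𝒜))))
  (hB : ∀ Y, Nonempty (F.obj Y ≅ DGModule.regular ℬ) →
    DerivedCat.IsPerfect 𝒜 ((DerivedCat.Q 𝒜).obj Y))

include hW hcone hA in
lemma isPerfect_derivedFunctor_obj {X : DerivedCat 𝒜} (hX : DerivedCat.IsPerfect 𝒜 X) :
    DerivedCat.IsPerfect ℬ ((derivedFunctor F hW).obj X) := by
  induction hX with
  | regular => exact hA.of_iso ((derivedFunctorIso F hW).app _)
  | shift X n _ ih => exact (ih.shift _ n).of_iso (((derivedFunctor F hW).commShiftIso n).symm.app X)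
  | cone T hT _ _ h1 h2 =>
    exact DerivedCat.IsPerfect.cone ((derivedFunctor F hW).mapTriangle.obj T)
      ((derivedFunctor_distinguished_iff F hW hcone T).1 hT) h1 h2
  | retract X Y r _ ih => exact DerivedCat.IsPerfect.retract _ _ (r.map (derivedFunctor F hW)) ih

include hcone hB in
lemma isPerfect_of_derivedFunctor_obj {Y : DerivedCat ℬ} (hY : DerivedCat.IsPerfect ℬ Y) :
    ∀ X, Nonempty ((derivedFunctor F hW).obj X ≅ Y) → DerivedCat.IsPerfect 𝒜 X := by
  let D := derivedFunctor F hW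
  have lift : ∀ {Y : DerivedCat ℬ}, (∀ X, Nonempty (D.obj X ≅ Y) → DerivedCat.IsPerfect 𝒜 X) →
      ∃ X, Nonempty (D.obj X ≅ Y) ∧ DerivedCat.IsPerfect 𝒜 X := fun h =>
    ⟨_, ⟨D.objObjPreimageIso _⟩, h _ ⟨D.objObjPreimageIso _⟩⟩
  induction hY with
  | regular =>
    rintro X ⟨i⟩
    let e := F.objObjPreimageIso (DGModule.regular ℬ)
    refine (hB _ ⟨e⟩).of_iso (D.preimageIso ?_)
    exact ((derivedFunctorIso F hW).symm.app _) ≪≫ (DerivedCat.Q ℬ).mapIso e ≪≫ i.symm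
  | shift Y n _ ih =>
    rintro X ⟨i⟩
    obtain ⟨Z, ⟨j⟩, hZ⟩ := lift ih
    refine (hZ.shift _ n).of_iso (D.preimageIso ?_)
    exact (D.commShiftIso n).app Z ≪≫ (shiftFunctor _ n).mapIso j ≪≫ i.symm
  | cone T hT _ _ h1 h2 =>
    rintro X ⟨i⟩
    obtain ⟨Z₁, ⟨j₁⟩, hZ₁⟩ := lift h1
    obtain ⟨Z₂, ⟨j₂⟩, hZ₂⟩ := lift h2
    let T' : Triangle (DerivedCat 𝒜) := Triangle.mk (D.preimage (j₁.hom ≫ T.mor₁ ≫ j₂.inv))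
      (D.preimage (j₂.hom ≫ T.mor₂ ≫ i.inv))
      (D.preimage (i.hom ≫ T.mor₃ ≫ (shiftFunctor _ (1 : ℤ)).map j₁.inv ≫
        (D.commShiftIso (1 : ℤ)).inv.app Z₁))
    refine DerivedCat.IsPerfect.cone T' ?_ hZ₁ hZ₂
    rw [derivedFunctor_distinguished_iff F hW hcone]
    refine DerivedCat.distinguished_of_iso (Triangle.isoMk _ _ j₁ j₂ i ?_ ?_ ?_) hT
    · change D.map (D.preimage _) ≫ j₂.hom = j₁.hom ≫ T.mor₁
      simp
    · change D.map (D.preimage _) ≫ i.hom = j₂.hom ≫ T.mor₂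
      simp
    · change (D.map (D.preimage _) ≫ (D.commShiftIso (1 : ℤ)).hom.app Z₁) ≫
        (shiftFunctor _ (1 : ℤ)).map j₁.hom = i.hom ≫ T.mor₃
      simp only [Functor.map_preimage, Category.assoc, Iso.inv_hom_id_app_assoc]
      rw [← CategoryTheory.Functor.map_comp, j₁.inv_hom_id, CategoryTheory.Functor.map_id, Category.comp_id]
  | retract Y Y' r _ ih =>
    rintro X ⟨i⟩
    obtain ⟨Z, ⟨j⟩, hZ⟩ := lift ih
    refine DerivedCat.IsPerfect.retract X Z
      { i := D.preimage (i.hom ≫ r.i ≫ j.inv), r := D.preimage (j.hom ≫ r.r ≫ i.inv), retract := ?_ } hZ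
    apply D.map_injective
    simp

include hW hcone hs hA hB in
theorem perfect_triangleEquivalent :
    TriangleEquivalent (PerfectCat.distinguished 𝒜) (PerfectCat.distinguished ℬ)
      (PerfectCat.scalar 𝒜) (PerfectCat.scalar ℬ) := by
  let D := derivedFunctor F hW
  let P := DerivedCat.perfect 𝒜
  let P' := DerivedCat.perfect ℬ
  have h1 : ∀ X : P.FullSubcategory, P' ((P.ι ⋙ D).obj X) := fun X =>
    isPerfect_derivedFunctor_obj F hW hcone hA X.property
  have h2 : P'.inverseImage D = P := by
    ext X
    exact ⟨fun h => isPerfect_of_derivedFunctor_obj F hW hcone hB h X ⟨Iso.refl _⟩,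
      isPerfect_derivedFunctor_obj F hW hcone hA⟩
  let E := P'.lift (P.ι ⋙ D) h1
  have : E.IsEquivalence :=
    ((D.asEquivalence).congrFullSubcategory (P := P) (Q := P') h2).isEquivalence_functor
  refine ⟨E.asEquivalence, (inferInstance : E.CommShift ℤ), fun T => ?_, fun c X => ?_⟩
  · change P.ι.mapTriangle.obj T ∈ DerivedCat.distinguished 𝒜 ↔
      P'.ι.mapTriangle.obj (E.mapTriangle.obj T) ∈ DerivedCat.distinguished ℬ
    rw [derivedFunctor_distinguished_iff F hW hcone]
    let i : P'.ι.mapTriangle.obj (E.mapTriangle.obj T) ≅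
        D.mapTriangle.obj (P.ι.mapTriangle.obj T) :=
      ((Functor.mapTriangleCompIso _ _).symm.app T) ≪≫
        ((Functor.mapTriangleIso (P'.liftCompιIso (P.ι ⋙ D) h1)).app T) ≪≫
        (Functor.mapTriangleCompIso _ _).app T
    exact ⟨DerivedCat.distinguished_of_iso i, DerivedCat.distinguished_of_iso i.symm⟩
  · ext
    exact derivedFunctor_map_scalar F hW hs c X.obj

end Scalar

end Transfer

section Morita

namespace DGModule

lemma isInternal_comap {M N : Type u} [AddCommGroup M] [AddCommGroup N] {p : ℤ → AddSubgroup M}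
    (hp : DirectSum.IsInternal p) (i : N →+ M) (r : M →+ N) (hr : ∀ n, r (i n) = n)
    (h : ∀ k m, m ∈ p k → i (r m) ∈ p k) : DirectSum.IsInternal (fun k => (p k).comap i) := by
  constructor
  · let f : ∀ k, (p k).comap i →+ p k := fun k =>
      (i.comp ((p k).comap i).subtype).codRestrict (p k) fun x => x.2
    have hf : (DirectSum.coeAddMonoidHom p).comp (DirectSum.map f) =
        i.comp (DirectSum.coeAddMonoidHom fun k => (p k).comap i) := by
      refine DirectSum.addHom_ext fun k x => ?_
      simp only [AddMonoidHom.comp_apply, DirectSum.map_of, DirectSum.coeAddMonoidHom_of]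
      rfl
    rw [injective_iff_map_eq_zero]
    intro x hx
    have h1 : DirectSum.map f x = 0 := hp.1 (by
      have := DFunLike.congr_fun hf x
      simp only [AddMonoidHom.comp_apply, hx] at this
      simpa using this)
    refine DFinsupp.ext fun k => Subtype.ext ?_
    have h2 : i (x k).1 = 0 := congrArg Subtype.val (DFunLike.congr_fun h1 k)
    change (x k).1 = 0
    rw [← hr (x k).1, h2, map_zero]
  · let s : ∀ k, p k →+ (p k).comap i := fun k =>
      (r.comp (p k).subtype).codRestrict ((p k).comap i) fun x => h k _ x.2
    have hs : (DirectSum.coeAddMonoidHom fun k => (p k).comap i).comp (DirectSum.map s) =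
        r.comp (DirectSum.coeAddMonoidHom p) := by
      refine DirectSum.addHom_ext fun k x => ?_
      simp only [AddMonoidHom.comp_apply, DirectSum.map_of, DirectSum.coeAddMonoidHom_of]
      rfl
    intro n
    obtain ⟨x, hx⟩ := hp.2 (i n)
    refine ⟨DirectSum.map s x, (DFunLike.congr_fun hs x).trans ?_⟩
    change r (DirectSum.coeAddMonoidHom p x) = n
    rw [hx, hr]

end DGModule

variable {K A B : Type u} [Field K] [Ring A] [Algebra K A] [Ring B] [Algebra K B]

/-- An identification of the graded algebra `B` with the corner `e A e` of `A` at an idempotent `e`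
whose complement is `ω δ`, where `δ` and `ω` are homogeneous elements of opposite degrees
such that `e δ = δ` and `ω e = ω`. -/
structure CornerData (𝒜 : ℤ → Submodule K A) (ℬ : ℤ → Submodule K B) where
  φ : B →ₙₐ[K] A
  p : A →ₗ[K] B
  p_φ : ∀ b, p (φ b) = b
  φ_p : ∀ a, φ (p a) = φ 1 * a * φ 1
  δ : A
  ω : A
  e_δ : φ 1 * δ = δ
  δ_e : δ * φ 1 = 0
  ω_e : ω * φ 1 = ω
  e_ω : φ 1 * ω = 0
  add_eq : φ 1 + ω * δ = 1
  φ_mem : ∀ {n b}, b ∈ ℬ n → φ b ∈ 𝒜 n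
  p_mem : ∀ {n a}, a ∈ 𝒜 n → p a ∈ ℬ n
  deg : ℤ
  ω_mem : ω ∈ 𝒜 deg
  δ_mem : δ ∈ 𝒜 (-deg)

namespace CornerData

open DGModule

variable {𝒜 : ℤ → Submodule K A} {ℬ : ℤ → Submodule K B} (S : CornerData 𝒜 ℬ)

/-- The idempotent `e`. -/
def e : A := S.φ 1

lemma e_mul_e : S.e * S.e = S.e := by rw [e, ← map_mul, one_mul]

lemma φ_mul_e (b : B) : S.φ b * S.e = S.φ b := by rw [e, ← map_mul, mul_one]

lemma e_mul_φ (b : B) : S.e * S.φ b = S.φ b := by rw [e, ← map_mul, one_mul]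

lemma φ_injective : Function.Injective S.φ := Function.LeftInverse.injective S.p_φ

lemma mul_eq (a b : A) : a * b = a * S.e * b + a * S.ω * (S.δ * b) := by
  conv_lhs => rw [← mul_one a, ← S.add_eq]
  rw [e]
  noncomm_ring

lemma p_mul (a b : A) : S.p (a * b) = S.p a * S.p b + S.p (a * S.ω) * S.p (S.δ * b) := by
  apply S.φ_injective
  simp only [map_add, map_mul, S.φ_p]
  rw [S.mul_eq a b]
  have h := S.e_mul_e
  have h1 := S.e_δ
  simp only [e] at *
  simp only [mul_assoc, mul_add, add_mul]
  simp only [← mul_assoc (S.φ 1) S.δ, h1, ← mul_assoc (S.φ 1) (S.φ 1), h]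

lemma p_e : S.p S.e = 1 := S.p_φ 1

lemma p_one : S.p 1 = 1 := by
  apply S.φ_injective
  rw [S.φ_p, mul_one, ← map_mul, one_mul]

lemma p_ω : S.p S.ω = 0 := by
  apply S.φ_injective
  rw [S.φ_p, S.e_ω, zero_mul, map_zero]

lemma p_δ : S.p S.δ = 0 := by
  apply S.φ_injective
  rw [S.φ_p, mul_assoc, S.δ_e, mul_zero, map_zero]

/-- The elements `m` of a module such that `m e = m`. -/
def sub (X : DGModule 𝒜) : AddSubgroup X.carrier where
  carrier := {m | op S.e • m = m}
  add_mem' ha hb := (smul_add _ _ _).trans (congrArg₂ (· + ·) ha hb)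
  zero_mem' := smul_zero _
  neg_mem' ha := (smul_neg _ _).trans (congrArg Neg.neg ha)

variable {S} in
lemma smul_mem_sub {X : DGModule 𝒜} {a : A} (h : a * S.e = a) (m : X.carrier) :
    op a • m ∈ S.sub X := by
  change op S.e • op a • m = _
  rw [smul_smul, ← op_mul, h]

instance (X : DGModule 𝒜) : Module Bᵐᵒᵖ (S.sub X) where
  smul b m := ⟨op (S.φ b.unop) • m.1, smul_mem_sub (S.φ_mul_e _) _⟩
  one_smul m := Subtype.ext m.2
  mul_smul b c m := Subtype.ext (by
    change op (S.φ (c.unop * b.unop)) • m.1 = op (S.φ b.unop) • op (S.φ c.unop) • m.1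
    rw [smul_smul, ← op_mul, map_mul])
  smul_zero b := Subtype.ext (smul_zero _)
  smul_add b m n := Subtype.ext (smul_add _ _ _)
  add_smul b c m := Subtype.ext (by
    change op (S.φ (b.unop + c.unop)) • m.1 = op (S.φ b.unop) • m.1 + op (S.φ c.unop) • m.1
    rw [map_add, MulOpposite.op_add, add_smul])
  zero_smul m := Subtype.ext (by
    change op (S.φ 0) • m.1 = 0
    rw [map_zero, op_zero, zero_smul])

/-- The map `m ↦ m e`. -/
def mulE (X : DGModule 𝒜) : X.carrier →+ S.sub X where
  toFun m := ⟨op S.e • m, smul_mem_sub S.e_mul_e m⟩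
  map_zero' := Subtype.ext (smul_zero _)
  map_add' _ _ := Subtype.ext (smul_add _ _ _)

/-- The map `m ↦ m ω`. -/
def mulω (X : DGModule 𝒜) : X.carrier →+ S.sub X where
  toFun m := ⟨op S.ω • m, smul_mem_sub S.ω_e m⟩
  map_zero' := Subtype.ext (smul_zero _)
  map_add' _ _ := Subtype.ext (smul_add _ _ _)

lemma mulE_coe {X : DGModule 𝒜} (m : S.sub X) : S.mulE X m = m := Subtype.ext m.2

lemma mulω_coe {X : DGModule 𝒜} (m : S.sub X) : S.mulω X m = 0 := Subtype.ext (by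
  change op S.ω • m.1 = 0
  rw [← m.2, smul_smul, ← op_mul, e, S.e_ω, op_zero, zero_smul])

lemma eq_add (X : DGModule 𝒜) (m : X.carrier) :
    m = (S.mulE X m).1 + op S.δ • (S.mulω X m).1 := by
  change m = op S.e • m + op S.δ • op S.ω • m
  rw [smul_smul, ← op_mul, ← add_smul, ← MulOpposite.op_add, e, S.add_eq, op_one, one_smul]

lemma e_mul_eq_φ_p {a : A} (h : a * S.e = a) : S.e * a = S.φ (S.p a) := by
  rw [S.φ_p, mul_assoc, ← e, h]

lemma op_smul_coe {X : DGModule 𝒜} (a : A) (m : S.sub X) :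
    op a • m.1 = (op (S.p a) • m : S.sub X).1 + op S.δ • (op (S.p (a * S.ω)) • m : S.sub X).1 := by
  rw [S.eq_add X (op a • m.1)]
  have h : ∀ c : A, c * S.e = c → op c • m.1 = op (S.φ (S.p c)) • m.1 := fun c hc => by
    rw [← S.e_mul_eq_φ_p hc, op_mul, mul_smul, m.2]
  congr 1
  · change op S.e • op a • m.1 = op (S.φ (S.p a)) • m.1
    rw [smul_smul, ← op_mul, h _ (by rw [mul_assoc, e_mul_e]), S.φ_p, S.φ_p, ← e]
    congr 2
    simp only [mul_assoc, e_mul_e]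
  · change op S.δ • op S.ω • op a • m.1 = op S.δ • op (S.φ (S.p (a * S.ω))) • m.1
    rw [smul_smul (op S.ω), ← op_mul, h _ (by rw [mul_assoc, e, S.ω_e])]

lemma mul_eq_add {a : A} (h : a * S.e = a) :
    a = S.e * S.φ (S.p a) + S.ω * S.φ (S.p (S.δ * a)) := by
  rw [← S.e_mul_eq_φ_p h, ← S.e_mul_eq_φ_p (a := S.δ * a) (by rw [mul_assoc, h]),
    ← mul_assoc S.e S.e, e_mul_e, ← mul_assoc S.e S.δ, e, S.e_δ, ← mul_assoc, ← add_mul,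
    S.add_eq, one_mul]

lemma mulE_smul (X : DGModule 𝒜) (a : A) (m : X.carrier) : S.mulE X (op a • m) =
    op (S.p a) • S.mulE X m + op (S.p (S.δ * a)) • S.mulω X m := Subtype.ext (by
  have hp : ∀ a, S.p (a * S.e) = S.p a := fun a => S.φ_injective (by
    rw [S.φ_p, S.φ_p, ← e]
    simp only [mul_assoc, e_mul_e])
  change op S.e • op a • m =
    op (S.φ (S.p a)) • op S.e • m + op (S.φ (S.p (S.δ * a))) • op S.ω • m
  simp only [smul_smul, ← op_mul, ← add_smul, ← MulOpposite.op_add]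
  rw [S.mul_eq_add (a := a * S.e) (by rw [mul_assoc, e_mul_e]), ← mul_assoc S.δ, hp, hp])

lemma mulω_smul (X : DGModule 𝒜) (a : A) (m : X.carrier) : S.mulω X (op a • m) =
    op (S.p (a * S.ω)) • S.mulE X m + op (S.p (S.δ * a * S.ω)) • S.mulω X m := Subtype.ext (by
  change op S.ω • op a • m =
    op (S.φ (S.p (a * S.ω))) • op S.e • m + op (S.φ (S.p (S.δ * a * S.ω))) • op S.ω • m
  simp only [smul_smul, ← op_mul, ← add_smul, ← MulOpposite.op_add]
  rw [mul_assoc S.δ, ← S.mul_eq_add (a := a * S.ω) (by rw [mul_assoc, e, S.ω_e])])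

lemma mulE_mem {X : DGModule 𝒜} {n : ℤ} {m : X.carrier} [GradedAlgebra ℬ] (hm : m ∈ X.gr n) :
    (S.mulE X m).1 ∈ X.gr n := by
  have := X.smul_mem hm (S.φ_mem (SetLike.one_mem_graded ℬ))
  rwa [add_zero] at this

lemma mulω_mem {X : DGModule 𝒜} {n : ℤ} {m : X.carrier} (hm : m ∈ X.gr n) :
    (S.mulω X m).1 ∈ X.gr (n + S.deg) := X.smul_mem hm S.ω_mem

lemma p_mul_ε (a : A) : S.p (a * S.ω) * S.p (S.δ * S.ω) = S.p (a * S.ω) := by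
  have := S.p_mul a S.ω
  rw [p_ω, mul_zero, zero_add] at this
  exact this.symm

lemma ε_mul_p (a : A) : S.p (S.δ * S.ω) * S.p (S.δ * a) = S.p (S.δ * a) := by
  have := S.p_mul S.δ a
  rw [p_δ, zero_mul, zero_add] at this
  exact this.symm

lemma ε_mem [GradedAlgebra 𝒜] : S.p (S.δ * S.ω) ∈ ℬ 0 := by
  have := S.p_mem (SetLike.mul_mem_graded S.δ_mem S.ω_mem)
  rwa [neg_add_cancel] at this

/-- The module `N` corresponds to the module `N ⊕ N ε` over `A`, where `ε = δ ω`;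
this is the second summand. -/
def second (N : DGModule ℬ) : AddSubgroup N.carrier where
  carrier := {n | op (S.p (S.δ * S.ω)) • n = n}
  add_mem' ha hb := (smul_add _ _ _).trans (congrArg₂ (· + ·) ha hb)
  zero_mem' := smul_zero _
  neg_mem' ha := (smul_neg _ _).trans (congrArg Neg.neg ha)

instance (N : DGModule ℬ) : Module Aᵐᵒᵖ (N.carrier × S.second N) where
  smul a m := ⟨op (S.p a.unop) • m.1 + op (S.p (S.δ * a.unop)) • m.2.1,
    op (S.p (a.unop * S.ω)) • m.1 + op (S.p (S.δ * a.unop * S.ω)) • m.2.1, by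
      change op _ • (_ + _) = _
      rw [smul_add, smul_smul, smul_smul, ← op_mul, ← op_mul, p_mul_ε, p_mul_ε]⟩
  one_smul m := by
    refine Prod.ext ?_ (Subtype.ext ?_)
    · change op (S.p 1) • m.1 + op (S.p (S.δ * 1)) • m.2.1 = m.1
      rw [p_one, mul_one, p_δ, op_one, one_smul, op_zero, zero_smul, add_zero]
    · change op (S.p (1 * S.ω)) • m.1 + op (S.p (S.δ * 1 * S.ω)) • m.2.1 = m.2.1
      rw [one_mul, mul_one, p_ω, op_zero, zero_smul, zero_add]
      exact m.2.2
  mul_smul a b m := by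
    refine Prod.ext ?_ (Subtype.ext ?_)
    · change op (S.p (b.unop * a.unop)) • m.1 + op (S.p (S.δ * (b.unop * a.unop))) • m.2.1 =
        op (S.p a.unop) • (op (S.p b.unop) • m.1 + op (S.p (S.δ * b.unop)) • m.2.1) +
        op (S.p (S.δ * a.unop)) •
          (op (S.p (b.unop * S.ω)) • m.1 + op (S.p (S.δ * b.unop * S.ω)) • m.2.1)
      rw [← mul_assoc, S.p_mul b.unop, S.p_mul (S.δ * b.unop)]
      simp only [MulOpposite.op_add, add_smul, op_mul, mul_smul, smul_add]
      abel
    · change op (S.p (b.unop * a.unop * S.ω)) • m.1 +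
          op (S.p (S.δ * (b.unop * a.unop) * S.ω)) • m.2.1 =
        op (S.p (a.unop * S.ω)) • (op (S.p b.unop) • m.1 + op (S.p (S.δ * b.unop)) • m.2.1) +
        op (S.p (S.δ * a.unop * S.ω)) •
          (op (S.p (b.unop * S.ω)) • m.1 + op (S.p (S.δ * b.unop * S.ω)) • m.2.1)
      rw [← mul_assoc, mul_assoc b.unop, mul_assoc (S.δ * b.unop), S.p_mul b.unop,
        S.p_mul (S.δ * b.unop), ← mul_assoc S.δ a.unop]
      simp only [MulOpposite.op_add, add_smul, op_mul, mul_smul, smul_add]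
      abel
  smul_zero a := by
    refine Prod.ext ?_ (Subtype.ext ?_) <;>
    · change op _ • (0 : N.carrier) + op _ • (0 : N.carrier) = 0
      rw [smul_zero, smul_zero, add_zero]
  smul_add a m n := by
    refine Prod.ext ?_ (Subtype.ext ?_) <;>
    · change op _ • (m.1 + n.1) + op _ • (m.2.1 + n.2.1) =
        (op _ • m.1 + op _ • m.2.1) + (op _ • n.1 + op _ • n.2.1)
      rw [smul_add, smul_add]
      abel
  add_smul a b m := by
    refine Prod.ext ?_ (Subtype.ext ?_)
    · change op (S.p (a.unop + b.unop)) • m.1 + op (S.p (S.δ * (a.unop + b.unop))) • m.2.1 =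
        (op (S.p a.unop) • m.1 + op (S.p (S.δ * a.unop)) • m.2.1) +
        (op (S.p b.unop) • m.1 + op (S.p (S.δ * b.unop)) • m.2.1)
      simp only [mul_add, map_add, MulOpposite.op_add, add_smul]
      abel
    · change op (S.p ((a.unop + b.unop) * S.ω)) • m.1 +
          op (S.p (S.δ * (a.unop + b.unop) * S.ω)) • m.2.1 =
        (op (S.p (a.unop * S.ω)) • m.1 + op (S.p (S.δ * a.unop * S.ω)) • m.2.1) +
        (op (S.p (b.unop * S.ω)) • m.1 + op (S.p (S.δ * b.unop * S.ω)) • m.2.1)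
      simp only [mul_add, add_mul, map_add, MulOpposite.op_add, add_smul]
      abel
  zero_smul m := by
    refine Prod.ext ?_ (Subtype.ext ?_)
    · change op (S.p 0) • m.1 + op (S.p (S.δ * 0)) • m.2.1 = 0
      rw [mul_zero, map_zero, op_zero, zero_smul, zero_smul, add_zero]
    · change op (S.p (0 * S.ω)) • m.1 + op (S.p (S.δ * 0 * S.ω)) • m.2.1 = 0
      rw [mul_zero, zero_mul, map_zero, op_zero, zero_smul, zero_smul, add_zero]

lemma isInternal_second [GradedAlgebra 𝒜] (N : DGModule ℬ) :
    DirectSum.IsInternal fun k => (N.gr k).comap (S.second N).subtype :=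
  isInternal_comap N.isInternal (S.second N).subtype
    { toFun n := ⟨op (S.p (S.δ * S.ω)) • n, by
        change op _ • op _ • n = op _ • n
        rw [smul_smul, ← op_mul, p_mul_ε]⟩
      map_zero' := Subtype.ext (smul_zero _)
      map_add' _ _ := Subtype.ext (smul_add _ _ _) }
    (fun n => Subtype.ext n.2)
    fun k m hm => by
      have := N.smul_mem hm S.ε_mem
      rwa [add_zero] at this

/-- The DG module `N ⊕ N ε [deg]` over `A`. -/
def induced [GradedAlgebra 𝒜] (N : DGModule ℬ) : DGModule 𝒜 where
  carrier := N.carrier × S.second N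
  gr k := (N.gr k).prod ((N.gr (k + S.deg)).comap (S.second N).subtype)
  isInternal := isInternal_prod N.isInternal (isInternal_shift (S.isInternal_second N) S.deg)
  smul_mem {n i m a} hm ha := by
    have h1 := N.smul_mem hm.1 (S.p_mem ha)
    have h2 := N.smul_mem hm.2 (S.p_mem (SetLike.mul_mem_graded S.δ_mem ha))
    have h3 := N.smul_mem hm.1 (S.p_mem (SetLike.mul_mem_graded ha S.ω_mem))
    have h4 := N.smul_mem hm.2 (S.p_mem (SetLike.mul_mem_graded (SetLike.mul_mem_graded S.δ_mem ha) S.ω_mem))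
    refine ⟨add_mem h1 ?_, show op _ • m.1 + op _ • m.2.1 ∈ N.gr _ from add_mem ?_ ?_⟩
    · rwa [show n + S.deg + (-S.deg + i) = n + i by ring] at h2
    · rwa [show n + (i + S.deg) = n + i + S.deg by ring] at h3
    · rwa [show n + S.deg + (-S.deg + i + S.deg) = n + i + S.deg by ring] at h4
  d :=
    { toFun m := (N.d m.1, ⟨N.d m.2.1, (N.d.map_smul _ m.2.1).symm.trans (congrArg N.d m.2.2)⟩)
      map_add' _ _ := Prod.ext (map_add N.d _ _) (Subtype.ext (map_add N.d _ _))
      map_smul' a m := by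
        refine Prod.ext ?_ (Subtype.ext ?_) <;>
        · change N.d (op _ • m.1 + op _ • m.2.1) = op _ • N.d m.1 + op _ • N.d m.2.1
          rw [map_add, map_smul, map_smul]
          rfl }
  d_mem {k m} hm := ⟨N.d_mem hm.1, by
    have := N.d_mem hm.2
    rwa [add_right_comm] at this⟩
  d_d m := Prod.ext (N.d_d _) (Subtype.ext (N.d_d _))

lemma sub_induced_iff [GradedAlgebra 𝒜] (N : DGModule ℬ) (m : N.carrier × S.second N) :
    m ∈ S.sub (S.induced N) ↔ m.2 = 0 := by
  have h : ∀ m : N.carrier × S.second N, op S.e • m = (m.1, 0) := fun m => by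
    refine Prod.ext ?_ (Subtype.ext ?_)
    · change op (S.p S.e) • m.1 + op (S.p (S.δ * S.e)) • m.2.1 = m.1
      rw [p_e, op_one, one_smul, e, δ_e, map_zero, op_zero, zero_smul, add_zero]
    · change op (S.p (S.e * S.ω)) • m.1 + op (S.p (S.δ * S.e * S.ω)) • m.2.1 = 0
      rw [e, e_ω, δ_e, zero_mul, map_zero, op_zero, zero_smul, zero_smul, add_zero]
  change op S.e • m = m ↔ _
  rw [h]
  exact ⟨fun h => (congrArg Prod.snd h).symm, fun h => Prod.ext rfl h.symm⟩

/-- The DG module `X e` over `B ≅ e A e`. -/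
def cornerObj [GradedAlgebra ℬ] (X : DGModule 𝒜) : DGModule ℬ where
  carrier := S.sub X
  gr n := (X.gr n).comap (S.sub X).subtype
  isInternal := isInternal_comap X.isInternal (S.sub X).subtype (S.mulE X) S.mulE_coe
    fun _ _ hm => S.mulE_mem hm
  smul_mem hm ha := X.smul_mem hm (S.φ_mem ha)
  d :=
    { toFun m := ⟨X.d m.1, (X.d.map_smul (op S.e) m.1).symm.trans (congrArg X.d m.2)⟩
      map_add' _ _ := Subtype.ext (map_add X.d _ _)
      map_smul' b m := Subtype.ext (X.d.map_smul (op (S.φ b.unop)) m.1) }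
  d_mem hm := X.d_mem hm
  d_d m := Subtype.ext (X.d_d m.1)

section

variable [GradedAlgebra ℬ]

/-- The functor `X ↦ X e`. -/
def functor : DGModule 𝒜 ⥤ DGModule ℬ where
  obj X := S.cornerObj X
  map {X Y} f := show Hom (S.cornerObj X) (S.cornerObj Y) from
    { map :=
        { toFun m := ⟨Hom.map f m.1,
            ((Hom.map f).map_smul (op S.e) m.1).symm.trans (congrArg (Hom.map f) m.2)⟩
          map_add' _ _ := Subtype.ext (map_add (Hom.map f) _ _)
          map_smul' b m := Subtype.ext ((Hom.map f).map_smul (op (S.φ b.unop)) m.1) }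
      map_mem := fun hm => Hom.map_mem f hm
      comm := fun m => Subtype.ext (Hom.comm f m.1) }

lemma mulE_map {X Y : DGModule 𝒜} (f : X ⟶ Y) (m : X.carrier) :
    S.mulE Y (Hom.map f m) = Hom.map (S.functor.map f) (S.mulE X m) :=
  Subtype.ext ((Hom.map f).map_smul (op S.e) m).symm

lemma mulω_map {X Y : DGModule 𝒜} (f : X ⟶ Y) (m : X.carrier) :
    S.mulω Y (Hom.map f m) = Hom.map (S.functor.map f) (S.mulω X m) :=
  Subtype.ext ((Hom.map f).map_smul (op S.ω) m).symm

lemma mulE_d (X : DGModule 𝒜) (m : X.carrier) :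
    S.mulE X (X.d m) = (S.functor.obj X).d (S.mulE X m) :=
  Subtype.ext (X.d.map_smul (op S.e) m).symm

lemma mulω_d (X : DGModule 𝒜) (m : X.carrier) :
    S.mulω X (X.d m) = (S.functor.obj X).d (S.mulω X m) :=
  Subtype.ext (X.d.map_smul (op S.ω) m).symm

instance : S.functor.Faithful where
  map_injective {X Y f g} h := by
    ext m
    rw [S.eq_add Y (Hom.map f m), S.eq_add Y (Hom.map g m), mulE_map, mulω_map, mulE_map,
      mulω_map, h]

/-- The extension to `X` of a morphism defined on `X e`. -/
def lift {X Y : DGModule 𝒜} (g : S.functor.obj X ⟶ S.functor.obj Y) : X ⟶ Y :=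
  let h : S.sub X →ₗ[Bᵐᵒᵖ] S.sub Y := Hom.map g
  show Hom X Y from
  { map :=
      { toFun m := (h (S.mulE X m)).1 + op S.δ • (h (S.mulω X m)).1
        map_add' m n := by
          simp only [map_add, AddSubgroup.coe_add, smul_add]
          abel
        map_smul' a m := by
          obtain ⟨a, rfl⟩ := op_surjective a
          simp only [RingHom.id_apply, mulE_smul, mulω_smul, map_add, map_smul,
            AddSubgroup.coe_add, smul_add]
          rw [smul_smul (op a), ← op_mul, S.op_smul_coe a, S.op_smul_coe (S.δ * a)]
          abel }
    map_mem := fun {n m} hm => by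
      refine add_mem (Hom.map_mem g (m := S.mulE X m) (S.mulE_mem hm)) ?_
      have := Y.smul_mem (Hom.map_mem g (m := S.mulω X m) (S.mulω_mem hm)) S.δ_mem
      rwa [add_neg_cancel_right] at this
    comm := fun m => by
      have hd : ∀ m : S.sub X, (h ((S.functor.obj X).d m)).1 = Y.d (h m).1 := fun m =>
        congrArg Subtype.val (Hom.comm g m)
      change (h (S.mulE X (X.d m))).1 + op S.δ • (h (S.mulω X (X.d m))).1 =
        Y.d ((h (S.mulE X m)).1 + op S.δ • (h (S.mulω X m)).1)
      rw [map_add, map_smul, ← hd, ← hd, mulE_d, mulω_d] }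

instance : S.functor.Full where
  map_surjective {X Y} g := by
    let h : S.sub X →ₗ[Bᵐᵒᵖ] S.sub Y := Hom.map g
    have key : ∀ m : S.sub X, (h (S.mulE X m)).1 + op S.δ • (h (S.mulω X m)).1 = (h m).1 :=
      fun m => by
        rw [mulE_coe, mulω_coe, map_zero, AddSubgroup.coe_zero, smul_zero, add_zero]
    exact ⟨S.lift g, hom_ext fun m => Subtype.ext (key m)⟩

/-- The isomorphism `(N ⊕ N ε) e ≅ N`. -/
def inducedIso [GradedAlgebra 𝒜] (N : DGModule ℬ) : S.functor.obj (S.induced N) ≅ N :=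
  isoOfEq (X := S.functor.obj (S.induced N)) (Y := N)
    (show S.sub (S.induced N) ≃ₗ[Bᵐᵒᵖ] N.carrier from
    { toFun m := m.1.1
      map_add' _ _ := rfl
      map_smul' b m := by
        have h0 : m.1.2 = 0 := (S.sub_induced_iff N _).1 m.2
        change op (S.p (S.φ b.unop)) • m.1.1 + op (S.p (S.δ * S.φ b.unop)) • m.1.2.1 = b • m.1.1
        rw [p_φ, h0, AddSubgroup.coe_zero, smul_zero, add_zero, op_unop]
      invFun n := ⟨(n, 0), (S.sub_induced_iff N _).2 rfl⟩
      left_inv m := Subtype.ext (Prod.ext rfl ((S.sub_induced_iff N _).1 m.2).symm)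
      right_inv _ := rfl })
    (fun n m => ⟨fun h => h.1, fun h => ⟨h, by
      have h0 : m.1.2 = 0 := (S.sub_induced_iff N _).1 m.2
      change m.1.2.1 ∈ N.gr (n + S.deg)
      rw [h0]
      exact zero_mem (N.gr (n + S.deg))⟩⟩)
    fun _ => rfl

instance [GradedAlgebra 𝒜] : S.functor.EssSurj := ⟨fun N => ⟨_, ⟨S.inducedIso N⟩⟩⟩

instance [GradedAlgebra 𝒜] : S.functor.IsEquivalence where

lemma quasiIso_functor_map_iff {X Y : DGModule 𝒜} (f : X ⟶ Y) :
    quasiIso 𝒜 f ↔ quasiIso ℬ (S.functor.map f) := by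
  rw [DGModule.quasiIso_iff, DGModule.quasiIso_iff]
  constructor
  · rintro ⟨h1, h2⟩
    refine ⟨fun m hm => ?_, fun y hy => ?_⟩
    · rintro ⟨y, hy⟩
      obtain ⟨x, hx⟩ := h1 _ (congrArg Subtype.val hm) ⟨y.1, congrArg Subtype.val hy⟩
      exact ⟨S.mulE X x, by rw [← mulE_d, hx]; exact S.mulE_coe m⟩
    · obtain ⟨m, hm, z, hz⟩ := h2 y.1 (congrArg Subtype.val hy)
      refine ⟨S.mulE X m, by rw [← mulE_d, hm, map_zero]; rfl, S.mulE Y z, ?_⟩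
      rw [← mulE_d, hz, map_sub, mulE_map]
      exact congrArg (fun w : (S.functor.obj Y).carrier =>
        Hom.map (S.functor.map f) (S.mulE X m) - w) (S.mulE_coe y)
  · rintro ⟨h1, h2⟩
    refine ⟨fun m hm => ?_, fun y hy => ?_⟩
    · rintro ⟨y, hy⟩
      obtain ⟨x, hx⟩ := h1 (S.mulE X m) (by rw [← mulE_d, hm, map_zero]; rfl)
        ⟨S.mulE Y y, by rw [← mulE_d, hy, mulE_map]⟩
      obtain ⟨x', hx'⟩ := h1 (S.mulω X m) (by rw [← mulω_d, hm, map_zero]; rfl)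
        ⟨S.mulω Y y, by rw [← mulω_d, hy, mulω_map]⟩
      refine ⟨x.1 + op S.δ • x'.1, ?_⟩
      rw [map_add, map_smul, S.eq_add X m, ← hx, ← hx']
      rfl
    · obtain ⟨m, hm, z, hz⟩ := h2 (S.mulE Y y) (by rw [← mulE_d, hy, map_zero]; rfl)
      obtain ⟨m', hm', z', hz'⟩ := h2 (S.mulω Y y) (by rw [← mulω_d, hy, map_zero]; rfl)
      refine ⟨m.1 + op S.δ • m'.1, ?_, z.1 + op S.δ • z'.1, ?_⟩
      · have e1 : X.d m.1 = 0 := congrArg Subtype.val hm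
        have e2 : X.d m'.1 = 0 := congrArg Subtype.val hm'
        rw [map_add, map_smul, e1, e2, smul_zero, add_zero]
      · have e1 : Y.d z.1 = Hom.map f m.1 - (S.mulE Y y).1 := congrArg Subtype.val hz
        have e2 : Y.d z'.1 = Hom.map f m'.1 - (S.mulω Y y).1 := congrArg Subtype.val hz'
        conv_rhs => rw [S.eq_add Y y]
        rw [map_add, map_smul, map_add, map_smul, e1, e2, smul_sub]
        abel

lemma quasiIso_eq : quasiIso 𝒜 = (quasiIso ℬ).inverseImage S.functor := by
  ext X Y f
  exact S.quasiIso_functor_map_iff f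

lemma functor_map_scalar [GradedAlgebra 𝒜] (c : K) (X : DGModule 𝒜) :
    S.functor.map ((DGModule.scalar 𝒜 c).app X) = (DGModule.scalar ℬ c).app (S.functor.obj X) := by
  refine hom_ext fun m => Subtype.ext ?_
  obtain ⟨m, hm⟩ := m
  change op (algebraMap K A c) • m = op (S.φ (algebraMap K B c)) • m
  have h : S.φ (algebraMap K B c) = S.e * algebraMap K A c := by
    rw [Algebra.algebraMap_eq_smul_one, map_smul, ← e, Algebra.smul_def, Algebra.commutes]
  rw [h, op_mul, mul_smul]
  exact congrArg _ hm.symm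

instance : S.functor.CommShift ℤ where
  commShiftIso n := NatIso.ofComponents (fun X =>
    isoOfEq (X := S.cornerObj (X.shift n)) (Y := (S.cornerObj X).shift n)
      (show S.sub (X.shift n) ≃ₗ[Bᵐᵒᵖ] S.sub X from LinearEquiv.refl Bᵐᵒᵖ (S.sub X))
      (fun _ _ => Iff.rfl) (fun m => Subtype.ext rfl)) (fun _ => rfl)
  commShiftIso_zero := by
    refine Iso.ext (NatTrans.ext (funext fun X => hom_ext fun m => ?_))
    rfl
  commShiftIso_add a b := by
    refine Iso.ext (NatTrans.ext (funext fun X => hom_ext fun m => ?_))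
    rfl

/-- The functor commutes with cones. -/
def coneIso {X Y : DGModule 𝒜} (f : X ⟶ Y) :
    S.functor.obj (cone f) ≅ cone (S.functor.map f) :=
  isoOfEq (X := S.cornerObj (cone f)) (Y := cone (S.functor.map f))
    (show S.sub (cone f) ≃ₗ[Bᵐᵒᵖ] S.sub Y × S.sub X from
    { toFun m := (⟨m.1.1, congrArg Prod.fst m.2⟩, ⟨m.1.2, congrArg Prod.snd m.2⟩)
      map_add' _ _ := rfl
      map_smul' _ _ := rfl
      invFun m := ⟨(m.1.1, m.2.1), Prod.ext m.1.2 m.2.2⟩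
      left_inv _ := rfl
      right_inv _ := rfl })
    (fun _ _ => Iff.rfl) (fun _ => rfl)

/-- The functor commutes with the formation of cone triangles. -/
def mapConeTriangleIso {X Y : DGModule 𝒜} (f : X ⟶ Y) :
    S.functor.mapTriangle.obj (coneTriangle f) ≅ coneTriangle (S.functor.map f) :=
  Pretriangulated.Triangle.isoMk _ _ (Iso.refl _) (Iso.refl _) (S.coneIso f)
    (hom_ext fun _ => rfl) (hom_ext fun _ => rfl) (hom_ext fun _ => rfl)

end

end CornerData

section IdealModule

open DGModule

variable {ℬ : ℤ → Submodule K B} (ε : B)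

/-- The right ideal `ε B`, for an idempotent `ε`. -/
def rightIdeal : AddSubgroup B where
  carrier := {b | ε * b = b}
  add_mem' ha hb := (mul_add _ _ _).trans (congrArg₂ (· + ·) ha hb)
  zero_mem' := mul_zero _
  neg_mem' ha := (mul_neg _ _).trans (congrArg Neg.neg ha)

instance : Module Bᵐᵒᵖ (rightIdeal ε) where
  smul b m := ⟨m.1 * b.unop, (mul_assoc _ _ _).symm.trans (congrArg (· * b.unop) m.2)⟩
  one_smul _ := Subtype.ext (mul_one _)
  mul_smul _ _ _ := Subtype.ext (mul_assoc _ _ _).symm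
  smul_zero _ := Subtype.ext (zero_mul _)
  smul_add _ _ _ := Subtype.ext (add_mul _ _ _)
  add_smul _ _ _ := Subtype.ext (mul_add _ _ _)
  zero_smul _ := Subtype.ext (mul_zero _)

variable {ε} [GradedAlgebra ℬ] (hε : ε * ε = ε) (h0 : ε ∈ ℬ 0)

/-- The right ideal `ε B` as a DG module. -/
def idealModule : DGModule ℬ where
  carrier := rightIdeal ε
  gr n := (ℬ n).toAddSubgroup.comap (rightIdeal ε).subtype
  isInternal := isInternal_comap (DirectSum.Decomposition.isInternal ℬ :
      DirectSum.IsInternal fun n => (ℬ n).toAddSubgroup) (rightIdeal ε).subtype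
    { toFun b := ⟨ε * b, by
        change ε * (ε * b) = ε * b
        rw [← mul_assoc, hε]⟩
      map_zero' := Subtype.ext (mul_zero _)
      map_add' _ _ := Subtype.ext (mul_add _ _ _) }
    (fun b => Subtype.ext b.2)
    fun k b hb => by
      have := SetLike.mul_mem_graded h0 hb
      rwa [zero_add] at this
  smul_mem hm ha := SetLike.mul_mem_graded (A := ℬ) hm ha
  d := 0
  d_mem _ := zero_mem _
  d_d _ := rfl

/-- `ε B` is a direct summand of `B`. -/
def idealModuleRetract : Retract (idealModule hε h0) (regular ℬ) where
  i := show Hom (idealModule hε h0) (regular ℬ) from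
    { map := 
        { toFun := fun b : rightIdeal ε => b.1
          map_add' _ _ := rfl
          map_smul' _ _ := rfl }
      map_mem := fun hm => hm
      comm := fun _ => rfl }
  r := show Hom (regular ℬ) (idealModule hε h0) from
    { map := 
        { toFun := fun b : B => (⟨ε * b, by
            change ε * (ε * b) = ε * b
            rw [← mul_assoc, hε]⟩ : rightIdeal ε)
          map_add' b c := Subtype.ext (mul_add ε (b : B) c)
          map_smul' c b := Subtype.ext (mul_assoc ε b c.unop).symm }
      map_mem := fun hm => by
        have := SetLike.mul_mem_graded h0 hm
        rwa [zero_add] at this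
      comm := fun _ => Subtype.ext (mul_zero _) }
  retract := hom_ext fun m => Subtype.ext (by exact m.2)

lemma isPerfect_idealModule :
    DerivedCat.IsPerfect ℬ ((DerivedCat.Q ℬ).obj (idealModule hε h0)) :=
  .retract _ _ ((idealModuleRetract hε h0).map _) .regular

end IdealModule

namespace CornerData

open DGModule

variable {𝒜 : ℤ → Submodule K A} {ℬ : ℤ → Submodule K B} (S : CornerData 𝒜 ℬ)

lemma p_mul_φ (a : A) (b : B) : S.p (a * S.φ b) = S.p a * b := by
  rw [S.p_mul, ← S.e_mul_φ b, ← mul_assoc S.δ, e, S.δ_e, zero_mul, map_zero, mul_zero, add_zero,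
    ← e, S.e_mul_φ, S.p_φ]

lemma ε_mul_ε : S.p (S.δ * S.ω) * S.p (S.δ * S.ω) = S.p (S.δ * S.ω) := S.p_mul_ε S.δ

lemma p_ω_mul (a : A) : S.p (S.ω * a) = 0 := by
  apply S.φ_injective
  rw [S.φ_p, ← mul_assoc, S.e_ω, zero_mul, zero_mul, map_zero]

lemma p_δ_mul_φ (b : B) : S.p (S.δ * S.φ b) = 0 := by
  rw [p_mul_φ, p_δ, zero_mul]

lemma φ_mul_δ_mul_ω (b : B) : S.p (S.δ * (S.ω * S.φ b)) = S.p (S.δ * S.ω) * b := by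
  rw [← mul_assoc, p_mul_φ]

variable [GradedAlgebra 𝒜]

/-- The underlying element of `A` of an element of `A e`. -/
abbrev toA (m : S.sub (regular 𝒜)) : A := m.1

variable [GradedAlgebra ℬ]

/-- The DG module `A e` over `e A e`, as a cone. -/
def regularIso : S.functor.obj (regular 𝒜) ≅
    cone (X := (idealModule S.ε_mul_ε S.ε_mem).shift (-1 - S.deg)) (Y := regular ℬ)
      (show Hom _ _ from ⟨0, fun _ => zero_mem _, fun _ => rfl⟩) :=
  isoOfEq (X := S.cornerObj (regular 𝒜))
    (Y := cone (X := (idealModule S.ε_mul_ε S.ε_mem).shift (-1 - S.deg)) (Y := regular ℬ)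
      (show Hom _ _ from ⟨0, fun _ => zero_mem _, fun _ => rfl⟩))
    (show S.sub (regular 𝒜) ≃ₗ[Bᵐᵒᵖ] B × rightIdeal (S.p (S.δ * S.ω)) from
    { toFun m := (S.p (S.toA m), ⟨S.p (S.δ * S.toA m), S.ε_mul_p _⟩)
      map_add' m n := Prod.ext (map_add S.p (S.toA m) (S.toA n)) (Subtype.ext
        ((congrArg S.p (mul_add S.δ (S.toA m) (S.toA n))).trans (map_add S.p _ _)))
      map_smul' b m := Prod.ext (S.p_mul_φ (S.toA m) b.unop) (Subtype.ext (by
        change S.p (S.δ * (S.toA m * S.φ b.unop)) = S.p (S.δ * S.toA m) * b.unop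
        rw [← mul_assoc, p_mul_φ]))
      invFun m := ⟨(S.φ m.1 + S.ω * S.φ m.2.1 : A), by
        change (S.φ m.1 + S.ω * S.φ m.2.1 : A) * S.e = S.φ m.1 + S.ω * S.φ m.2.1
        rw [add_mul, mul_assoc, φ_mul_e, φ_mul_e]⟩
      left_inv m := Subtype.ext (by
        have := S.mul_eq_add (a := S.toA m) m.2
        rw [e_mul_φ] at this
        exact this.symm)
      right_inv m := by
        refine Prod.ext ?_ (Subtype.ext ?_)
        · change S.p (S.φ m.1 + S.ω * S.φ m.2.1) = m.1
          rw [map_add, p_φ, p_ω_mul, add_zero]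
        · change S.p (S.δ * (S.φ m.1 + S.ω * S.φ m.2.1)) = m.2.1
          rw [mul_add, map_add, p_δ_mul_φ, φ_mul_δ_mul_ω, zero_add]
          exact m.2.2 })
    (fun n m => by
      change S.toA m ∈ 𝒜 n ↔ S.p (S.toA m) ∈ ℬ n ∧ S.p (S.δ * S.toA m) ∈ ℬ (n + 1 + (-1 - S.deg))
      constructor
      · intro h
        have := S.p_mem (SetLike.mul_mem_graded S.δ_mem h)
        exact ⟨S.p_mem h, by rwa [show n + 1 + (-1 - S.deg) = -S.deg + n by ring]⟩
      · rintro ⟨h1, h2⟩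
        have := S.mul_eq_add (a := S.toA m) m.2
        rw [e_mul_φ] at this
        rw [this]
        refine add_mem (S.φ_mem h1) ?_
        have := SetLike.mul_mem_graded S.ω_mem (S.φ_mem h2)
        rwa [show S.deg + (n + 1 + (-1 - S.deg)) = n by ring] at this)
    fun m => by
      refine Prod.ext ?_ (Subtype.ext ?_)
      · change S.p 0 = 0 + 0
        rw [map_zero, add_zero]
      · change S.p (S.δ * 0) =
          (-((((-1 - S.deg).negOnePow : ℤ) • (0 : rightIdeal (S.p (S.δ * S.ω)))))).1
        rw [mul_zero, map_zero, smul_zero, neg_zero]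
        rfl

lemma isPerfect_functor_obj_regular :
    DerivedCat.IsPerfect ℬ ((DerivedCat.Q ℬ).obj (S.functor.obj (regular 𝒜))) := by
  refine DerivedCat.IsPerfect.of_iso ((DerivedCat.Q ℬ).mapIso S.regularIso.symm) ?_
  refine DerivedCat.IsPerfect.cone ((DerivedCat.Q ℬ).mapTriangle.obj (coneTriangle _))
    ⟨_, _, _, ⟨Iso.refl _⟩⟩ ?_ .regular
  exact ((isPerfect_idealModule S.ε_mul_ε S.ε_mem).shift _ (-1 - S.deg)).of_iso
    (((DerivedCat.Q ℬ).commShiftIso (-1 - S.deg)).symm.app _)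

/-- `B` is a direct summand of `A e`. -/
def regularRetract : Retract (regular ℬ) (S.functor.obj (regular 𝒜)) where
  i := show Hom (regular ℬ) (S.cornerObj (regular 𝒜)) from
    { map :=
        { toFun := fun b : B => (⟨S.φ b, S.φ_mul_e b⟩ : S.sub (regular 𝒜))
          map_add' _ _ := Subtype.ext (map_add S.φ _ _)
          map_smul' c b := Subtype.ext (map_mul S.φ (show B from b) c.unop) }
      map_mem := S.φ_mem
      comm := fun _ => Subtype.ext (map_zero S.φ) }
  r := show Hom (S.cornerObj (regular 𝒜)) (regular ℬ) from
    { map :=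
        { toFun := fun a : S.sub (regular 𝒜) => S.p a.1
          map_add' _ _ := map_add S.p _ _
          map_smul' c a := S.p_mul_φ a.1 c.unop }
      map_mem := S.p_mem
      comm := fun _ => map_zero S.p }
  retract := hom_ext S.p_φ

lemma isPerfect_of_iso (Y : DGModule 𝒜) (h : Nonempty (S.functor.obj Y ≅ regular ℬ)) :
    DerivedCat.IsPerfect 𝒜 ((DerivedCat.Q 𝒜).obj Y) := by
  obtain ⟨i⟩ := h
  let r : Retract (S.functor.obj Y) (S.functor.obj (regular 𝒜)) :=
    (Retract.ofIso i).trans S.regularRetract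
  refine .retract _ _ (Retract.map (X := Y) (Y := regular 𝒜)
    ⟨S.functor.preimage r.i, S.functor.preimage r.r, ?_⟩ (DerivedCat.Q 𝒜)) .regular
  apply S.functor.map_injective
  simp

include S in
theorem derived_triangleEquivalent :
    TriangleEquivalent (DerivedCat.distinguished 𝒜) (DerivedCat.distinguished ℬ)
      (DerivedCat.scalar 𝒜) (DerivedCat.scalar ℬ) :=
  _root_.derived_triangleEquivalent S.functor S.quasiIso_eq (fun f => ⟨S.mapConeTriangleIso f⟩)
    S.functor_map_scalar

include S in
theorem perfect_triangleEquivalent :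
    TriangleEquivalent (PerfectCat.distinguished 𝒜) (PerfectCat.distinguished ℬ)
      (PerfectCat.scalar 𝒜) (PerfectCat.scalar ℬ) :=
  _root_.perfect_triangleEquivalent S.functor S.quasiIso_eq (fun f => ⟨S.mapConeTriangleIso f⟩)
    S.functor_map_scalar S.isPerfect_functor_obj_regular S.isPerfect_of_iso

end CornerData

end Morita

namespace GradedBoundQuiver

variable {K : Type u} [Field K] (B : GradedBoundQuiver K)

/-- The class of a trivial path in `KQ / ⟨I⟩`. -/
def idem (v : B.V) : B.Alg := B.proj (B.vertex v)

/-- The class of an arrow in `KQ / ⟨I⟩`. -/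
def arr (a : B.E) : B.Alg := B.proj (B.arrow a)

lemma proj_eq_zero {x : B.Free K} (hx : x ∈ B.rel) : B.proj x = 0 := by
  rw [← map_zero B.proj]
  exact RingQuot.mkAlgHom_rel K (Or.inr ⟨hx, rfl⟩)

lemma idem_mul_self (v : B.V) : B.idem v * B.idem v = B.idem v := by
  rw [idem, ← map_mul]
  exact RingQuot.mkAlgHom_rel K (Or.inl (.idem v))

lemma idem_mul_of_ne {v w : B.V} (h : v ≠ w) : B.idem v * B.idem w = 0 := by
  rw [idem, idem, ← map_mul, ← map_zero B.proj]
  exact RingQuot.mkAlgHom_rel K (Or.inl (.orth v w h))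

lemma sum_idem : ∑ v, B.idem v = 1 := by
  simp only [idem, ← map_sum]
  rw [← map_one B.proj]
  exact RingQuot.mkAlgHom_rel K (Or.inl .one)

lemma idem_tgt_mul (a : B.E) : B.idem (B.tgt a) * B.arr a = B.arr a := by
  rw [idem, arr, ← map_mul]
  exact RingQuot.mkAlgHom_rel K (Or.inl (.tgt a))

lemma mul_idem_src (a : B.E) : B.arr a * B.idem (B.src a) = B.arr a := by
  rw [idem, arr, ← map_mul]
  exact RingQuot.mkAlgHom_rel K (Or.inl (.src a))

lemma idem_mem (v : B.V) : B.idem v ∈ B.grading 0 := ⟨_, GradedQuiver.homog_vertex v, rfl⟩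

lemma arr_mem (a : B.E) : B.arr a ∈ B.grading (B.deg a) := ⟨_, GradedQuiver.homog_arrow a, rfl⟩

variable {B} in
/-- `KQ / ⟨I⟩` is generated by the trivial paths and the arrows as an algebra without unit. -/
lemma alg_induction {P : B.Alg → Prop} (hv : ∀ v, P (B.idem v)) (ha : ∀ a, P (B.arr a))
    (zero : P 0) (add : ∀ x y, P x → P y → P (x + y)) (smul : ∀ (c : K) x, P x → P (c • x))
    (mul : ∀ x y, P x → P y → P (x * y)) (x : B.Alg) : P x := by
  obtain ⟨x, rfl⟩ := RingQuot.mkAlgHom_surjective K B.Rel x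
  induction x using FreeAlgebra.induction with
  | grade0 c =>
    rw [AlgHom.commutes, Algebra.algebraMap_eq_smul_one, ← sum_idem]
    exact smul c _ (Finset.sum_induction _ P add zero fun v _ => hv v)
  | grade1 g => exact g.casesOn hv ha
  | mul x y hx hy =>
    rw [map_mul]
    exact mul _ _ hx hy
  | add x y hx hy =>
    rw [map_add]
    exact add _ _ hx hy

section Lift

variable {R : Type u} [Ring R] [Algebra K R]

/-- The algebra structure of a corner. -/
abbrev cornerAlgebra {e : R} (he : IsIdempotentElem e) : Algebra K he.Corner :=
  RingHom.toAlgebra'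
    { toFun c := ⟨c • e, c • e, by simp [he.eq]⟩
      map_one' := Subtype.ext (one_smul K e)
      map_mul' c c' := Subtype.ext (by
        change (c * c') • e = (c • e) * (c' • e)
        rw [smul_mul_smul_comm, he.eq])
      map_zero' := Subtype.ext (zero_smul K e)
      map_add' c c' := Subtype.ext (add_smul c c' e) }
    fun c x => Subtype.ext (by
      change (c • e) * x.1 = x.1 * (c • e)
      have := (Subsemigroup.mem_corner_iff he).1 x.2
      rw [smul_mul_assoc, mul_smul_comm, this.1, this.2])

/-- A map on generators that is compatible with the relations, except that the trivial paths need
not add up to `1`, extends to a homomorphism of algebras without unit. -/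
lemma exists_nonUnitalAlgHom (f : B.V → R) (g : B.E → R) (hf : ∀ v, f v * f v = f v)
    (hf' : ∀ v w, v ≠ w → f v * f w = 0) (ht : ∀ a, f (B.tgt a) * g a = g a)
    (hs : ∀ a, g a * f (B.src a) = g a)
    (hrel : ∀ x ∈ B.rel, FreeAlgebra.lift K (Sum.elim f g) x = 0) :
    ∃ Φ : B.Alg →ₙₐ[K] R, (∀ v, Φ (B.idem v) = f v) ∧ ∀ a, Φ (B.arr a) = g a := by
  classical
  let e := ∑ v, f v
  have he1 : ∀ v, e * f v = f v := fun v => by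
    rw [Finset.sum_mul, Finset.sum_eq_single v (fun w _ h => hf' w v h) (by simp), hf]
  have he2 : ∀ v, f v * e = f v := fun v => by
    rw [Finset.mul_sum, Finset.sum_eq_single v (fun w _ h => hf' v w h.symm) (by simp), hf]
  have he : IsIdempotentElem e := by
    change e * ∑ v, f v = e
    rw [Finset.mul_sum]
    exact Finset.sum_congr rfl fun v _ => he1 v
  have hh1 : ∀ x, e * Sum.elim f g x = Sum.elim f g x := by
    rintro (v | a)
    · exact he1 v
    · change e * g a = g a
      rw [← ht, ← mul_assoc, he1]
  have hh2 : ∀ x, Sum.elim f g x * e = Sum.elim f g x := by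
    rintro (v | a)
    · exact he2 v
    · change g a * e = g a
      rw [← hs, mul_assoc, he2]
  let _ : Algebra K he.Corner := cornerAlgebra he
  let h : B.V ⊕ B.E → he.Corner := fun x =>
    ⟨Sum.elim f g x, (Subsemigroup.mem_corner_iff he).2 ⟨hh1 x, hh2 x⟩⟩
  let c : he.Corner → R := Subtype.val
  have hc : ∀ x, c (FreeAlgebra.lift K h x) = e * FreeAlgebra.lift K (Sum.elim f g) x ∧
      c (FreeAlgebra.lift K h x) = FreeAlgebra.lift K (Sum.elim f g) x * e := fun x => by
    induction x using FreeAlgebra.induction with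
    | grade0 r =>
      rw [AlgHom.commutes, AlgHom.commutes, Algebra.algebraMap_eq_smul_one (A := R),
        mul_smul_comm, smul_mul_assoc, mul_one, one_mul]
      exact ⟨rfl, rfl⟩
    | grade1 x =>
      rw [FreeAlgebra.lift_ι_apply, FreeAlgebra.lift_ι_apply, hh1, hh2]
      exact ⟨rfl, rfl⟩
    | mul x y hx hy =>
      have hcm : ∀ x y, c (x * y) = c x * c y := fun _ _ => rfl
      have hce : ∀ x, e * c x = c x := fun x => ((Subsemigroup.mem_corner_iff he).1 x.2).1
      have hce' : ∀ x, c x * e = c x := fun x => ((Subsemigroup.mem_corner_iff he).1 x.2).2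
      rw [map_mul, map_mul, hcm]
      constructor
      · rw [hy.1, ← mul_assoc, hce', hx.1, mul_assoc]
      · rw [hx.2, mul_assoc, hce, hy.2, mul_assoc]
    | add x y hx hy =>
      have hca : ∀ x y, c (x + y) = c x + c y := fun _ _ => rfl
      rw [map_add, map_add, hca, mul_add, add_mul]
      exact ⟨congrArg₂ _ hx.1 hy.1, congrArg₂ _ hx.2 hy.2⟩
  have key : ∀ x y, B.Rel x y → FreeAlgebra.lift K h x = FreeAlgebra.lift K h y := by
    rintro x y (h1 | ⟨h1, rfl⟩)
    · refine Subtype.ext ?_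
      cases h1 with
      | idem v =>
        rw [map_mul]
        simp only [GradedQuiver.vertex, FreeAlgebra.lift_ι_apply]
        exact hf v
      | orth v w hvw =>
        rw [map_mul, map_zero]
        simp only [GradedQuiver.vertex, FreeAlgebra.lift_ι_apply]
        exact hf' v w hvw
      | one =>
        refine (hc _).1.trans ?_
        rw [map_sum]
        simp only [GradedQuiver.vertex, FreeAlgebra.lift_ι_apply]
        rw [map_one]
        exact he
      | tgt a =>
        rw [map_mul]
        simp only [GradedQuiver.vertex, GradedQuiver.arrow, FreeAlgebra.lift_ι_apply]
        exact ht a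
      | src a =>
        rw [map_mul]
        simp only [GradedQuiver.vertex, GradedQuiver.arrow, FreeAlgebra.lift_ι_apply]
        exact hs a
    · refine Subtype.ext ((hc x).1.trans ?_)
      rw [hrel x h1, mul_zero, map_zero]
      rfl
  let Ψ : B.Alg →ₐ[K] he.Corner := RingQuot.liftAlgHom K ⟨FreeAlgebra.lift K h, fun x y => key x y⟩
  have hΨ : ∀ x, Ψ (B.proj x) = FreeAlgebra.lift K h x := RingQuot.liftAlgHom_mkAlgHom_apply K _ _
  refine ⟨{ toFun x := c (Ψ x)
            map_smul' r x := ?_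
            map_zero' := congrArg c (map_zero Ψ)
            map_add' x y := congrArg c (map_add Ψ x y)
            map_mul' x y := congrArg c (map_mul Ψ x y) }, fun v => ?_, fun a => ?_⟩
  · rw [map_smul, Algebra.smul_def]
    change (r • e) * c (Ψ x) = r • c (Ψ x)
    rw [smul_mul_assoc, ((Subsemigroup.mem_corner_iff he).1 (Ψ x).2).1]
  · refine (congrArg c (hΨ _)).trans ?_
    rw [GradedQuiver.vertex, FreeAlgebra.lift_ι_apply]
    rfl
  · refine (congrArg c (hΨ _)).trans ?_
    rw [GradedQuiver.arrow, FreeAlgebra.lift_ι_apply]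
    rfl

end Lift

variable {B} {R : Type u} [Ring R] [Algebra K R] {𝒞 : ℤ → Submodule K R} [GradedAlgebra 𝒞]

lemma map_mem_of_gen (Φ : B.Alg →ₙₐ[K] R) (hv : ∀ v, Φ (B.idem v) ∈ 𝒞 0)
    (ha : ∀ a, Φ (B.arr a) ∈ 𝒞 (B.deg a)) {n : ℤ} {x : B.Alg} (hx : x ∈ B.grading n) :
    Φ x ∈ 𝒞 n := by
  obtain ⟨y, hy, rfl⟩ := Submodule.mem_map.1 hx
  change Φ (B.proj y) ∈ _
  have h1 : Φ 1 ∈ 𝒞 0 := by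
    rw [← sum_idem, map_sum]
    exact sum_mem fun v _ => hv v
  have hg : ∀ g, Φ (B.proj (FreeAlgebra.ι K g)) ∈ 𝒞 (B.genDeg g) := by
    rintro (v | a)
    · exact hv v
    · exact ha a
  clear hx
  induction hy using Submodule.span_induction with
  | mem x hx =>
    obtain ⟨l, rfl, rfl⟩ := hx
    induction l with
    | nil => simpa using h1
    | cons g l ih =>
      simp only [List.map_cons, List.prod_cons, List.sum_cons, map_mul] at ih ⊢
      exact SetLike.mul_mem_graded (hg g) ih
  | zero => simp
  | add x y _ _ hx hy => rw [map_add, map_add]; exact add_mem hx hy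
  | smul c x _ hx => rw [map_smul, map_smul]; exact Submodule.smul_mem _ _ hx

end GradedBoundQuiver

/-- A graded map reflects degrees if it is injective. -/
lemma mem_of_injective_graded {K A B : Type u} [Field K] [Ring A] [Algebra K A] [Ring B]
    [Algebra K B] {𝒜 : ℤ → Submodule K A} {ℬ : ℤ → Submodule K B} [GradedAlgebra 𝒜]
    [GradedAlgebra ℬ] (φ : B →ₙₐ[K] A) (hφ : Function.Injective φ)
    (hm : ∀ {n b}, b ∈ ℬ n → φ b ∈ 𝒜 n) {n : ℤ} {b : B} (h : φ b ∈ 𝒜 n) : b ∈ ℬ n := by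
  have key : ∀ b : B, φ (DirectSum.decompose ℬ b n : B) = (DirectSum.decompose 𝒜 (φ b) n : A) := by
    intro b
    induction b using DirectSum.Decomposition.inductionOn ℬ with
    | zero => simp
    | @homogeneous i b =>
      by_cases hi : i = n
      · subst hi
        rw [DirectSum.decompose_of_mem_same ℬ b.2, DirectSum.decompose_of_mem_same 𝒜 (hm b.2)]
      · rw [DirectSum.decompose_of_mem_ne ℬ b.2 hi, DirectSum.decompose_of_mem_ne 𝒜 (hm b.2) hi,
          map_zero]
    | add x y hx hy =>
      simp only [map_add, DirectSum.decompose_add, DirectSum.add_apply, Submodule.coe_add, hx, hy]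
  have h2 : (DirectSum.decompose ℬ b n : B) = b :=
    hφ (by rw [key, DirectSum.decompose_of_mem_same 𝒜 h])
  rw [← h2]
  exact SetLike.coe_mem _

namespace GradedPinchedGentle

open GradedQuiver

variable {Λ : GradedPinchedGentle.{u}}

namespace Kronecker

variable (κ : Λ.Kronecker)

/-- The only arrows of `Qᵍ` into the target of a Kronecker are its two arrows. -/
lemma tgt_ne {a : Λ.G} (h : a ≠ κ.α ∧ a ≠ κ.β) : Λ.tgt a ≠ Λ.tgt κ.α := by
  intro ht
  have h1 : ({a, κ.α, κ.β} : Set Λ.G) ⊆ {a | Λ.tgt a = Λ.tgt κ.α} := by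
    rintro _ (rfl | rfl | rfl)
    exacts [ht, rfl, κ.tgt_eq]
  have h2 := (Set.ncard_le_ncard h1 (Set.toFinite _)).trans (Λ.in_le _)
  rw [Set.ncard_eq_three.2 ⟨a, κ.α, κ.β, h.1, h.2, κ.ne, rfl⟩] at h2
  omega

lemma merge_of_ne {v : Λ.V} (h : v ≠ Λ.tgt κ.α) : merge κ v = ⟨v, h⟩ := dif_neg h

lemma merge_tgt : merge κ (Λ.tgt κ.α) = ⟨Λ.src κ.α, κ.not_loop⟩ := dif_pos rfl

lemma ne_of_src_eq_base {b : Λ.G} {p : Λ.P} (h : Λ.src b = Λ.base p) : b ≠ κ.α ∧ b ≠ κ.β :=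
  ⟨fun hb => κ.base_ne_src p (by rw [← h, hb]),
    fun hb => κ.base_ne_src p (by rw [← h, hb, κ.src_eq])⟩

lemma ne_of_tgt_eq_base {a : Λ.G} {p : Λ.P} (h : Λ.tgt a = Λ.base p) : a ≠ κ.α ∧ a ≠ κ.β :=
  ⟨fun hb => κ.base_ne_tgt p (by rw [← h, hb]),
    fun hb => κ.base_ne_tgt p (by rw [← h, hb, κ.tgt_eq])⟩

lemma ne_of_tgt_eq_src {a : Λ.G} (h : Λ.tgt a = Λ.src κ.α) : a ≠ κ.α ∧ a ≠ κ.β :=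
  ⟨fun ha => κ.not_loop (by rw [← h, ha]), fun ha => κ.not_loop (by rw [← h, ha, κ.tgt_eq])⟩

lemma ne_of_src_eq_tgt {b : Λ.G} (h : Λ.src b = Λ.tgt κ.α) : b ≠ κ.α ∧ b ≠ κ.β :=
  ⟨fun hb => κ.not_loop (by rw [← h, hb]), fun hb => κ.not_loop (by rw [← h, hb, κ.src_eq])⟩

end Kronecker

variable {K : Type u} [Field K] (κ : Λ.Kronecker) (μ : K)

section LocalizationGenerators

/-- The trivial paths of the localization. -/
def lV (v : Λ.V) : (localization κ μ).Alg := (localization κ μ).idem v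

/-- The arrows of `Qᵍ` in the localization. -/
def lG (a : Λ.G) : (localization κ μ).Alg := (localization κ μ).arr (some (Sum.inl a))

/-- The loops of `P` in the localization. -/
def lP (p : Λ.P) : (localization κ μ).Alg := (localization κ μ).arr (some (Sum.inr p))

/-- The inverse arrow in the localization. -/
def lδ : (localization κ μ).Alg := (localization κ μ).arr none

/-- The inverted element `α + μ β`. -/
def lω : (localization κ μ).Alg := lG κ μ κ.α + μ • lG κ μ κ.β

lemma lV_mul_self (v : Λ.V) : lV κ μ v * lV κ μ v = lV κ μ v :=
  (localization κ μ).idem_mul_self v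

lemma lV_mul_of_ne {v w : Λ.V} (h : v ≠ w) : lV κ μ v * lV κ μ w = 0 :=
  (localization κ μ).idem_mul_of_ne h

lemma sum_lV : ∑ v, lV κ μ v = 1 := (localization κ μ).sum_idem

lemma lV_mul_lG (a : Λ.G) : lV κ μ (Λ.tgt a) * lG κ μ a = lG κ μ a :=
  (localization κ μ).idem_tgt_mul (some (Sum.inl a))

lemma lG_mul_lV (a : Λ.G) : lG κ μ a * lV κ μ (Λ.src a) = lG κ μ a :=
  (localization κ μ).mul_idem_src (some (Sum.inl a))

lemma lV_mul_lP (p : Λ.P) : lV κ μ (Λ.base p) * lP κ μ p = lP κ μ p :=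
  (localization κ μ).idem_tgt_mul (some (Sum.inr p))

lemma lP_mul_lV (p : Λ.P) : lP κ μ p * lV κ μ (Λ.base p) = lP κ μ p :=
  (localization κ μ).mul_idem_src (some (Sum.inr p))

lemma lV_mul_lδ : lV κ μ (Λ.src κ.α) * lδ κ μ = lδ κ μ :=
  (localization κ μ).idem_tgt_mul none

lemma lδ_mul_lV : lδ κ μ * lV κ μ (Λ.tgt κ.α) = lδ κ μ :=
  (localization κ μ).mul_idem_src none

lemma lV_mul_lω : lV κ μ (Λ.tgt κ.α) * lω κ μ = lω κ μ := by
  rw [lω, mul_add, mul_smul_comm, lV_mul_lG, ← κ.tgt_eq, lV_mul_lG]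

lemma lω_mul_lV : lω κ μ * lV κ μ (Λ.src κ.α) = lω κ μ := by
  rw [lω, add_mul, smul_mul_assoc, lG_mul_lV, ← κ.src_eq, lG_mul_lV]

/-- The map from the free algebra of `Q` to the localization. -/
def lProj : Λ.quiver.Free K →ₐ[K] (localization κ μ).Alg :=
  AlgHom.comp (localization κ μ).proj ((Λ.boundQuiver K).incl (Sum.inl κ.α))

lemma lProj_eq_zero {x : Λ.quiver.Free K} (h : IsRel K Λ x) : lProj κ μ x = 0 :=
  (localization κ μ).proj_eq_zero (Or.inl ⟨x, h, rfl⟩)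

lemma lProj_lG (a : Λ.G) : lProj κ μ (Λ.quiver.arrow (Sum.inl a)) = lG κ μ a :=
  congrArg (localization κ μ).proj (FreeAlgebra.lift_ι_apply _ _)

lemma lProj_lP (p : Λ.P) : lProj κ μ (Λ.quiver.arrow (Sum.inr p)) = lP κ μ p :=
  congrArg (localization κ μ).proj (FreeAlgebra.lift_ι_apply _ _)

lemma lProj_lV (v : Λ.V) : lProj κ μ (Λ.quiver.vertex v) = lV κ μ v :=
  congrArg (localization κ μ).proj (FreeAlgebra.lift_ι_apply _ _)

lemma lG_mul_lG {b a : Λ.G} (h : Λ.rel b a) : lG κ μ b * lG κ μ a = 0 := by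
  have := lProj_eq_zero κ μ (IsRel.gentle b a h)
  rwa [map_mul, lProj_lG, lProj_lG] at this

lemma lG_mul_lP {b : Λ.G} {p : Λ.P} (h : Λ.src b = Λ.base p) :
    lG κ μ b * (lP κ μ p - (Λ.outStrand b).sign K • lV κ μ (Λ.base p)) = 0 := by
  have := lProj_eq_zero κ μ (IsRel.loop_out p b h)
  rwa [map_mul, map_sub, map_smul, lProj_lG, lProj_lP, lProj_lV] at this

lemma lP_mul_lG {a : Λ.G} {p : Λ.P} (h : Λ.tgt a = Λ.base p) :
    (lP κ μ p - (Λ.inStrand a).sign K • lV κ μ (Λ.base p)) * lG κ μ a = 0 := by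
  have := lProj_eq_zero κ μ (IsRel.loop_in p a h)
  rwa [map_mul, map_sub, map_smul, lProj_lG, lProj_lP, lProj_lV] at this

lemma lδ_mul_lω : lδ κ μ * lω κ μ = lV κ μ (Λ.src κ.α) := by
  let F : ((Λ.boundQuiver K).addInverse (Sum.inl κ.α)).Free K →ₐ[K] (localization κ μ).Alg :=
    (localization κ μ).proj
  have : F (arrow _ none * (arrow _ (some (Sum.inl κ.α)) + μ • arrow _ (some (Sum.inl κ.β))) -
      vertex _ (Λ.src κ.α)) = 0 := (localization κ μ).proj_eq_zero (Or.inr (Or.inl rfl))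
  rw [map_sub, map_mul, map_add, map_smul] at this
  exact sub_eq_zero.1 this

lemma lω_mul_lδ : lω κ μ * lδ κ μ = lV κ μ (Λ.tgt κ.α) := by
  let F : ((Λ.boundQuiver K).addInverse (Sum.inl κ.α)).Free K →ₐ[K] (localization κ μ).Alg :=
    (localization κ μ).proj
  have : F ((arrow _ (some (Sum.inl κ.α)) + μ • arrow _ (some (Sum.inl κ.β))) * arrow _ none -
      vertex _ (Λ.tgt κ.α)) = 0 := (localization κ μ).proj_eq_zero (Or.inr (Or.inr rfl))
  rw [map_sub, map_mul, map_add, map_smul] at this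
  exact sub_eq_zero.1 this

end LocalizationGenerators

section PinchingGenerators

variable (K)

/-- The trivial paths of the pinching. -/
def pV (v : {v : Λ.V // v ≠ Λ.tgt κ.α}) : (pinching K κ).Alg := (pinching K κ).idem v

/-- The arrows of `Qᵍ` other than `α` and `β` in the pinching. -/
def pG (a : {a : Λ.G // a ≠ κ.α ∧ a ≠ κ.β}) : (pinching K κ).Alg := (pinching K κ).arr (Sum.inl a)

/-- The loops of `P` in the pinching. -/
def pP (p : Λ.P) : (pinching K κ).Alg := (pinching K κ).arr (Sum.inr (some p))

/-- The new loop in the pinching. -/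
def pγ : (pinching K κ).Alg := (pinching K κ).arr (Sum.inr none)

/-- The vertex of the new loop. -/
def p1 : (pinching K κ).Alg := pV K κ ⟨Λ.src κ.α, κ.not_loop⟩

lemma pV_mul_self (v) : pV K κ v * pV K κ v = pV K κ v := (pinching K κ).idem_mul_self v

lemma pV_mul_of_ne {v w} (h : v ≠ w) : pV K κ v * pV K κ w = 0 := (pinching K κ).idem_mul_of_ne h

lemma p1_mul_self : p1 K κ * p1 K κ = p1 K κ := pV_mul_self K κ _

lemma p1_mul_pγ : p1 K κ * pγ K κ = pγ K κ := by
  have := (pinching K κ).idem_tgt_mul (Sum.inr none)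
  change pV K κ (merge κ (Λ.src κ.α)) * _ = _ at this
  rwa [κ.merge_of_ne κ.not_loop] at this

lemma pγ_mul_p1 : pγ K κ * p1 K κ = pγ K κ := by
  have := (pinching K κ).mul_idem_src (Sum.inr none)
  change _ * pV K κ (merge κ (Λ.src κ.α)) = _ at this
  rwa [κ.merge_of_ne κ.not_loop] at this

lemma pV_mul_pP (p : Λ.P) : pV K κ ⟨Λ.base p, κ.base_ne_tgt p⟩ * pP K κ p = pP K κ p := by
  have := (pinching K κ).idem_tgt_mul (Sum.inr (some p))
  change pV K κ (merge κ (Λ.base p)) * _ = _ at this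
  rwa [κ.merge_of_ne (κ.base_ne_tgt p)] at this

lemma pP_mul_pV (p : Λ.P) : pP K κ p * pV K κ ⟨Λ.base p, κ.base_ne_tgt p⟩ = pP K κ p := by
  have := (pinching K κ).mul_idem_src (Sum.inr (some p))
  change _ * pV K κ (merge κ (Λ.base p)) = _ at this
  rwa [κ.merge_of_ne (κ.base_ne_tgt p)] at this

lemma pV_mul_pG (a : {a : Λ.G // a ≠ κ.α ∧ a ≠ κ.β}) :
    pV K κ ⟨Λ.tgt a, κ.tgt_ne a.2⟩ * pG K κ a = pG K κ a := by
  have := (pinching K κ).idem_tgt_mul (Sum.inl a)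
  change pV K κ (merge κ (Λ.tgt a)) * _ = _ at this
  rwa [κ.merge_of_ne (κ.tgt_ne a.2)] at this

lemma pG_mul_pV (a : {a : Λ.G // a ≠ κ.α ∧ a ≠ κ.β}) (h : Λ.src a ≠ Λ.tgt κ.α) :
    pG K κ a * pV K κ ⟨Λ.src a, h⟩ = pG K κ a := by
  have := (pinching K κ).mul_idem_src (Sum.inl a)
  change _ * pV K κ (merge κ (Λ.src a)) = _ at this
  rwa [κ.merge_of_ne h] at this

lemma pG_mul_p1 (a : {a : Λ.G // a ≠ κ.α ∧ a ≠ κ.β}) (h : Λ.src a = Λ.tgt κ.α) :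
    pG K κ a * p1 K κ = pG K κ a := by
  have := (pinching K κ).mul_idem_src (Sum.inl a)
  change _ * pV K κ (merge κ (Λ.src a)) = _ at this
  rwa [h, κ.merge_tgt] at this

/-- The map from the free algebra to the pinching. -/
def pProj : (pinchingQuiver κ).Free K →ₐ[K] (pinching K κ).Alg := (pinching K κ).proj

lemma pProj_eq_zero {x : (pinchingQuiver κ).Free K} (h : IsPinchingRel K κ x) : pProj K κ x = 0 :=
  (pinching K κ).proj_eq_zero h

lemma pProj_pVertex {v : Λ.V} (h : v ≠ Λ.tgt κ.α) : pProj K κ (pVertex K κ v) = pV K κ ⟨v, h⟩ := by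
  rw [pVertex, κ.merge_of_ne h]
  rfl

variable {a b : {a : Λ.G // a ≠ κ.α ∧ a ≠ κ.β}}

lemma pG_mul_pG (h : Λ.rel b.1 a.1) : pG K κ b * pG K κ a = 0 := by
  have := pProj_eq_zero K κ (.gentle b a h)
  rw [map_mul] at this
  exact this

lemma pG_mul_pP {p : Λ.P} (h : Λ.src b.1 = Λ.base p) : pG K κ b *
    (pP K κ p - (Λ.outStrand b.1).sign K • pV K κ ⟨Λ.base p, κ.base_ne_tgt p⟩) = 0 := by
  have := pProj_eq_zero K κ (.loop_out p b h)
  rw [map_mul, map_sub, map_smul, pProj_pVertex] at this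
  exact this

lemma pP_mul_pG {p : Λ.P} (h : Λ.tgt a.1 = Λ.base p) :
    (pP K κ p - (Λ.inStrand a.1).sign K • pV K κ ⟨Λ.base p, κ.base_ne_tgt p⟩) * pG K κ a = 0 := by
  have := pProj_eq_zero K κ (.loop_in p a h)
  rw [map_mul, map_sub, map_smul, pProj_pVertex] at this
  exact this

lemma pG_mul_add (h : Λ.rel b.1 κ.α) : pG K κ b * (pγ K κ + p1 K κ) = 0 := by
  have := pProj_eq_zero K κ (.beta_out b h)
  rw [map_mul, map_add, pProj_pVertex] at this
  exact this

lemma add_mul_pG (h : Λ.rel κ.α a.1) : (pγ K κ + p1 K κ) * pG K κ a = 0 := by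
  have := pProj_eq_zero K κ (.beta_in a h)
  rw [map_mul, map_add, pProj_pVertex] at this
  exact this

lemma pG_mul_sub (h : Λ.rel b.1 κ.β) : pG K κ b * (pγ K κ - p1 K κ) = 0 := by
  have := pProj_eq_zero K κ (.alpha_out b h)
  rw [map_mul, map_sub, pProj_pVertex] at this
  exact this

lemma sub_mul_pG (h : Λ.rel κ.β a.1) : (pγ K κ - p1 K κ) * pG K κ a = 0 := by
  have := pProj_eq_zero K κ (.alpha_in a h)
  rw [map_mul, map_sub, pProj_pVertex] at this
  exact this

end PinchingGenerators

/-- The element of the localization that corresponds to the new loop of the pinching. -/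
def lγ : (localization κ μ).Alg := lδ κ μ * lG κ μ κ.α - μ • (lδ κ μ * lG κ μ κ.β)

lemma lγ_add : lγ κ μ + lV κ μ (Λ.src κ.α) = (2 : K) • (lδ κ μ * lG κ μ κ.α) := by
  rw [← lδ_mul_lω, lγ, lω, mul_add, mul_smul_comm]
  module

lemma lγ_sub : lγ κ μ - lV κ μ (Λ.src κ.α) = (-2 * μ) • (lδ κ μ * lG κ μ κ.β) := by
  rw [← lδ_mul_lω, lγ, lω, mul_add, mul_smul_comm]
  module

lemma lω_mul_lδ_mul {a : Λ.G} (h : Λ.tgt a = Λ.tgt κ.α) :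
    lω κ μ * (lδ κ μ * lG κ μ a) = lG κ μ a := by
  rw [← mul_assoc, lω_mul_lδ, ← h, lV_mul_lG]

open Classical in
/-- The images of the arrows of `Qᵍ` under the map from the pinching to the localization. -/
def toLG (a : Λ.G) : (localization κ μ).Alg :=
  if Λ.src a = Λ.tgt κ.α then lG κ μ a * lω κ μ else lG κ μ a

lemma toLG_of_eq {a : Λ.G} (h : Λ.src a = Λ.tgt κ.α) : toLG κ μ a = lG κ μ a * lω κ μ := if_pos h

lemma toLG_of_ne {a : Λ.G} (h : Λ.src a ≠ Λ.tgt κ.α) : toLG κ μ a = lG κ μ a := if_neg h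

lemma mul_toLG {x : (localization κ μ).Alg} {a : Λ.G} (h : x * lG κ μ a = 0) :
    x * toLG κ μ a = 0 := by
  by_cases ha : Λ.src a = Λ.tgt κ.α
  · rw [toLG_of_eq κ μ ha, ← mul_assoc, h, zero_mul]
  · rw [toLG_of_ne κ μ ha, h]

lemma lV_mul_toLG (a : Λ.G) : lV κ μ (Λ.tgt a) * toLG κ μ a = toLG κ μ a := by
  by_cases ha : Λ.src a = Λ.tgt κ.α
  · rw [toLG_of_eq κ μ ha, ← mul_assoc, lV_mul_lG]
  · rw [toLG_of_ne κ μ ha, lV_mul_lG]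

lemma exists_pinching_to_localization : ∃ Φ : (pinching K κ).Alg →ₙₐ[K] (localization κ μ).Alg,
    (∀ v, Φ (pV K κ v) = lV κ μ v.1) ∧ (∀ a, Φ (pG K κ a) = toLG κ μ a.1) ∧
    (∀ p, Φ (pP K κ p) = lP κ μ p) ∧ Φ (pγ K κ) = lγ κ μ := by
  let f : (pinching K κ).V → (localization κ μ).Alg := fun v => lV κ μ v.1
  let g : (pinching K κ).E → (localization κ μ).Alg :=
    Sum.elim (fun a => toLG κ μ a.1) (fun p => p.elim (lγ κ μ) (lP κ μ))
  have hm : ∀ v, v ≠ Λ.tgt κ.α → f (merge κ v) = lV κ μ v := fun v hv => by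
    rw [κ.merge_of_ne hv]
  have hm1 := hm _ κ.not_loop
  obtain ⟨Φ, h1, h2⟩ := (pinching K κ).exists_nonUnitalAlgHom f g
    (fun v => lV_mul_self κ μ _) (fun v w h => lV_mul_of_ne κ μ fun h' => h (Subtype.ext h'))
    (by
      rintro (a | _ | p)
      · change f (merge κ (Λ.tgt a)) * toLG κ μ a = toLG κ μ a
        rw [hm _ (κ.tgt_ne a.2), lV_mul_toLG]
      · change f (merge κ (Λ.src κ.α)) * lγ κ μ = lγ κ μ
        rw [hm1, lγ, mul_sub, mul_smul_comm, ← mul_assoc, lV_mul_lδ, ← mul_assoc, lV_mul_lδ]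
      · change f (merge κ (Λ.base p)) * lP κ μ p = lP κ μ p
        rw [hm _ (κ.base_ne_tgt p), lV_mul_lP])
    (by
      rintro (a | _ | p)
      · change toLG κ μ a * f (merge κ (Λ.src a)) = toLG κ μ a
        by_cases ha : Λ.src a.1 = Λ.tgt κ.α
        · rw [toLG_of_eq κ μ ha, ha, κ.merge_tgt, mul_assoc]
          exact congrArg _ (lω_mul_lV κ μ)
        · rw [toLG_of_ne κ μ ha, hm _ ha, lG_mul_lV]
      · change lγ κ μ * f (merge κ (Λ.src κ.α)) = lγ κ μ
        rw [hm1, lγ, sub_mul, smul_mul_assoc, mul_assoc, mul_assoc, lG_mul_lV]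
        conv_lhs => rw [← κ.src_eq, lG_mul_lV]
      · change lP κ μ p * f (merge κ (Λ.base p)) = lP κ μ p
        rw [hm _ (κ.base_ne_tgt p), lP_mul_lV])
    (by
      have hp : ∀ b p, Λ.src b = Λ.base p → toLG κ μ b = lG κ μ b := fun b p h =>
        toLG_of_ne κ μ (by rw [h]; exact κ.base_ne_tgt p)
      let F : (pinchingQuiver κ).Free K →ₐ[K] (localization κ μ).Alg :=
        FreeAlgebra.lift K (Sum.elim f g)
      have hV : ∀ v, v ≠ Λ.tgt κ.α → F (pVertex K κ v) = lV κ μ v := fun v hv =>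
        (FreeAlgebra.lift_ι_apply _ _).trans (hm v hv)
      have hG : ∀ a, F (pArrow K κ a) = toLG κ μ a.1 := fun a => FreeAlgebra.lift_ι_apply _ _
      have hP : ∀ p, F (pLoop K κ p) = lP κ μ p := fun p => FreeAlgebra.lift_ι_apply _ _
      have hγ : F (pGamma K κ) = lγ κ μ := FreeAlgebra.lift_ι_apply _ _
      have hV1 := hV _ κ.not_loop
      change ∀ x, IsPinchingRel K κ x → F x = 0
      rintro x (⟨b, a, h⟩ | ⟨p, b, h⟩ | ⟨p, a, h⟩ | ⟨b, a, h, h'⟩ | ⟨b, a, h, h'⟩ | ⟨b, h⟩ | ⟨a, h⟩ |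
        ⟨b, h⟩ | ⟨a, h⟩)
      · rw [map_mul, hG, hG]
        rw [toLG_of_ne κ μ (a := b) (by rw [Λ.rel_path _ _ h]; exact κ.tgt_ne a.2)]
        exact mul_toLG κ μ (lG_mul_lG κ μ h)
      · rw [map_mul, map_sub, map_smul, hG, hP, hV _ (κ.base_ne_tgt p), hp b p h, lG_mul_lP κ μ h]
      · rw [map_mul, map_sub, map_smul, hG, hP, hV _ (κ.base_ne_tgt p)]
        exact mul_toLG κ μ (lP_mul_lG κ μ h)
      · rw [map_mul, hG, hG]
        refine mul_toLG κ μ ?_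
        rw [toLG_of_eq κ μ ((Λ.rel_path _ _ h).trans κ.tgt_eq), lω, mul_add, mul_smul_comm,
          lG_mul_lG κ μ h, smul_zero, add_zero, mul_assoc, lG_mul_lG κ μ h', mul_zero]
      · rw [map_mul, hG, hG]
        refine mul_toLG κ μ ?_
        rw [toLG_of_eq κ μ (Λ.rel_path _ _ h), lω, mul_add, mul_smul_comm,
          lG_mul_lG κ μ h, zero_add, smul_mul_assoc, mul_assoc, lG_mul_lG κ μ h', mul_zero,
          smul_zero]
      · rw [map_mul, map_add, hG, hγ, hV1, lγ_add, toLG_of_eq κ μ (Λ.rel_path _ _ h), mul_smul_comm, mul_assoc,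
          lω_mul_lδ_mul κ μ rfl, lG_mul_lG κ μ h, smul_zero]
      · rw [map_mul, map_add, hG, hγ, hV1]
        refine mul_toLG κ μ ?_
        rw [lγ_add, smul_mul_assoc, mul_assoc, lG_mul_lG κ μ h, mul_zero, smul_zero]
      · rw [map_mul, map_sub, hG, hγ, hV1, lγ_sub, toLG_of_eq κ μ ((Λ.rel_path _ _ h).trans κ.tgt_eq), mul_smul_comm,
          mul_assoc, lω_mul_lδ_mul κ μ κ.tgt_eq, lG_mul_lG κ μ h, smul_zero]
      · rw [map_mul, map_sub, hG, hγ, hV1]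
        refine mul_toLG κ μ ?_
        rw [lγ_sub, smul_mul_assoc, mul_assoc, lG_mul_lG κ μ h, mul_zero, smul_zero])
  exact ⟨Φ, h1, fun a => h2 (Sum.inl a), fun p => h2 (Sum.inr (some p)), h2 (Sum.inr none)⟩

end GradedPinchedGentle

section MatrixTwo

variable {R : Type u}

/-- A matrix with two rows and two columns. -/
def mat (a b c d : R) : Matrix (Fin 2) (Fin 2) R := !![a, b; c, d]

lemma smul_mat {K : Type u} [SMul K R] (r : K) (a b c d : R) :
    r • mat a b c d = mat (r • a) (r • b) (r • c) (r • d) := by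
  ext i j
  fin_cases i <;> fin_cases j <;> rfl

variable [Ring R]

lemma mat_zero : mat 0 0 0 0 = (0 : Matrix (Fin 2) (Fin 2) R) := by
  ext i j
  fin_cases i <;> fin_cases j <;> rfl

lemma mat_add (a b c d a' b' c' d' : R) :
    mat a b c d + mat a' b' c' d' = mat (a + a') (b + b') (c + c') (d + d') := by
  ext i j
  fin_cases i <;> fin_cases j <;> rfl

lemma mat_sub (a b c d a' b' c' d' : R) :
    mat a b c d - mat a' b' c' d' = mat (a - a') (b - b') (c - c') (d - d') := by
  ext i j
  fin_cases i <;> fin_cases j <;> rfl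

lemma mat_mul (a b c d a' b' c' d' : R) : mat a b c d * mat a' b' c' d' =
    mat (a * a' + b * c') (a * b' + b * d') (c * a' + d * c') (c * b' + d * d') :=
  Matrix.mul_fin_two ..

end MatrixTwo

namespace GradedPinchedGentle

open GradedQuiver

variable {Λ : GradedPinchedGentle.{u}} {K : Type u} [Field K] (κ : Λ.Kronecker) (μ : K)

/-- The element of the pinching that corresponds to `δ α`. -/
def pα : (pinching K κ).Alg := (2 : K)⁻¹ • (pγ K κ + p1 K κ)

/-- The element of the pinching that corresponds to `δ β`. -/
def pβ : (pinching K κ).Alg := (-2 * μ)⁻¹ • (pγ K κ - p1 K κ)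

lemma p1_mul_pα : p1 K κ * pα κ = (pα κ : (pinching K κ).Alg) := by
  rw [pα, mul_smul_comm, mul_add, p1_mul_pγ, p1_mul_self]

lemma pα_mul_p1 : pα κ * p1 K κ = (pα κ : (pinching K κ).Alg) := by
  rw [pα, smul_mul_assoc, add_mul, pγ_mul_p1, p1_mul_self]

lemma p1_mul_pβ : p1 K κ * pβ κ μ = pβ κ μ := by
  rw [pβ, mul_smul_comm, mul_sub, p1_mul_pγ, p1_mul_self]

lemma pβ_mul_p1 : pβ κ μ * p1 K κ = pβ κ μ := by
  rw [pβ, smul_mul_assoc, sub_mul, pγ_mul_p1, p1_mul_self]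

variable {μ} in
lemma pα_add_pβ (h2 : (2 : K) ≠ 0) (hμ : μ ≠ 0) : pα κ + μ • pβ κ μ = p1 K κ := by
  have h3 : μ * (-2 * μ)⁻¹ = -(2 : K)⁻¹ := by field_simp
  have h4 : (2 : K)⁻¹ + (2 : K)⁻¹ = 1 := by rw [← two_mul, mul_inv_cancel₀ h2]
  rw [pα, pβ, smul_smul, h3]
  calc _ = ((2 : K)⁻¹ + (2 : K)⁻¹) • p1 K κ := by module
    _ = _ := by rw [h4, one_smul]

variable {μ} in
lemma pα_sub_pβ (h2 : (2 : K) ≠ 0) (hμ : μ ≠ 0) : pα κ - μ • pβ κ μ = pγ K κ := by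
  have h3 : μ * (-2 * μ)⁻¹ = -(2 : K)⁻¹ := by field_simp
  have h4 : (2 : K)⁻¹ + (2 : K)⁻¹ = 1 := by rw [← two_mul, mul_inv_cancel₀ h2]
  rw [pα, pβ, smul_smul, h3]
  calc _ = ((2 : K)⁻¹ + (2 : K)⁻¹) • pγ K κ := by module
    _ = _ := by rw [h4, one_smul]

open Classical in
/-- The images of the trivial paths under the Peirce decomposition of the localization. -/
def matV (v : Λ.V) : Matrix (Fin 2) (Fin 2) (pinching K κ).Alg :=
  if h : v = Λ.tgt κ.α then mat 0 0 0 (p1 K κ) else mat (pV K κ ⟨v, h⟩) 0 0 0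

open Classical in
/-- The images of the arrows of `Qᵍ` under the Peirce decomposition of the localization. -/
def matG (a : Λ.G) : Matrix (Fin 2) (Fin 2) (pinching K κ).Alg :=
  if h : a ≠ κ.α ∧ a ≠ κ.β then
    if Λ.src a = Λ.tgt κ.α then mat 0 (pG K κ ⟨a, h⟩) 0 0 else mat (pG K κ ⟨a, h⟩) 0 0 0
  else if a = κ.α then mat 0 0 (pα κ) 0 else mat 0 0 (pβ κ μ) 0

lemma matV_tgt : matV κ (Λ.tgt κ.α) = mat 0 0 0 (p1 K κ) := dif_pos rfl

lemma matV_ne {v : Λ.V} (h : v ≠ Λ.tgt κ.α) : matV κ v = mat (pV K κ ⟨v, h⟩) 0 0 0 := dif_neg h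

lemma matV_src : matV κ (Λ.src κ.α) = mat (p1 K κ) 0 0 0 := matV_ne κ κ.not_loop

lemma matG_α : matG κ μ κ.α = mat 0 0 (pα κ) 0 := by
  rw [matG, dif_neg (fun h => h.1 rfl), if_pos rfl]

lemma matG_β : matG κ μ κ.β = mat 0 0 (pβ κ μ) 0 := by
  rw [matG, dif_neg (fun h => h.2 rfl), if_neg κ.ne.symm]

lemma matG_eq {a : Λ.G} (h : Λ.src a = Λ.tgt κ.α) :
    matG κ μ a = mat 0 (pG K κ ⟨a, κ.ne_of_src_eq_tgt h⟩) 0 0 := by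
  rw [matG, dif_pos (κ.ne_of_src_eq_tgt h), if_pos h]

lemma matG_ne {a : Λ.G} (ha : a ≠ κ.α ∧ a ≠ κ.β) (h : Λ.src a ≠ Λ.tgt κ.α) :
    matG κ μ a = mat (pG K κ ⟨a, ha⟩) 0 0 0 := by
  rw [matG, dif_pos ha, if_neg h]

lemma mat_mul_matG {x y : (pinching K κ).Alg} {a : Λ.G} (ha : a ≠ κ.α ∧ a ≠ κ.β)
    (hx : x * pG K κ ⟨a, ha⟩ = 0) (hy : y * pG K κ ⟨a, ha⟩ = 0) :
    mat x 0 y 0 * matG κ μ a = 0 := by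
  by_cases h : Λ.src a = Λ.tgt κ.α
  · rw [matG_eq κ μ h, mat_mul, hx, hy]
    simp [mat_zero]
  · rw [matG_ne κ μ ha h, mat_mul, hx, hy]
    simp [mat_zero]

lemma matG_mul_matG {b a : Λ.G} (h : Λ.rel b a) : matG κ μ b * matG κ μ a = 0 := by
  have hp := Λ.rel_path _ _ h
  by_cases hb : b = κ.α
  · subst hb
    have ha := κ.ne_of_tgt_eq_src hp.symm
    rw [matG_α]
    refine mat_mul_matG κ μ ha (zero_mul _) ?_
    rw [pα, smul_mul_assoc, add_mul_pG K κ (a := ⟨a, ha⟩) h, smul_zero]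
  by_cases hb' : b = κ.β
  · subst hb'
    have ha := κ.ne_of_tgt_eq_src (hp.symm.trans κ.src_eq)
    rw [matG_β]
    refine mat_mul_matG κ μ ha (zero_mul _) ?_
    rw [pβ, smul_mul_assoc, sub_mul_pG K κ (a := ⟨a, ha⟩) h, smul_zero]
  by_cases ha : a = κ.α
  · subst ha
    rw [matG_α, matG_eq κ μ hp, mat_mul, pα, mul_smul_comm,
      pG_mul_add K κ (b := ⟨b, hb, hb'⟩) h]
    simp [mat_zero]
  by_cases ha' : a = κ.β
  · subst ha'
    rw [matG_β, matG_eq κ μ (hp.trans κ.tgt_eq), mat_mul, pβ, mul_smul_comm,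
      pG_mul_sub K κ (b := ⟨b, hb, hb'⟩) h]
    simp [mat_zero]
  · rw [matG_ne κ μ ⟨hb, hb'⟩ (by rw [hp]; exact κ.tgt_ne ⟨ha, ha'⟩)]
    exact mat_mul_matG κ μ ⟨ha, ha'⟩ (pG_mul_pG K κ (b := ⟨b, hb, hb'⟩) (a := ⟨a, ha, ha'⟩) h)
      (zero_mul _)

lemma matV_mul_matG (a : Λ.G) : matV κ (Λ.tgt a) * matG κ μ a = matG κ μ a := by
  by_cases ha : a = κ.α
  · subst ha
    rw [matV_tgt, matG_α, mat_mul, p1_mul_pα]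
    simp
  by_cases ha' : a = κ.β
  · subst ha'
    rw [κ.tgt_eq, matV_tgt, matG_β, mat_mul, p1_mul_pβ]
    simp
  have hg := pV_mul_pG K κ ⟨a, ha, ha'⟩
  rw [matV_ne κ (κ.tgt_ne ⟨ha, ha'⟩)]
  by_cases h : Λ.src a = Λ.tgt κ.α
  · rw [matG_eq κ μ h, mat_mul, hg]
    simp
  · rw [matG_ne κ μ ⟨ha, ha'⟩ h, mat_mul, hg]
    simp

lemma matG_mul_matV (a : Λ.G) : matG κ μ a * matV κ (Λ.src a) = matG κ μ a := by
  by_cases ha : a = κ.α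
  · subst ha
    rw [matV_src, matG_α, mat_mul, pα_mul_p1]
    simp
  by_cases ha' : a = κ.β
  · subst ha'
    rw [κ.src_eq, matV_src, matG_β, mat_mul, pβ_mul_p1]
    simp
  by_cases h : Λ.src a = Λ.tgt κ.α
  · rw [matG_eq κ μ h, h, matV_tgt, mat_mul, pG_mul_p1 K κ _ h]
    simp
  · rw [matG_ne κ μ ⟨ha, ha'⟩ h, matV_ne κ h, mat_mul, pG_mul_pV K κ ⟨a, ha, ha'⟩ h]
    simp

variable {μ} in
lemma matG_α_add (h2 : (2 : K) ≠ 0) (hμ : μ ≠ 0) :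
    matG κ μ κ.α + μ • matG κ μ κ.β = mat 0 0 (p1 K κ) 0 := by
  rw [matG_α, matG_β, smul_mat, mat_add, pα_add_pβ κ h2 hμ]
  simp

variable {μ} in
lemma exists_localization_to_pinching (h2 : (2 : K) ≠ 0) (hμ : μ ≠ 0) :
    ∃ Ψ : (localization κ μ).Alg →ₙₐ[K] Matrix (Fin 2) (Fin 2) (pinching K κ).Alg,
      (∀ v, Ψ (lV κ μ v) = matV κ v) ∧ (∀ a, Ψ (lG κ μ a) = matG κ μ a) ∧
      (∀ p, Ψ (lP κ μ p) = mat (pP K κ p) 0 0 0) ∧ Ψ (lδ κ μ) = mat 0 (p1 K κ) 0 0 := by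
  let f : (localization κ μ).V → Matrix (Fin 2) (Fin 2) (pinching K κ).Alg := matV κ
  let g : (localization κ μ).E → Matrix (Fin 2) (Fin 2) (pinching K κ).Alg := fun x =>
    x.elim (mat 0 (p1 K κ) 0 0) (Sum.elim (matG κ μ) fun p => mat (pP K κ p) 0 0 0)
  obtain ⟨Ψ, h1, h2⟩ := (localization κ μ).exists_nonUnitalAlgHom f g
    (fun v => by
      change matV κ v * matV κ v = matV κ v
      by_cases hv : v = Λ.tgt κ.α
      · rw [hv, matV_tgt, mat_mul, p1_mul_self]
        simp
      · rw [matV_ne κ hv, mat_mul, pV_mul_self]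
        simp)
    (fun v w hvw => by
      change matV κ v * matV κ w = 0
      by_cases hv : v = Λ.tgt κ.α
      · have hw : w ≠ Λ.tgt κ.α := fun h => hvw (hv.trans h.symm)
        rw [hv, matV_tgt, matV_ne κ hw, mat_mul]
        simp [mat_zero]
      · by_cases hw : w = Λ.tgt κ.α
        · rw [hw, matV_tgt, matV_ne κ hv, mat_mul]
          simp [mat_zero]
        · rw [matV_ne κ hv, matV_ne κ hw, mat_mul,
            pV_mul_of_ne K κ fun h => hvw (congrArg Subtype.val h)]
          simp [mat_zero])
    (by
      rintro (_ | a | p)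
      · change matV κ (Λ.src κ.α) * mat 0 (p1 K κ) 0 0 = mat 0 (p1 K κ) 0 0
        rw [matV_src, mat_mul, p1_mul_self]
        simp
      · exact matV_mul_matG κ μ a
      · change matV κ (Λ.base p) * mat (pP K κ p) 0 0 0 = mat (pP K κ p) 0 0 0
        rw [matV_ne κ (κ.base_ne_tgt p), mat_mul, pV_mul_pP]
        simp)
    (by
      rintro (_ | a | p)
      · change mat 0 (p1 K κ) 0 0 * matV κ (Λ.tgt κ.α) = mat 0 (p1 K κ) 0 0
        rw [matV_tgt, mat_mul, p1_mul_self]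
        simp
      · exact matG_mul_matV κ μ a
      · change mat (pP K κ p) 0 0 0 * matV κ (Λ.base p) = mat (pP K κ p) 0 0 0
        rw [matV_ne κ (κ.base_ne_tgt p), mat_mul, pP_mul_pV]
        simp)
    (by
      let F : ((Λ.boundQuiver K).addInverse (Sum.inl κ.α)).Free K →ₐ[K]
          Matrix (Fin 2) (Fin 2) (pinching K κ).Alg := FreeAlgebra.lift K (Sum.elim f g)
      let F' : Λ.quiver.Free K →ₐ[K] Matrix (Fin 2) (Fin 2) (pinching K κ).Alg :=
        F.comp ((Λ.boundQuiver K).incl (Sum.inl κ.α))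
      have hF : ∀ x, F (FreeAlgebra.ι K x) = Sum.elim f g x := FreeAlgebra.lift_ι_apply _
      have hF' : ∀ x, F' (FreeAlgebra.ι K x) = Sum.elim f g (Sum.map id some x) := fun x =>
        (congrArg F (FreeAlgebra.lift_ι_apply _ _)).trans (hF _)
      have hV : ∀ v : Λ.V, F' (Λ.quiver.vertex v) = matV κ v := fun v => hF' _
      have hG : ∀ a, F' (Λ.quiver.arrow (Sum.inl a)) = matG κ μ a := fun a => hF' _
      have hP : ∀ p, F' (Λ.quiver.arrow (Sum.inr p)) = mat (pP K κ p) 0 0 0 := fun p => hF' _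
      have hFω : F (arrow _ (some (Sum.inl κ.α)) + μ • arrow _ (some (Sum.inl κ.β))) =
          mat 0 0 (p1 K κ) 0 :=
        ((map_add F _ _).trans (congrArg₂ _ (hF _)
          ((map_smul F _ _).trans (congrArg _ (hF _))))).trans (matG_α_add κ h2 hμ)
      rintro x (⟨x, hx, rfl⟩ | rfl | rfl)
      · change F' x = 0
        rcases hx with ⟨b, a, h⟩ | ⟨p, b, h⟩ | ⟨p, a, h⟩
        · rw [map_mul, hG, hG, matG_mul_matG κ μ h]
        · have hb := κ.ne_of_src_eq_base h
          rw [map_mul, map_sub, map_smul, hG, hP, hV, matV_ne κ (κ.base_ne_tgt p),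
            matG_ne κ μ hb (by rw [h]; exact κ.base_ne_tgt p), smul_mat, mat_sub, mat_mul,
            pG_mul_pP K κ (b := ⟨b, hb⟩) h]
          simp [mat_zero]
        · have ha := κ.ne_of_tgt_eq_base h
          rw [map_mul, map_sub, map_smul, hG, hP, hV, matV_ne κ (κ.base_ne_tgt p), smul_mat,
            mat_sub]
          simp only [smul_zero, sub_zero]
          exact mat_mul_matG κ μ ha (pP_mul_pG K κ (a := ⟨a, ha⟩) h) (zero_mul _)
      · refine (map_sub F _ _).trans (sub_eq_zero.2 ?_)
        refine ((map_mul F _ _).trans (congrArg₂ _ (hF _) hFω)).trans (Eq.trans ?_ (hF _).symm)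
        change mat 0 (p1 K κ) 0 0 * mat 0 0 (p1 K κ) 0 = matV κ (Λ.src κ.α)
        rw [matV_src, mat_mul, p1_mul_self]
        simp
      · refine (map_sub F _ _).trans (sub_eq_zero.2 ?_)
        refine ((map_mul F _ _).trans (congrArg₂ _ hFω (hF _))).trans (Eq.trans ?_ (hF _).symm)
        change mat 0 0 (p1 K κ) 0 * mat 0 (p1 K κ) 0 0 = matV κ (Λ.tgt κ.α)
        rw [matV_tgt, mat_mul, p1_mul_self]
        simp)
  exact ⟨Ψ, h1, fun a => h2 (some (Sum.inl a)), fun p => h2 (some (Sum.inr p)), h2 none⟩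

end GradedPinchedGentle

namespace GradedPinchedGentle

open GradedQuiver

variable {Λ : GradedPinchedGentle.{u}} {K : Type u} [Field K] (κ : Λ.Kronecker) (μ : K)

/-- The sum of the trivial paths of the localization except the one at the target. -/
def lE : (localization κ μ).Alg := 1 - lV κ μ (Λ.tgt κ.α)

section

variable {κ μ} {x : (localization κ μ).Alg}

lemma lE_mul_of_zero (h : lV κ μ (Λ.tgt κ.α) * x = 0) : lE κ μ * x = x := by
  rw [lE, sub_mul, one_mul, h, sub_zero]

lemma lE_mul_of_self (h : lV κ μ (Λ.tgt κ.α) * x = x) : lE κ μ * x = 0 := by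
  rw [lE, sub_mul, one_mul, h, sub_self]

lemma mul_lE_of_zero (h : x * lV κ μ (Λ.tgt κ.α) = 0) : x * lE κ μ = x := by
  rw [lE, mul_sub, mul_one, h, sub_zero]

lemma mul_lE_of_self (h : x * lV κ μ (Λ.tgt κ.α) = x) : x * lE κ μ = 0 := by
  rw [lE, mul_sub, mul_one, h, sub_self]

lemma lδ_mul_of_zero (h : lV κ μ (Λ.tgt κ.α) * x = 0) : lδ κ μ * x = 0 := by
  rw [← lδ_mul_lV, mul_assoc, h, mul_zero]

lemma mul_lω_of_zero (h : x * lV κ μ (Λ.tgt κ.α) = 0) : x * lω κ μ = 0 := by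
  rw [← lV_mul_lω, ← mul_assoc, h, zero_mul]

lemma lV_mul_of_lV_mul {v : Λ.V} (hv : v ≠ Λ.tgt κ.α) (h : lV κ μ v * x = x) :
    lV κ μ (Λ.tgt κ.α) * x = 0 := by
  rw [← h, ← mul_assoc, lV_mul_of_ne κ μ hv.symm, zero_mul]

lemma mul_lV_of_mul_lV {v : Λ.V} (hv : v ≠ Λ.tgt κ.α) (h : x * lV κ μ v = x) :
    x * lV κ μ (Λ.tgt κ.α) = 0 := by
  rw [← h, mul_assoc, lV_mul_of_ne κ μ hv, mul_zero]

end

lemma lE_mul_self : lE κ μ * lE κ μ = lE κ μ :=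
  lE_mul_of_zero (by rw [lE, mul_sub, mul_one, lV_mul_self, sub_self])

lemma lE_add : lE κ μ + lω κ μ * lδ κ μ = 1 := by
  rw [lω_mul_lδ, lE, sub_add_cancel]

lemma lE_mul_lδ : lE κ μ * lδ κ μ = lδ κ μ :=
  lE_mul_of_zero (lV_mul_of_lV_mul κ.not_loop (lV_mul_lδ κ μ))

lemma lδ_mul_lE : lδ κ μ * lE κ μ = 0 := mul_lE_of_self (lδ_mul_lV κ μ)

lemma lω_mul_lE : lω κ μ * lE κ μ = lω κ μ :=
  mul_lE_of_zero (mul_lV_of_mul_lV κ.not_loop (lω_mul_lV κ μ))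

lemma lE_mul_lω : lE κ μ * lω κ μ = 0 := lE_mul_of_self (lV_mul_lω κ μ)

section Comparison

variable {κ μ} {Φ : (pinching K κ).Alg →ₙₐ[K] (localization κ μ).Alg}
  {Ψ : (localization κ μ).Alg →ₙₐ[K] Matrix (Fin 2) (Fin 2) (pinching K κ).Alg}

lemma map_one_eq_lE (hΦV : ∀ v, Φ (pV K κ v) = lV κ μ v.1) : Φ 1 = lE κ μ := by
  classical
  have h : Φ 1 = ∑ v : {v : Λ.V // v ≠ Λ.tgt κ.α}, lV κ μ v.1 := by
    rw [← (pinching K κ).sum_idem, map_sum]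
    exact Finset.sum_congr (by
      ext v
      exact ⟨fun _ => Finset.mem_univ v, fun _ => Finset.mem_univ v⟩) fun v _ => hΦV v
  rw [h, lE, ← sum_lV, ← Finset.sum_erase_eq_sub (Finset.mem_univ _)]
  exact (Finset.sum_subtype _ (by simp) _).symm

lemma map_map_eq_mat (h2 : (2 : K) ≠ 0) (hμ : μ ≠ 0) (hΦV : ∀ v, Φ (pV K κ v) = lV κ μ v.1)
    (hΦG : ∀ a, Φ (pG K κ a) = toLG κ μ a.1) (hΦP : ∀ p, Φ (pP K κ p) = lP κ μ p)
    (hΦγ : Φ (pγ K κ) = lγ κ μ) (hΨV : ∀ v, Ψ (lV κ μ v) = matV κ v)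
    (hΨG : ∀ a, Ψ (lG κ μ a) = matG κ μ a) (hΨP : ∀ p, Ψ (lP κ μ p) = mat (pP K κ p) 0 0 0)
    (hΨδ : Ψ (lδ κ μ) = mat 0 (p1 K κ) 0 0) (b : (pinching K κ).Alg) :
    Ψ (Φ b) = mat b 0 0 0 := by
  have hω : Ψ (lω κ μ) = mat 0 0 (p1 K κ) 0 := by
    rw [lω, map_add, map_smul, hΨG, hΨG, matG_α_add κ h2 hμ]
  induction b using GradedBoundQuiver.alg_induction with
  | hv v => exact (congrArg Ψ (hΦV v)).trans ((hΨV v.1).trans (matV_ne κ v.2))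
  | ha a =>
    rcases a with a | _ | p
    · refine (congrArg Ψ (hΦG a)).trans ?_
      by_cases h : Λ.src a.1 = Λ.tgt κ.α
      · rw [toLG_of_eq κ μ h, map_mul, hΨG, hω, matG_eq κ μ h, mat_mul, pG_mul_p1 K κ a h]
        simp
        rfl
      · rw [toLG_of_ne κ μ h, hΨG, matG_ne κ μ a.2 h]
        rfl
    · refine (congrArg Ψ hΦγ).trans ?_
      rw [lγ, map_sub, map_smul, map_mul, map_mul, hΨδ, hΨG, hΨG, matG_α, matG_β, mat_mul,
        mat_mul, smul_mat, mat_sub, p1_mul_pα, p1_mul_pβ]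
      simp only [zero_mul, mul_zero, add_zero, zero_add, smul_zero, sub_zero]
      rw [pα_sub_pβ κ h2 hμ]
      rfl
    · exact (congrArg Ψ (hΦP p)).trans (hΨP p)
  | zero => rw [map_zero, map_zero, mat_zero]
  | add x y hx hy => rw [map_add, map_add, hx, hy, mat_add]; simp
  | smul c x hx => rw [map_smul, map_smul, hx, smul_mat]; simp
  | mul x y hx hy => rw [map_mul, map_mul, hx, hy, mat_mul]; simp

/-- The Peirce decomposition of an element of the localization. -/
def IsPeirce (Φ : (pinching K κ).Alg →ₙₐ[K] (localization κ μ).Alg)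
    (m : Matrix (Fin 2) (Fin 2) (pinching K κ).Alg) (a : (localization κ μ).Alg) : Prop :=
  ∀ i j, Φ (m i j) = ![lE κ μ, lδ κ μ] i * a * ![lE κ μ, lω κ μ] j

lemma isPeirce_mat {x y z t : (pinching K κ).Alg} {a : (localization κ μ).Alg}
    (hx : Φ x = lE κ μ * a * lE κ μ) (hy : Φ y = lE κ μ * a * lω κ μ)
    (hz : Φ z = lδ κ μ * a * lE κ μ) (ht : Φ t = lδ κ μ * a * lω κ μ) :
    IsPeirce Φ (mat x y z t) a := by
  intro i j
  fin_cases i <;> fin_cases j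
  exacts [hx, hy, hz, ht]

lemma IsPeirce.mul {m n : Matrix (Fin 2) (Fin 2) (pinching K κ).Alg}
    {a b : (localization κ μ).Alg} (hm : IsPeirce Φ m a) (hn : IsPeirce Φ n b) :
    IsPeirce Φ (m * n) (a * b) := by
  intro i j
  rw [Matrix.mul_apply, Fin.sum_univ_two, map_add, map_mul, map_mul, hm, hm, hn, hn]
  generalize ![lE κ μ, lδ κ μ] i = u
  generalize ![lE κ μ, lω κ μ] j = w
  change u * a * lE κ μ * (lE κ μ * b * w) + u * a * lω κ μ * (lδ κ μ * b * w) = _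
  have h : u * a * lE κ μ * (lE κ μ * b * w) + u * a * lω κ μ * (lδ κ μ * b * w) =
      u * a * (lE κ μ * lE κ μ + lω κ μ * lδ κ μ) * (b * w) := by noncomm_ring
  rw [h, lE_mul_self, lE_add]
  noncomm_ring

lemma isPeirce_matG (h2 : (2 : K) ≠ 0) (hμ : μ ≠ 0) (hΦV : ∀ v, Φ (pV K κ v) = lV κ μ v.1)
    (hΦG : ∀ a, Φ (pG K κ a) = toLG κ μ a.1) (hΦγ : Φ (pγ K κ) = lγ κ μ) (a : Λ.G) :
    IsPeirce Φ (matG κ μ a) (lG κ μ a) := by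
  have hs := lG_mul_lV κ μ a
  have ht := lV_mul_lG κ μ a
  by_cases ha : a = κ.α
  · subst ha
    have hs' := mul_lV_of_mul_lV κ.not_loop hs
    have hα : Φ (pα κ) = lδ κ μ * lG κ μ κ.α := by
      rw [pα, map_smul, map_add, hΦγ, p1, hΦV, lγ_add, inv_smul_smul₀ h2]
    rw [matG_α]
    apply isPeirce_mat
    · rw [map_zero, lE_mul_of_self ht, zero_mul]
    · rw [map_zero, lE_mul_of_self ht, zero_mul]
    · rw [mul_assoc, mul_lE_of_zero hs', hα]
    · rw [map_zero, mul_assoc, mul_lω_of_zero hs', mul_zero]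
  by_cases ha' : a = κ.β
  · subst ha'
    rw [κ.tgt_eq] at ht
    rw [κ.src_eq] at hs
    have hs' := mul_lV_of_mul_lV κ.not_loop hs
    have hβ : Φ (pβ κ μ) = lδ κ μ * lG κ μ κ.β := by
      rw [pβ, map_smul, map_sub, hΦγ, p1, hΦV, lγ_sub,
        inv_smul_smul₀ (mul_ne_zero (neg_ne_zero.2 h2) hμ)]
    rw [matG_β]
    apply isPeirce_mat
    · rw [map_zero, lE_mul_of_self ht, zero_mul]
    · rw [map_zero, lE_mul_of_self ht, zero_mul]
    · rw [mul_assoc, mul_lE_of_zero hs', hβ]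
    · rw [map_zero, mul_assoc, mul_lω_of_zero hs', mul_zero]
  have ht' := lV_mul_of_lV_mul (κ.tgt_ne ⟨ha, ha'⟩) ht
  by_cases h : Λ.src a = Λ.tgt κ.α
  · rw [h] at hs
    rw [matG_eq κ μ h]
    apply isPeirce_mat
    · rw [map_zero, mul_assoc, mul_lE_of_self hs, mul_zero]
    · rw [hΦG, toLG_of_eq κ μ h, lE_mul_of_zero ht']
    · rw [map_zero, lδ_mul_of_zero ht', zero_mul]
    · rw [map_zero, lδ_mul_of_zero ht', zero_mul]
  · have hs' := mul_lV_of_mul_lV h hs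
    rw [matG_ne κ μ ⟨ha, ha'⟩ h]
    apply isPeirce_mat
    · rw [hΦG, toLG_of_ne κ μ h, lE_mul_of_zero ht', mul_lE_of_zero hs']
    · rw [map_zero, mul_assoc, mul_lω_of_zero hs', mul_zero]
    · rw [map_zero, lδ_mul_of_zero ht', zero_mul]
    · rw [map_zero, lδ_mul_of_zero ht', zero_mul]

lemma isPeirce_matV (hΦV : ∀ v, Φ (pV K κ v) = lV κ μ v.1) (v : Λ.V) :
    IsPeirce Φ (matV κ v) (lV κ μ v) := by
  have hv := lV_mul_self κ μ v
  by_cases h : v = Λ.tgt κ.α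
  · subst h
    rw [matV_tgt]
    apply isPeirce_mat
    · rw [map_zero, lE_mul_of_self hv, zero_mul]
    · rw [map_zero, lE_mul_of_self hv, zero_mul]
    · rw [map_zero, mul_assoc, mul_lE_of_self hv, mul_zero]
    · rw [p1, hΦV, mul_assoc, lV_mul_lω, lδ_mul_lω]
  · have h1 := lV_mul_of_lV_mul h hv
    have h2 := mul_lV_of_mul_lV h hv
    rw [matV_ne κ h]
    apply isPeirce_mat
    · rw [hΦV, lE_mul_of_zero h1, mul_lE_of_zero h2]
    · rw [map_zero, mul_assoc, mul_lω_of_zero h2, mul_zero]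
    · rw [map_zero, lδ_mul_of_zero h1, zero_mul]
    · rw [map_zero, lδ_mul_of_zero h1, zero_mul]

lemma isPeirce_map (h2 : (2 : K) ≠ 0) (hμ : μ ≠ 0) (hΦV : ∀ v, Φ (pV K κ v) = lV κ μ v.1)
    (hΦG : ∀ a, Φ (pG K κ a) = toLG κ μ a.1) (hΦP : ∀ p, Φ (pP K κ p) = lP κ μ p)
    (hΦγ : Φ (pγ K κ) = lγ κ μ) (hΨV : ∀ v, Ψ (lV κ μ v) = matV κ v)
    (hΨG : ∀ a, Ψ (lG κ μ a) = matG κ μ a) (hΨP : ∀ p, Ψ (lP κ μ p) = mat (pP K κ p) 0 0 0)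
    (hΨδ : Ψ (lδ κ μ) = mat 0 (p1 K κ) 0 0) (a : (localization κ μ).Alg) :
    IsPeirce Φ (Ψ a) a := by
  induction a using GradedBoundQuiver.alg_induction with
  | hv v =>
    have h : ∀ v : Λ.V, IsPeirce Φ (Ψ (lV κ μ v)) (lV κ μ v) := fun v => by
      rw [hΨV]
      exact isPeirce_matV hΦV v
    exact h v
  | ha a =>
    rcases a with _ | a | p
    · change IsPeirce Φ (Ψ (lδ κ μ)) (lδ κ μ)
      have h := lV_mul_of_lV_mul κ.not_loop (lV_mul_lδ κ μ)
      rw [hΨδ]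
      apply isPeirce_mat
      · rw [map_zero, mul_assoc, lδ_mul_lE, mul_zero]
      · rw [p1, hΦV, lE_mul_lδ, lδ_mul_lω]
      · rw [map_zero, lδ_mul_of_zero h, zero_mul]
      · rw [map_zero, lδ_mul_of_zero h, zero_mul]
    · have := isPeirce_matG h2 hμ hΦV hΦG hΦγ a
      rwa [← hΨG] at this
    · change IsPeirce Φ (Ψ (lP κ μ p)) (lP κ μ p)
      have h1 := lV_mul_of_lV_mul (κ.base_ne_tgt p) (lV_mul_lP κ μ p)
      have h2 := mul_lV_of_mul_lV (κ.base_ne_tgt p) (lP_mul_lV κ μ p)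
      rw [hΨP]
      apply isPeirce_mat
      · rw [hΦP, lE_mul_of_zero h1, mul_lE_of_zero h2]
      · rw [map_zero, mul_assoc, mul_lω_of_zero h2, mul_zero]
      · rw [map_zero, lδ_mul_of_zero h1, zero_mul]
      · rw [map_zero, lδ_mul_of_zero h1, zero_mul]
  | zero =>
    intro i j
    rw [map_zero, Matrix.zero_apply, map_zero, mul_zero, zero_mul]
  | add x y hx hy =>
    intro i j
    rw [map_add, Matrix.add_apply, map_add, hx, hy, mul_add, add_mul]
  | smul c x hx =>
    intro i j
    rw [map_smul, Matrix.smul_apply, map_smul, hx, mul_smul_comm, smul_mul_assoc]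
  | mul x y hx hy =>
    rw [map_mul]
    exact hx.mul hy

end Comparison

lemma lδ_mem : lδ κ μ ∈ (localization κ μ).grading (-Λ.deg κ.α) := (localization κ μ).arr_mem none

lemma lG_mem (a : Λ.G) : lG κ μ a ∈ (localization κ μ).grading (Λ.deg a) :=
  (localization κ μ).arr_mem (some (Sum.inl a))

lemma lω_mem : lω κ μ ∈ (localization κ μ).grading (Λ.deg κ.α) := by
  have h := lG_mem κ μ κ.β
  rw [κ.deg_eq] at h
  exact add_mem (lG_mem κ μ κ.α) (Submodule.smul_mem _ _ h)

lemma lγ_mem : lγ κ μ ∈ (localization κ μ).grading 0 := by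
  have h1 := SetLike.mul_mem_graded (lδ_mem κ μ) (lG_mem κ μ κ.α)
  have h2 := SetLike.mul_mem_graded (lδ_mem κ μ) (lG_mem κ μ κ.β)
  rw [κ.deg_eq] at h2
  rw [neg_add_cancel] at h1 h2
  exact sub_mem h1 (Submodule.smul_mem _ _ h2)

lemma toLG_mem (a : {a : Λ.G // a ≠ κ.α ∧ a ≠ κ.β}) :
    toLG κ μ a.1 ∈ (localization κ μ).grading ((pinchingQuiver κ).deg (Sum.inl a)) := by
  classical
  change _ ∈ (localization κ μ).grading (if Λ.rel a.1 κ.β then Λ.deg a.1 + Λ.deg κ.α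
      else if Λ.rel a.1 κ.α then Λ.deg a.1 + Λ.deg κ.β else Λ.deg a.1)
  rw [κ.deg_eq]
  by_cases h : Λ.src a.1 = Λ.tgt κ.α
  · rw [toLG_of_eq κ μ h]
    have hm := SetLike.mul_mem_graded (lG_mem κ μ a.1) (lω_mem κ μ)
    split_ifs with h1 h2
    · exact hm
    · exact hm
    · exact absurd (Λ.path_right_unique _ _ _ h (h.trans κ.tgt_eq.symm) h2 h1) κ.ne
  · rw [toLG_of_ne κ μ h, if_neg fun h1 => h ((Λ.rel_path _ _ h1).trans κ.tgt_eq),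
      if_neg fun h1 => h (Λ.rel_path _ _ h1)]
    exact lG_mem κ μ a.1

variable {μ}

/-- The pinching is the corner of the localization at the complement of the target. -/
lemma nonempty_cornerData (h2 : (2 : K) ≠ 0) (hμ : μ ≠ 0) :
    Nonempty (CornerData (localization κ μ).grading (pinching K κ).grading) := by
  obtain ⟨Φ, hΦV, hΦG, hΦP, hΦγ⟩ := exists_pinching_to_localization κ μ
  obtain ⟨Ψ, hΨV, hΨG, hΨP, hΨδ⟩ := exists_localization_to_pinching κ h2 hμ
  have h1 := map_one_eq_lE hΦV
  have hΨΦ := map_map_eq_mat h2 hμ hΦV hΦG hΦP hΦγ hΨV hΨG hΨP hΨδ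
  have hΦΨ : ∀ a, Φ (Ψ a 0 0) = lE κ μ * a * lE κ μ := fun a =>
    isPeirce_map h2 hμ hΦV hΦG hΦP hΦγ hΨV hΨG hΨP hΨδ a 0 0
  have hpφ : ∀ b, Ψ (Φ b) 0 0 = b := fun b => by
    rw [hΨΦ]
    rfl
  have hΦi : Function.Injective Φ := fun b b' h => by rw [← hpφ b, h, hpφ]
  have hV0 : ∀ v, Φ (pV K κ v) ∈ (localization κ μ).grading 0 := fun v => by
    rw [hΦV]
    exact (localization κ μ).idem_mem v.1
  have hΦm : ∀ {n b}, b ∈ (pinching K κ).grading n → Φ b ∈ (localization κ μ).grading n :=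
    GradedBoundQuiver.map_mem_of_gen Φ hV0
      (by
        rintro (a | _ | p)
        · have := toLG_mem κ μ a
          rwa [← hΦG] at this
        · have := lγ_mem κ μ
          rwa [← hΦγ] at this
        · have : lP κ μ p ∈ (localization κ μ).grading 0 :=
            (localization κ μ).arr_mem (some (Sum.inr p))
          rwa [← hΦP] at this)
  have hE : lE κ μ ∈ (localization κ μ).grading 0 := by
    rw [← h1]
    exact hΦm SetLike.GradedOne.one_mem
  exact ⟨{
    φ := Φ
    p :=
      { toFun a := Ψ a 0 0
        map_add' x y := by rw [map_add, Matrix.add_apply]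
        map_smul' c x := by rw [map_smul, Matrix.smul_apply, RingHom.id_apply] }
    p_φ := hpφ
    φ_p a := by
      rw [h1]
      exact hΦΨ a
    δ := lδ κ μ
    ω := lω κ μ
    e_δ := by rw [h1, lE_mul_lδ]
    δ_e := by rw [h1, lδ_mul_lE]
    ω_e := by rw [h1, lω_mul_lE]
    e_ω := by rw [h1, lE_mul_lω]
    add_eq := by rw [h1, lE_add]
    φ_mem := hΦm
    p_mem {n a} ha := by
      refine mem_of_injective_graded (𝒜 := (localization κ μ).grading) Φ hΦi hΦm ?_
      have := SetLike.mul_mem_graded (SetLike.mul_mem_graded hE ha) hE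
      rw [zero_add, add_zero] at this
      rw [← hΦΨ] at this
      exact this
    deg := Λ.deg κ.α
    ω_mem := lω_mem κ μ
    δ_mem := lδ_mem κ μ }⟩

end GradedPinchedGentle

end

theorem mainTheorem10 {K : Type u} [Field K] (hK : ringChar K ≠ 2) (Λ : GradedPinchedGentle.{u})
    (κ : Λ.Kronecker) (μ : K) (hμ : μ ≠ 0) :
    (GradedPinchedGentle.localization κ μ).DerivedEquivalent (GradedPinchedGentle.pinching K κ) ∧
    (GradedPinchedGentle.localization κ μ).PerfectEquivalent (GradedPinchedGentle.pinching K κ) := by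
  obtain ⟨S⟩ := GradedPinchedGentle.nonempty_cornerData κ (Ring.two_ne_zero hK) hμ
  exact ⟨S.derived_triangleEquivalent, S.perfect_triangleEquivalent⟩
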